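/- Let $m,\ell\ge 1$ be integers and $p$ a real number with $m>p\ge 2$. Write $r=|x|$, $y_i=x_i/r$ on $\mathbb R^m\setminus\{0\}$, and define $u^{(\ell)}=(u^{(\ell)}_{i_1\dots i_\ell})_{1\le i_1,\dots,i_\ell\le m}\colon\mathbb R^m\setminus\{0\}\to\mathbb R^{m^\ell}$ by $u^{(1)}_{i_1}=y_{i_1}$ and, for $\ell\ge 2$, $$u^{(\ell)}_{i_1\dots i_\ell}=\sqrt{\tfrac{\ell+m-3}{2\ell+m-4}}\,\Big(y_{i_\ell}\,u^{(\ell-1)}_{i_1\dots i_{\ell-1}}-\tfrac{1}{\ell+m-3}\,r\,\tfrac{\partial}{\partial x_{i_\ell}}u^{(\ell-1)}_{i_1\dots i_{\ell-1}}\Big).$$ Let $B^m\subset\mathbb R^m$ be the open unit ball and let $u_\star^{(\ell)}=(u^{(\ell)},0)\colon B^m\to\mathbb S^{m^\ell}\subset\mathbb R^{m^\ell}\times\mathbb R$ be the generalized equator map (defined almost everywhere). Write $W^{1,p}(B^m,\mathbb S^{n})$ for the maps in $W^{1,p}(B^m,\mathbb R^{n+1})$ with $|u|=1$ almost everywhere,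 and $E_p(u)=\frac1p\int_{B^m}|\nabla u|^p\,dx$, where $|\nabla u|^2=\sum_i|\partial_i u|^2$. A map $u\in W^{1,p}(B^m,\mathbb S^n)$ is called $p$-harmonic if $\operatorname{div}(|\nabla u|^{p-2}\nabla u)+|\nabla u|^pu=0$ in the sense of distributions on $B^m$. A $p$-harmonic map $u$ is called unstable if there is a bounded $\eta\in W^{1,p}_0(B^m,\mathbb R^{n+1})$ such that, for the variation $u_t=\frac{u+t\eta}{|u+t\eta|}$, the second derivative $\frac{d^2}{dt^2}E_p(u_t)\big|_{t=0}$ exists and is negative. 1. If $(m-p)^2<4\ell(\ell+m-2)$, then $u_\star^{(\ell)}$ is an unstable $p$-harmonic map. 2. If $(m-p)^2\ge 4\ell(\ell+m-2)$, then $u_\star^{(\ell)}$ is a $p$-harmonic map and it is the unique minimizer of the $p$-energy among maps with the same boundary values: for every $w\in W^{1,p}(B^m,\mathbb S^{m^\ell})$ with $u_\star^{(\ell)}-w\in W^{1,p}_0(B^m,\mathbb R^{m^\ell+1})$ one has $E_p(u_\star^{(\ell)})\le E_p(w)$, with equality only if $w=u_\star^{(\ell)}$ almost everywhere. -/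

import Mathlib

open MeasureTheory Filter Topology
open scoped Distributions

noncomputable section

namespace EquatorMap

/-- The domain `ℝ^m` with the Euclidean norm. -/
abbrev Dom (m : ℕ) : Type := EuclideanSpace ℝ (Fin m)

/-- Values of the gradient of a map `ℝ^m → ℝ^ι`: one vector for each partial derivative.
Its norm is the Euclidean (Hilbert-Schmidt) norm `|∇u|² = ∑ᵢ |∂ᵢu|²`. -/
abbrev Grad (m : ℕ) (ι : Type) [Fintype ι] : Type :=
  PiLp 2 (fun _ : Fin m => EuclideanSpace ℝ ι)

/-- The open unit ball `B^m`. -/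
def ball (m : ℕ) : TopologicalSpace.Opens (Dom m) :=
  ⟨Metric.ball 0 1, Metric.isOpen_ball⟩

/-- Lebesgue measure on `B^m`. -/
def ballMeasure (m : ℕ) : Measure (Dom m) :=
  volume.restrict (Metric.ball 0 1)

/-! ### Sobolev spaces on the ball -/

section Sobolev

variable {m : ℕ} {ι : Type} [Fintype ι]

/-- The `i`-th partial derivative (in the classical sense) of `f` at `x`. -/
def partialDeriv {V : Type} [NormedAddCommGroup V] [NormedSpace ℝ V]
    (i : Fin m) (f : Dom m → V) (x : Dom m) : V :=
  fderiv ℝ f x (EuclideanSpace.single i 1)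

/-- The classical gradient. -/
def classicalGrad (f : Dom m → EuclideanSpace ℝ ι) (x : Dom m) : Grad m ι :=
  WithLp.toLp 2 (fun i => partialDeriv i f x)

/-- `G` is a weak gradient of `u` on the unit ball. -/
structure HasWeakGrad (u : Dom m → EuclideanSpace ℝ ι) (G : Dom m → Grad m ι) : Prop where
  locallyIntegrable : LocallyIntegrableOn u (ball m) volume
  locallyIntegrable_grad : LocallyIntegrableOn G (ball m) volume
  integral_eq : ∀ (φ : 𝓓(ball m, ℝ)) (i : Fin m),
    ∫ x, partialDeriv i φ x • u x ∂(ballMeasure m) = -∫ x, φ x • G x i ∂(ballMeasure m)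

open Classical in
/-- The weak gradient of `u` on the unit ball (unique up to null sets where it exists; zero if
there is none). -/
def weakGrad (u : Dom m → EuclideanSpace ℝ ι) : Dom m → Grad m ι :=
  if h : ∃ G, HasWeakGrad u G then h.choose else 0

/-- `u ∈ W^{1,p}(B^m, ℝ^ι)`. -/
def MemW1p (p : ℝ) (u : Dom m → EuclideanSpace ℝ ι) : Prop :=
  MemLp u (ENNReal.ofReal p) (ballMeasure m) ∧
    ∃ G, HasWeakGrad u G ∧ MemLp G (ENNReal.ofReal p) (ballMeasure m)

/-- `u ∈ W^{1,p}₀(B^m, ℝ^ι)`, the closure of the compactly supported smooth maps in `W^{1,p}`. -/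
def MemW1pZero (p : ℝ) (u : Dom m → EuclideanSpace ℝ ι) : Prop :=
  MemLp u (ENNReal.ofReal p) (ballMeasure m) ∧
    ∃ G, HasWeakGrad u G ∧ MemLp G (ENNReal.ofReal p) (ballMeasure m) ∧
      ∃ φ : ℕ → 𝓓(ball m, EuclideanSpace ℝ ι),
        Tendsto (fun k => eLpNorm (fun x => φ k x - u x) (ENNReal.ofReal p) (ballMeasure m))
          atTop (𝓝 0) ∧
        Tendsto (fun k => eLpNorm (fun x => classicalGrad (φ k) x - G x)
          (ENNReal.ofReal p) (ballMeasure m)) atTop (𝓝 0)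

/-- `u ∈ W^{1,p}(B^m, S)`, where `S` is the unit sphere of `ℝ^ι`. -/
def MemW1pSphere (p : ℝ) (u : Dom m → EuclideanSpace ℝ ι) : Prop :=
  MemW1p p u ∧ ∀ᵐ x ∂(ballMeasure m), u x ∈ Metric.sphere (0 : EuclideanSpace ℝ ι) 1

/-! ### The `p`-energy, `p`-harmonic maps, stability and minimizers -/

/-- The `p`-energy `E_p(u) = (1/p) ∫_{B^m} |∇u|^p dx`. -/
def energy (p : ℝ) (u : Dom m → EuclideanSpace ℝ ι) : ℝ :=
  (1 / p) * ∫ x, ‖weakGrad u x‖ ^ p ∂(ballMeasure m)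

/-- `u` is a (weakly) `p`-harmonic map from the ball to the sphere: `u ∈ W^{1,p}(B^m, S)` solves
`div(|∇u|^{p-2} ∇u) + |∇u|^p u = 0` on the whole ball in the sense of distributions. -/
structure IsPHarmonic (p : ℝ) (u : Dom m → EuclideanSpace ℝ ι) : Prop where
  mem : MemW1pSphere p u
  weak_eq : ∀ β : 𝓓(ball m, EuclideanSpace ℝ ι),
    ∫ x, ‖weakGrad u x‖ ^ (p - 2) * inner ℝ (weakGrad u x) (classicalGrad β x)
        ∂(ballMeasure m) =
      ∫ x, ‖weakGrad u x‖ ^ p * inner ℝ (u x) (β x) ∂(ballMeasure m)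

/-- `c` is the second derivative of `f` at `t₀`: `f` is differentiable near `t₀` and its derivative
has derivative `c` at `t₀`. -/
def HasSecondDerivAt (f : ℝ → ℝ) (c t₀ : ℝ) : Prop :=
  ∃ f' : ℝ → ℝ, (∀ᶠ t in 𝓝 t₀, HasDerivAt f (f' t) t) ∧ HasDerivAt f' c t₀

/-- Fields generating variations: bounded elements of `W^{1,p}₀(B^m, ℝ^ι)`. -/
def IsVariationField (p : ℝ) (η : Dom m → EuclideanSpace ℝ ι) : Prop :=
  MemW1pZero p η ∧ ∃ C : ℝ, ∀ᵐ x ∂(ballMeasure m), ‖η x‖ ≤ C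

/-- The variation `u_t = (u + tη) / |u + tη|` of a sphere-valued map `u`. For small `t` it is again
sphere-valued, and `u_t - u ∈ W^{1,p}₀` if `η` is a bounded element of `W^{1,p}₀`. -/
def variation (u η : Dom m → EuclideanSpace ℝ ι) (t : ℝ) : Dom m → EuclideanSpace ℝ ι :=
  fun x => ‖u x + t • η x‖⁻¹ • (u x + t • η x)

/-- Stability: `d²/dt² E_p(u_t)` at `t = 0` is never negative. -/
def IsStable (p : ℝ) (u : Dom m → EuclideanSpace ℝ ι) : Prop :=
  ∀ η, IsVariationField p η → ∀ c : ℝ,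
    HasSecondDerivAt (fun t => energy p (variation u η t)) c 0 → 0 ≤ c

/-- An unstable `p`-harmonic map: a `p`-harmonic map that is not stable, that is, some variation
has an energy whose second derivative at `t = 0` exists and is negative. -/
def IsUnstablePHarmonic (p : ℝ) (u : Dom m → EuclideanSpace ℝ ι) : Prop :=
  IsPHarmonic p u ∧ ¬ IsStable p u

/-- `u` is a `p`-harmonic map which is the unique minimizer of the `p`-energy among the maps in
`W^{1,p}(B^m, S)` with the boundary values of `u`. -/
structure IsUniqueMinimizer (p : ℝ) (u : Dom m → EuclideanSpace ℝ ι) : Prop where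
  isPHarmonic : IsPHarmonic p u
  minimizing : ∀ w : Dom m → EuclideanSpace ℝ ι, MemW1pSphere p w →
    MemW1pZero p (fun x => u x - w x) → energy p u ≤ energy p w
  unique : ∀ w : Dom m → EuclideanSpace ℝ ι, MemW1pSphere p w →
    MemW1pZero p (fun x => u x - w x) → energy p w = energy p u → w =ᵐ[ballMeasure m] u

end Sobolev

/-! ### The generalized equator map -/

/-- The normalizing constant `C_{ℓ,m}`. -/
def normConst (ℓ m : ℕ) : ℝ :=
  Real.sqrt (((ℓ : ℝ) + m - 3) / (2 * (ℓ : ℝ) + m - 4))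

/-- The components `u^{(ℓ)}_{i₁…i_ℓ}` of the generalized radial projection on `ℝ^m \ {0}`.
The recursion starts with `ℓ = 1`; the value for `ℓ = 0` is a placeholder. -/
def radialProj (m : ℕ) : (ℓ : ℕ) → (Fin ℓ → Fin m) → Dom m → ℝ
  | 0, _, _ => 1
  | 1, I, x => x (I 0) / ‖x‖
  | (k + 2), I, x =>
      normConst (k + 2) m *
        (x (I (Fin.last (k + 1))) / ‖x‖ * radialProj m (k + 1) (Fin.init I) x
          - 1 / (((k + 2 : ℕ) : ℝ) + m - 3) *
            (‖x‖ * partialDeriv (I (Fin.last (k + 1))) (radialProj m (k + 1) (Fin.init I)) x))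

/-- The generalized equator map `u_⋆^{(ℓ)} = (u^{(ℓ)}, 0)`, with values in the unit sphere of
`ℝ^{m^ℓ} × ℝ`; the last coordinate is the one indexed by `none`. -/
def equatorMap (m ℓ : ℕ) (x : Dom m) : EuclideanSpace ℝ (Option (Fin ℓ → Fin m)) :=
  WithLp.toLp 2 (fun j => j.elim 0 (fun I => radialProj m ℓ I x))

end EquatorMap

end

/-!
Write `r = |x|`, `u` for the generalized equator map and `λ = ℓ (ℓ + m - 2)` (`eigenval`).

**The map.** The components of `u` are `H_I / r^ℓ` (`radialProj_eq`), where the `H_I` (`harmPoly`) are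
harmonic homogeneous polynomials of degree `ℓ` (`polyLaplacian_harmPoly`) with `∑ H_I² = r^{2ℓ}`
(`sum_harmPoly_sq`). Hence `|u| = 1`; the Laplacian of the last identity, together with Euler's
identity, yields `|∇u|² = λ / r²`. Moreover `div (r^{2-p} ∇u) = -λ r^{-p} u`. All these functions are
sums of terms `r^q P` with a homogeneous polynomial `P`, and for `p < m` they are integrable enough at
the origin for the classical derivatives to be weak ones (`hasWeakPartials_norm_rpow_mul_polyFun`).
As `|∇u|^{p-2} = λ^{(p-2)/2} r^{2-p}`, this is the equation of `p`-harmonic maps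
(`isPHarmonic_equatorMap`).

**Minimality.** Let `w` be a competitor and `v = u - w ∈ W^{1,p}₀`. Since `s ↦ s^{p/2}` is convex,
`|∇w|^p ≥ |∇u|^p + (p/2) |∇u|^{p-2} (|∇v|² - 2 ∇u · ∇v)`. Test the equation of `u` with `v`; as
`|u| = |w| = 1` gives `u · v = |v|² / 2`, the energy difference is at least
`(1/2) λ^{(p-2)/2} ∫ r^{2-p} |∇v|² - λ r^{-p} |v|²`. The weighted Hardy inequality with remainder
`∫ r^{2-p} |∇v|² ≥ ∫ r^{-p} (a² + r²) |v|²`, where `a = (m - p) / 2`, comes from integrating a square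
built with the field `(a + r²) r⁻² x` (`hardy_scalar`); it holds on `W^{1,p}₀` by density and Fatou's
lemma (`IsTestLimit.hardy`). If `λ ≤ a²`, the difference is therefore at least a positive multiple of
`∫ r^{2-p} |v|²`, which gives minimality and uniqueness at once (`energy_equatorMap_add_le`).

**Instability.** For the variation towards the pole by a test function `f` supported away from the
origin, the energy density is an explicit function of `t²` (`norm_variationGrad_sq`), and the second
derivative of the energy at `t = 0` is `λ^{(p-2)/2} ∫ r^{2-p} (|∇f|² - λ r⁻² f²)`
(`hasSecondDerivAt_energy_variation`). For radial `f = r^{-a} g(log r)` this is a positive multiple of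
`∫ (g' - a g)² - λ g²` over the line (`integral_hardy_logRadial`). If `λ > a²`, a bump function `g`
that is stretched enough makes it negative (`exists_integral_neg`).
-/

namespace EquatorMap

/-! ### Harmonic polynomials -/

section Polynomials

open MvPolynomial

variable {m : ℕ}

/-- The polynomial `r² = ∑ᵢ xᵢ²`. -/
noncomputable def normSqPoly (m : ℕ) : MvPolynomial (Fin m) ℝ := ∑ i, X i ^ 2

/-- The Laplacian of a polynomial. -/
noncomputable def polyLaplacian (P : MvPolynomial (Fin m) ℝ) : MvPolynomial (Fin m) ℝ :=
  ∑ i, pderiv i (pderiv i P)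

/-- The harmonic polynomials `H_I` of degree `ℓ` with `u^{(ℓ)}_I = H_I / r^ℓ`. Up to a constant,
`H_{Ij}` is the harmonic projection of `x_j H_I`. The recursion starts at degree `0`; when `m ≥ 3`
its first step yields the coordinates. -/
noncomputable def harmPoly (m : ℕ) : (ℓ : ℕ) → (Fin ℓ → Fin m) → MvPolynomial (Fin m) ℝ
  | 0, _ => 1
  | k + 1, I =>
      C (Real.sqrt ((2 * k + m - 2 : ℝ) / (k + m - 2))) *
        (X (I (Fin.last k)) * harmPoly m k (Fin.init I) -
          C (1 / (2 * k + m - 2 : ℝ)) *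
            (normSqPoly m * pderiv (I (Fin.last k)) (harmPoly m k (Fin.init I))))

theorem C_two : (C 2 : MvPolynomial (Fin m) ℝ) = 2 := map_ofNat C 2

theorem pderiv_pderiv_comm (i j : Fin m) (P : MvPolynomial (Fin m) ℝ) :
    pderiv i (pderiv j P) = pderiv j (pderiv i P) := by
  have h : ⁅pderiv (R := ℝ) (σ := Fin m) i, pderiv (R := ℝ) (σ := Fin m) j⁆ = 0 := by
    refine MvPolynomial.derivation_ext fun k => ?_
    rw [Derivation.commutator_apply]
    classical
    simp only [pderiv_X, Pi.single_apply]
    split_ifs <;> simp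
  have h' := congrArg (fun D => D P) h
  simpa [Derivation.commutator_apply, sub_eq_zero] using h'

theorem pderiv_normSqPoly (i : Fin m) : pderiv i (normSqPoly m) = 2 * X i := by
  classical
  simp [normSqPoly, pderiv_X, Pi.single_apply]

theorem isHomogeneous_normSqPoly : (normSqPoly m).IsHomogeneous 2 :=
  IsHomogeneous.sum _ _ _ fun i _ => (isHomogeneous_X ℝ i).pow 2

theorem polyLaplacian_C_mul (c : ℝ) (P : MvPolynomial (Fin m) ℝ) :
    polyLaplacian (C c * P) = C c * polyLaplacian P := by
  simp [polyLaplacian, Finset.mul_sum]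

theorem polyLaplacian_sub (P Q : MvPolynomial (Fin m) ℝ) :
    polyLaplacian (P - Q) = polyLaplacian P - polyLaplacian Q := by
  simp [polyLaplacian, Finset.sum_sub_distrib]

theorem polyLaplacian_sum {κ : Type*} (s : Finset κ) (P : κ → MvPolynomial (Fin m) ℝ) :
    polyLaplacian (∑ k ∈ s, P k) = ∑ k ∈ s, polyLaplacian (P k) := by
  simp only [polyLaplacian, map_sum]
  exact Finset.sum_comm

theorem polyLaplacian_pderiv (j : Fin m) (P : MvPolynomial (Fin m) ℝ) :
    polyLaplacian (pderiv j P) = pderiv j (polyLaplacian P) := by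
  simp only [polyLaplacian, map_sum]
  exact Finset.sum_congr rfl fun i _ => by
    rw [pderiv_pderiv_comm i j P, pderiv_pderiv_comm i j]

theorem polyLaplacian_mul (P Q : MvPolynomial (Fin m) ℝ) :
    polyLaplacian (P * Q) =
      polyLaplacian P * Q + 2 * ∑ i, pderiv i P * pderiv i Q + P * polyLaplacian Q := by
  simp only [polyLaplacian, Finset.sum_mul, Finset.mul_sum, ← Finset.sum_add_distrib]
  refine Finset.sum_congr rfl fun i _ => ?_
  simp only [pderiv_mul, map_add]
  ring

theorem polyLaplacian_X (j : Fin m) : polyLaplacian (X j : MvPolynomial (Fin m) ℝ) = 0 := by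
  classical
  refine Finset.sum_eq_zero fun i _ => ?_
  rw [pderiv_X, Pi.single_apply]
  split_ifs <;> simp

theorem polyLaplacian_normSqPoly :
    polyLaplacian (normSqPoly m) = C (2 * m : ℝ) := by
  have h : ∀ i : Fin m, pderiv i (pderiv i (normSqPoly m)) = 2 := fun i => by
    rw [pderiv_normSqPoly, pderiv_mul, pderiv_X_self]
    have : pderiv i (2 : MvPolynomial (Fin m) ℝ) = 0 := by
      simpa using (pderiv i : Derivation ℝ _ _).map_natCast 2
    simp [this]
  simp only [polyLaplacian, h, Finset.sum_const, Finset.card_univ, Fintype.card_fin]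
  simp [C_two, mul_comm]

theorem polyLaplacian_X_mul (j : Fin m) (P : MvPolynomial (Fin m) ℝ) :
    polyLaplacian (X j * P) = 2 * pderiv j P + X j * polyLaplacian P := by
  classical
  rw [polyLaplacian_mul, polyLaplacian_X]
  simp [pderiv_X, Pi.single_apply]

theorem polyLaplacian_normSqPoly_mul {k : ℕ} {P : MvPolynomial (Fin m) ℝ}
    (hP : P.IsHomogeneous k) :
    polyLaplacian (normSqPoly m * P) =
      C (2 * m + 4 * k : ℝ) * P + normSqPoly m * polyLaplacian P := by
  have h := hP.sum_X_mul_pderiv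
  rw [polyLaplacian_mul, polyLaplacian_normSqPoly]
  simp only [pderiv_normSqPoly, mul_assoc, ← Finset.mul_sum, h]
  simp only [map_add, map_mul, map_natCast, nsmul_eq_mul, map_ofNat]
  ring

theorem polyLaplacian_normSqPoly_pow (k : ℕ) :
    polyLaplacian (normSqPoly m ^ k) =
      C (2 * k * (2 * k + m - 2) : ℝ) * normSqPoly m ^ (k - 1) := by
  induction k with
  | zero => simp [polyLaplacian]
  | succ k ih =>
    have hk : (normSqPoly m ^ k).IsHomogeneous (2 * k) := isHomogeneous_normSqPoly.pow k
    rw [pow_succ', polyLaplacian_normSqPoly_mul hk, ih]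
    rcases k with _ | k
    · simp
    · have : normSqPoly m * (C (2 * ↑(k + 1) * (2 * ↑(k + 1) + m - 2) : ℝ) *
          normSqPoly m ^ (k + 1 - 1)) =
          C (2 * ↑(k + 1) * (2 * ↑(k + 1) + m - 2) : ℝ) * normSqPoly m ^ (k + 1) := by
        simp only [Nat.add_sub_cancel]
        ring
      rw [this, ← add_mul, ← C_add, Nat.add_sub_cancel]
      congr 2
      push_cast
      ring

theorem isHomogeneous_harmPoly (ℓ : ℕ) (I : Fin ℓ → Fin m) :
    (harmPoly m ℓ I).IsHomogeneous ℓ := by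
  induction ℓ with
  | zero => exact isHomogeneous_one _ _
  | succ k ih =>
    have h1 : (X (I (Fin.last k)) * harmPoly m k (Fin.init I)).IsHomogeneous (k + 1) := by
      simpa [add_comm] using (isHomogeneous_X ℝ (I (Fin.last k))).mul (ih (Fin.init I))
    have h2 : (normSqPoly m * pderiv (I (Fin.last k)) (harmPoly m k (Fin.init I))).IsHomogeneous
        (k + 1) := by
      rcases k with _ | k
      · have h0 : pderiv (I (Fin.last 0)) (harmPoly m 0 (Fin.init I)) = 0 := by
          simp [harmPoly]
        rw [h0, mul_zero]
        exact isHomogeneous_zero _ _ _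
      · have := isHomogeneous_normSqPoly.mul ((ih (Fin.init I)).pderiv (i := I (Fin.last (k + 1))))
        rwa [show 2 + (k + 1 - 1) = k + 1 + 1 by omega] at this
    rw [harmPoly]
    have h3 := (h1.sub (h2.C_mul (1 / (2 * k + m - 2 : ℝ)))).C_mul
      (Real.sqrt ((2 * k + m - 2 : ℝ) / (k + m - 2)))
    exact h3

/-- By `Δ (x_j H) = 2 ∂_j H` and `Δ (r² ∂_j H) = (2 m + 4 (k - 1)) ∂_j H`, the coefficient in
`harmPoly` is the one for which the two terms cancel. -/
theorem polyLaplacian_harmPoly (hm : 3 ≤ m) (ℓ : ℕ) (I : Fin ℓ → Fin m) :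
    polyLaplacian (harmPoly m ℓ I) = 0 := by
  induction ℓ with
  | zero => simp [harmPoly, polyLaplacian]
  | succ k ih =>
    have hm' : (3 : ℝ) ≤ m := by exact_mod_cast hm
    rw [harmPoly, polyLaplacian_C_mul, polyLaplacian_sub, polyLaplacian_C_mul,
      polyLaplacian_X_mul, ih,
      polyLaplacian_normSqPoly_mul (isHomogeneous_harmPoly k (Fin.init I)).pderiv,
      polyLaplacian_pderiv, ih, map_zero, mul_zero, mul_zero, add_zero, add_zero, ← mul_assoc,
      ← C_mul]
    rcases k with _ | k
    · simp [harmPoly]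
    · have h : (1 / (2 * ((k + 1 : ℕ) : ℝ) + m - 2)) * (2 * m + 4 * ((k + 1 - 1 : ℕ) : ℝ)) = 2 := by
        rw [Nat.add_sub_cancel]
        have : (2 * ((k + 1 : ℕ) : ℝ) + m - 2) ≠ 0 := by
          have hk0 : (0 : ℝ) ≤ k := Nat.cast_nonneg k
          push_cast
          linarith
        field_simp
        push_cast
        ring
      rw [h]
      simp [C_two]

/-- Sums over multi-indices of length `k + 1` split off the last index. -/
theorem sum_multiIndex_succ {M : Type*} [AddCommMonoid M] (k : ℕ)
    (F : (Fin k → Fin m) → Fin m → M) :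
    ∑ I : Fin (k + 1) → Fin m, F (Fin.init I) (I (Fin.last k)) =
      ∑ I : Fin k → Fin m, ∑ j, F I j := by
  rw [← (Fin.snocEquiv fun _ : Fin (k + 1) => Fin m).sum_comp, Fintype.sum_prod_type_right]
  simp [Fin.snocEquiv]

/-- Apply the Laplacian to `∑ P_I² = r^{2k}`: for harmonic `P_I`, the left side becomes
`2 ∑ |∇P_I|²`. -/
theorem sum_sum_pderiv_sq_of_sum_sq {κ : Type*} [Fintype κ] {k : ℕ}
    {P : κ → MvPolynomial (Fin m) ℝ}
    (hP : ∀ I, polyLaplacian (P I) = 0) (hsq : ∑ I, P I ^ 2 = normSqPoly m ^ k) :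
    ∑ I, ∑ i, pderiv i (P I) ^ 2 =
      C (k * (2 * k + m - 2) : ℝ) * normSqPoly m ^ (k - 1) := by
  have h := congrArg polyLaplacian hsq
  rw [polyLaplacian_sum, polyLaplacian_normSqPoly_pow] at h
  have h1 : ∀ I, polyLaplacian (P I ^ 2) = C 2 * ∑ i, pderiv i (P I) ^ 2 := fun I => by
    rw [sq, polyLaplacian_mul, hP, zero_mul, mul_zero, zero_add, add_zero]
    simp [sq, C_two]
  simp only [h1, ← Finset.mul_sum] at h
  have h2 : (C (2 * k * (2 * k + m - 2) : ℝ) : MvPolynomial (Fin m) ℝ) =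
      C 2 * C (k * (2 * k + m - 2) : ℝ) := by
    rw [← C_mul]; congr 1; ring
  rw [h2, mul_assoc] at h
  exact mul_left_cancel₀ (by simp) h

/-- The map with components `H_I / r^ℓ` takes values in the unit sphere. In the induction, the
cross terms of `(x_j H_I - d⁻¹ r² ∂_j H_I)²`, with `d = 2 k + m - 2`, are given by
Euler's identity, and the gradient terms by `sum_sum_pderiv_sq_of_sum_sq`. -/
theorem sum_harmPoly_sq (hm : 3 ≤ m) (ℓ : ℕ) :
    ∑ I, harmPoly m ℓ I ^ 2 = normSqPoly m ^ ℓ := by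
  induction ℓ with
  | zero => simp [harmPoly]
  | succ k ih =>
    have hm' : (3 : ℝ) ≤ m := by exact_mod_cast hm
    have hg := sum_sum_pderiv_sq_of_sum_sq (fun I => polyLaplacian_harmPoly hm k I) ih
    set d : ℝ := 2 * k + m - 2 with hd
    set e : ℝ := k + m - 2 with he
    have hk0 : (0 : ℝ) ≤ k := Nat.cast_nonneg k
    have hd0 : 0 < d := by linarith
    have he0 : 0 < e := by linarith
    have hsum : ∑ I, ∑ j, (X j * harmPoly m k I -
          C (1 / d) * (normSqPoly m * pderiv j (harmPoly m k I))) ^ 2 =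
        C (e / d) * normSqPoly m ^ (k + 1) := by
      have h1 : ∀ I, ∑ j, (X j * harmPoly m k I -
          C (1 / d) * (normSqPoly m * pderiv j (harmPoly m k I))) ^ 2 =
          normSqPoly m * harmPoly m k I ^ 2 -
            C (2 / d * k) * (normSqPoly m * harmPoly m k I ^ 2) +
            C (1 / d ^ 2) * normSqPoly m ^ 2 * ∑ j, pderiv j (harmPoly m k I) ^ 2 := by
        intro I
        have hE := (isHomogeneous_harmPoly k I).sum_X_mul_pderiv
        have hexp : ∀ j, (X j * harmPoly m k I -
            C (1 / d) * (normSqPoly m * pderiv j (harmPoly m k I))) ^ 2 =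
            X j ^ 2 * harmPoly m k I ^ 2 -
            C (2 / d) * normSqPoly m * harmPoly m k I * (X j * pderiv j (harmPoly m k I)) +
            C (1 / d ^ 2) * normSqPoly m ^ 2 * pderiv j (harmPoly m k I) ^ 2 := fun j => by
          have e1 : (C (2 / d) : MvPolynomial (Fin m) ℝ) = 2 * C (1 / d) := by
            rw [show (2 : ℝ) / d = 2 * (1 / d) by ring, C_mul, C_two]
          have e2 : (C (1 / d ^ 2) : MvPolynomial (Fin m) ℝ) = C (1 / d) ^ 2 := by
            rw [← C_pow, div_pow, one_pow]
          rw [e1, e2]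
          ring
        simp only [hexp, Finset.sum_add_distrib, Finset.sum_sub_distrib, ← Finset.mul_sum,
          ← Finset.sum_mul, hE]
        rw [C_mul, nsmul_eq_mul, map_natCast, normSqPoly]
        ring
      simp only [h1, Finset.sum_add_distrib, Finset.sum_sub_distrib, ← Finset.mul_sum, ih, hg]
      rcases k with _ | k
      · have : e = d := by rw [hd, he]; simp
        simp [this, hd0.ne']
      · have e3 : (C (e / d) : MvPolynomial (Fin m) ℝ) =
            1 - C (2 / d * ↑(k + 1)) + C (1 / d ^ 2) * C (↑(k + 1) * d) := by
          rw [← C_mul, ← C_1, ← C_sub, ← C_add]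
          congr 1
          have hed : e = d - ↑(k + 1) := by rw [hd, he]; ring
          rw [hed]
          field_simp
          ring
        rw [e3, Nat.add_sub_cancel]
        ring
    have hF : ∀ I : Fin (k + 1) → Fin m, harmPoly m (k + 1) I ^ 2 = C (d / e) *
        (X (I (Fin.last k)) * harmPoly m k (Fin.init I) -
          C (1 / d) * (normSqPoly m * pderiv (I (Fin.last k))
            (harmPoly m k (Fin.init I)))) ^ 2 := fun I => by
      rw [harmPoly, mul_pow, ← C_pow, Real.sq_sqrt (by positivity)]
    simp only [hF, ← Finset.mul_sum]
    rw [sum_multiIndex_succ k fun I j => (X j * harmPoly m k I -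
      C (1 / d) * (normSqPoly m * pderiv j (harmPoly m k I))) ^ 2, hsum, ← mul_assoc, ← C_mul]
    rw [div_mul_div_cancel₀ he0.ne', div_self hd0.ne', C_1, one_mul]

end Polynomials

/-! ### Functions `r^q P` with a homogeneous polynomial `P` -/

section Homogeneous

open scoped ContDiff

variable {m : ℕ}

/-- The polynomial function of `P` on `ℝ^m`. -/
noncomputable def polyFun (P : MvPolynomial (Fin m) ℝ) (x : Dom m) : ℝ :=
  MvPolynomial.eval x.ofLp P

theorem partialDeriv_eq_of_hasFDerivAt {V : Type} [NormedAddCommGroup V] [NormedSpace ℝ V]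
    {f : Dom m → V} {f' : Dom m →L[ℝ] V} {x : Dom m} (h : HasFDerivAt f f' x) (i : Fin m) :
    partialDeriv i f x = f' (EuclideanSpace.single i 1) := by
  rw [partialDeriv, h.fderiv]

theorem contDiff_polyFun (P : MvPolynomial (Fin m) ℝ) : ContDiff ℝ ∞ (polyFun P) := by
  unfold polyFun
  induction P using MvPolynomial.induction_on with
  | C a => simpa using contDiff_const
  | add P Q hP hQ => simpa using hP.add hQ
  | mul_X P i hP =>
    simp only [map_mul, MvPolynomial.eval_X]
    exact hP.mul (by fun_prop)

theorem differentiable_polyFun (P : MvPolynomial (Fin m) ℝ) : Differentiable ℝ (polyFun P) :=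
  (contDiff_polyFun P).differentiable (by simp)

theorem continuous_polyFun (P : MvPolynomial (Fin m) ℝ) : Continuous (polyFun P) :=
  (contDiff_polyFun P).continuous

theorem fderiv_polyFun (P : MvPolynomial (Fin m) ℝ) (x : Dom m) (i : Fin m) :
    fderiv ℝ (polyFun P) x (EuclideanSpace.single i 1) = polyFun (MvPolynomial.pderiv i P) x := by
  induction P using MvPolynomial.induction_on with
  | C a =>
    have : polyFun (MvPolynomial.C a) = fun _ : Dom m => a := by ext; simp [polyFun]
    simp [this, polyFun]
  | add P Q hP hQ =>
    have : polyFun (P + Q) = polyFun P + polyFun Q := by ext; simp [polyFun]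
    rw [this, fderiv_add (differentiable_polyFun P x) (differentiable_polyFun Q x)]
    simp [hP, hQ, polyFun]
  | mul_X P j hP =>
    have hX : HasFDerivAt (fun x : Dom m => x j) (EuclideanSpace.proj j : Dom m →L[ℝ] ℝ) x :=
      (EuclideanSpace.proj j : Dom m →L[ℝ] ℝ).hasFDerivAt
    have h : HasFDerivAt (polyFun (P * MvPolynomial.X j)) _ x :=
      HasFDerivAt.congr_of_eventuallyEq ((differentiable_polyFun P x).hasFDerivAt.mul hX)
        (.of_forall fun y => by simp [polyFun])
    rw [h.fderiv]
    simp only [_root_.add_apply, _root_.smul_apply, smul_eq_mul, hP]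
    classical
    by_cases hij : i = j
    · simp [polyFun, MvPolynomial.pderiv_X, mul_comm, hij]
    · simp [polyFun, MvPolynomial.pderiv_X, mul_comm, Ne.symm hij]

theorem abs_coord_le_norm (x : Dom m) (i : Fin m) : |x i| ≤ ‖x‖ := by
  simpa using PiLp.norm_apply_le x i

/-- A homogeneous polynomial of degree `d` is bounded by a multiple of `r^d`. -/
theorem exists_abs_polyFun_le {d : ℕ} {P : MvPolynomial (Fin m) ℝ} (hP : P.IsHomogeneous d) :
    ∃ C : ℝ, 0 ≤ C ∧ ∀ x, |polyFun P x| ≤ C * ‖x‖ ^ d := by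
  refine ⟨∑ e ∈ P.support, |P.coeff e|, by positivity, fun x => ?_⟩
  rw [polyFun, MvPolynomial.eval_eq', Finset.sum_mul]
  refine (Finset.abs_sum_le_sum_abs _ _).trans (Finset.sum_le_sum fun e he => ?_)
  rw [abs_mul]
  refine mul_le_mul_of_nonneg_left ?_ (abs_nonneg _)
  rw [Finset.abs_prod]
  have hd : ∑ i, e i = d := by
    have := hP (MvPolynomial.mem_support_iff.1 he)
    simpa [Finsupp.weight_apply, Finsupp.sum_fintype] using this
  rw [← hd, ← Finset.prod_pow_eq_pow_sum]
  refine Finset.prod_le_prod (fun _ _ => abs_nonneg _) fun i _ => ?_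
  rw [abs_pow]
  exact pow_le_pow_left₀ (abs_nonneg _) (abs_coord_le_norm x i) _

theorem ae_ne_zero (hm : 0 < m) : ∀ᵐ x : Dom m, x ≠ 0 := by
  have : Nonempty (Fin m) := ⟨⟨0, hm⟩⟩
  exact compl_mem_ae_iff.2 (measure_singleton 0)

theorem norm_sq_rpow_half (x : Dom m) (q : ℝ) : (‖x‖ ^ 2) ^ (q / 2) = ‖x‖ ^ q := by
  rw [← Real.rpow_natCast_mul (norm_nonneg x)]
  congr 1
  push_cast
  ring

/-- The case `ε > 0` gives a smooth regularization of `r^q`, the case `ε = 0` is `r^q` itself. -/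
theorem hasFDerivAt_normSq_add_rpow {ε : ℝ} (q : ℝ) {x : Dom m} (h : 0 < ‖x‖ ^ 2 + ε) :
    HasFDerivAt (fun y : Dom m => (‖y‖ ^ 2 + ε) ^ (q / 2))
      ((q * (‖x‖ ^ 2 + ε) ^ ((q - 2) / 2)) • innerSL ℝ x) x := by
  have h1 := ((hasStrictFDerivAt_norm_sq x).hasFDerivAt.add_const ε).rpow_const (p := q / 2)
    (Or.inl h.ne')
  have e : (q * (‖x‖ ^ 2 + ε) ^ ((q - 2) / 2)) • innerSL ℝ x =
      (q / 2 * (‖x‖ ^ 2 + ε) ^ (q / 2 - 1)) • 2 • innerSL ℝ x := by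
    rw [show (q - 2) / 2 = q / 2 - 1 by ring]
    ext v
    simp
    ring
  rw [e]
  exact h1

theorem hasFDerivAt_normSq_add_rpow_mul_polyFun {ε : ℝ} (q : ℝ) (P : MvPolynomial (Fin m) ℝ)
    {x : Dom m} (h : 0 < ‖x‖ ^ 2 + ε) :
    HasFDerivAt (fun y : Dom m => (‖y‖ ^ 2 + ε) ^ (q / 2) * polyFun P y)
      ((‖x‖ ^ 2 + ε) ^ (q / 2) • fderiv ℝ (polyFun P) x +
        polyFun P x • (q * (‖x‖ ^ 2 + ε) ^ ((q - 2) / 2)) • innerSL ℝ x) x :=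
  (hasFDerivAt_normSq_add_rpow q h).mul (differentiable_polyFun P x).hasFDerivAt

/-- The `i`-th partial derivative of `r^q P`, away from the origin. -/
noncomputable def radPolyDeriv (q : ℝ) (P : MvPolynomial (Fin m) ℝ) (i : Fin m) (x : Dom m) : ℝ :=
  q * ‖x‖ ^ (q - 2) * (x i * polyFun P x) + ‖x‖ ^ q * polyFun (MvPolynomial.pderiv i P) x

theorem partialDeriv_normSq_add_rpow_mul_polyFun {ε : ℝ} (q : ℝ) (P : MvPolynomial (Fin m) ℝ)
    {x : Dom m} (h : 0 < ‖x‖ ^ 2 + ε) (i : Fin m) :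
    partialDeriv i (fun y : Dom m => (‖y‖ ^ 2 + ε) ^ (q / 2) * polyFun P y) x =
      q * (‖x‖ ^ 2 + ε) ^ ((q - 2) / 2) * (x i * polyFun P x) +
        (‖x‖ ^ 2 + ε) ^ (q / 2) * polyFun (MvPolynomial.pderiv i P) x := by
  rw [partialDeriv_eq_of_hasFDerivAt (hasFDerivAt_normSq_add_rpow_mul_polyFun q P h)]
  simp only [_root_.add_apply, _root_.smul_apply, smul_eq_mul,
    fderiv_polyFun, innerSL_apply_apply, EuclideanSpace.inner_single_right]
  simp
  ring

theorem partialDeriv_norm_rpow_mul_polyFun (q : ℝ) (P : MvPolynomial (Fin m) ℝ)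
    {x : Dom m} (hx : x ≠ 0) (i : Fin m) :
    partialDeriv i (fun y : Dom m => ‖y‖ ^ q * polyFun P y) x = radPolyDeriv q P i x := by
  have := partialDeriv_normSq_add_rpow_mul_polyFun (ε := 0) q P (x := x) (by positivity) i
  simp only [add_zero, norm_sq_rpow_half] at this
  exact this

theorem contDiff_normSq_add_rpow_mul_polyFun {ε : ℝ} (hε : 0 < ε) (q : ℝ)
    (P : MvPolynomial (Fin m) ℝ) :
    ContDiff ℝ ∞ (fun y : Dom m => (‖y‖ ^ 2 + ε) ^ (q / 2) * polyFun P y) :=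
  (ContDiff.rpow_const_of_ne ((contDiff_norm_sq ℝ).add contDiff_const)
    fun x => by positivity).mul (contDiff_polyFun P)

theorem measurable_norm_rpow_mul_polyFun (q : ℝ) (P : MvPolynomial (Fin m) ℝ) :
    Measurable fun x : Dom m => ‖x‖ ^ q * polyFun P x :=
  (measurable_norm.pow_const q).mul (continuous_polyFun P).measurable

theorem exists_abs_norm_rpow_mul_polyFun_le (q : ℝ) {d : ℕ} {P : MvPolynomial (Fin m) ℝ}
    (hP : P.IsHomogeneous d) :
    ∃ C : ℝ, 0 ≤ C ∧ ∀ x : Dom m, x ≠ 0 → |‖x‖ ^ q * polyFun P x| ≤ C * ‖x‖ ^ (q + d) := by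
  obtain ⟨C, hC, h⟩ := exists_abs_polyFun_le hP
  refine ⟨C, hC, fun x hx => ?_⟩
  have hx' : 0 < ‖x‖ := norm_pos_iff.2 hx
  rw [abs_mul, abs_of_nonneg (by positivity), Real.rpow_add hx', Real.rpow_natCast]
  calc ‖x‖ ^ q * |polyFun P x| ≤ ‖x‖ ^ q * (C * ‖x‖ ^ d) := by gcongr; exact h x
    _ = _ := by ring

theorem locallyIntegrable_of_abs_le_rpow (hm : 0 < m) {f : Dom m → ℝ} {C s : ℝ}
    (hs : -(m : ℝ) < s) (hf : ∀ x, x ≠ 0 → |f x| ≤ C * ‖x‖ ^ s) (hfm : Measurable f) :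
    LocallyIntegrable f :=
  locallyIntegrable_of_norm_le_rpow (C := C) (α := -s)
    (by simpa using Nat.succ_le_of_lt hm)
    (by simpa using by linarith)
    (by filter_upwards [ae_ne_zero hm] with x hx; simpa using hf x hx)
    hfm.aestronglyMeasurable

theorem locallyIntegrable_norm_rpow_mul_polyFun (hm : 0 < m) {q : ℝ} {d : ℕ}
    {P : MvPolynomial (Fin m) ℝ} (hP : P.IsHomogeneous d) (hq : -(m : ℝ) < q + d) :
    LocallyIntegrable fun x : Dom m => ‖x‖ ^ q * polyFun P x := by
  obtain ⟨C, _, h⟩ := exists_abs_norm_rpow_mul_polyFun_le q hP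
  exact locallyIntegrable_of_abs_le_rpow hm hq h (measurable_norm_rpow_mul_polyFun q P)

end Homogeneous

/-! ### Weak partial derivatives across the origin -/

section WeakPartials

open scoped ContDiff

variable {m : ℕ}

/-- `g` is a scalar function on `ℝ^m` with weak partial derivatives `dg i`. -/
structure HasWeakPartials (g : Dom m → ℝ) (dg : Fin m → Dom m → ℝ) : Prop where
  locallyIntegrable : LocallyIntegrable g
  locallyIntegrable_deriv : ∀ i, LocallyIntegrable (dg i)
  integral_eq : ∀ φ : Dom m → ℝ, ContDiff ℝ ∞ φ → HasCompactSupport φ → ∀ i,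
    ∫ x, partialDeriv i φ x * g x = -∫ x, φ x * dg i x

theorem contDiff_partialDeriv {V : Type} [NormedAddCommGroup V] [NormedSpace ℝ V]
    {φ : Dom m → V} (h : ContDiff ℝ ∞ φ) (i : Fin m) :
    ContDiff ℝ ∞ (partialDeriv i φ) :=
  (h.fderiv_right (m := ∞) (by simp)).clm_apply contDiff_const

theorem hasCompactSupport_partialDeriv {V : Type} [NormedAddCommGroup V] [NormedSpace ℝ V]
    {φ : Dom m → V} (h : HasCompactSupport φ) (i : Fin m) :
    HasCompactSupport (partialDeriv i φ) :=
  h.fderiv_apply ℝ _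

theorem partialDeriv_mul {f g : Dom m → ℝ} {x : Dom m} (hf : DifferentiableAt ℝ f x)
    (hg : DifferentiableAt ℝ g x) (i : Fin m) :
    partialDeriv i (fun y => f y * g y) x =
      f x * partialDeriv i g x + partialDeriv i f x * g x := by
  have h : HasFDerivAt (fun y => f y * g y) _ x := hf.hasFDerivAt.mul hg.hasFDerivAt
  rw [partialDeriv_eq_of_hasFDerivAt h]
  simp [partialDeriv, mul_comm]

theorem integral_partialDeriv_mul_eq {φ g : Dom m → ℝ} (hφ : ContDiff ℝ ∞ φ)
    (hc : HasCompactSupport φ) (hg : ContDiff ℝ ∞ g) (i : Fin m) :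
    ∫ x, partialDeriv i φ x * g x = -∫ x, φ x * partialDeriv i g x := by
  have hgi := contDiff_partialDeriv hg i
  have hφi := contDiff_partialDeriv hφ i
  rw [eq_neg_iff_add_eq_zero, add_comm, ← eq_neg_iff_add_eq_zero]
  refine integral_mul_fderiv_eq_neg_fderiv_mul_of_integrable ?_ ?_ ?_
    (fun x _ => hφ.differentiable (by simp) x) (fun x _ => hg.differentiable (by simp) x)
  · exact (hφi.continuous.mul hg.continuous).integrable_of_hasCompactSupport
      ((hasCompactSupport_partialDeriv hc i).mul_right)
  · exact (hφ.continuous.mul hgi.continuous).integrable_of_hasCompactSupport hc.mul_right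
  · exact (hφ.continuous.mul hg.continuous).integrable_of_hasCompactSupport hc.mul_right

theorem LocallyIntegrable.integrable_mul_of_hasCompactSupport {g φ : Dom m → ℝ}
    (hg : LocallyIntegrable g) (hφ : Continuous φ) (hc : HasCompactSupport φ) :
    Integrable fun x => φ x * g x :=
  hg.integrable_smul_left_of_hasCompactSupport hφ hc

/-- A smooth function has its classical partial derivatives as weak ones. -/
theorem hasWeakPartials_of_contDiff {g : Dom m → ℝ} (hg : ContDiff ℝ ∞ g) :
    HasWeakPartials g fun i => partialDeriv i g where
  locallyIntegrable := hg.continuous.locallyIntegrable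
  locallyIntegrable_deriv i := (contDiff_partialDeriv hg i).continuous.locallyIntegrable
  integral_eq _ hφ hc i := integral_partialDeriv_mul_eq hφ hc hg i

theorem HasWeakPartials.add {g h : Dom m → ℝ} {dg dh : Fin m → Dom m → ℝ}
    (hg : HasWeakPartials g dg) (hh : HasWeakPartials h dh) :
    HasWeakPartials (fun x => g x + h x) fun i x => dg i x + dh i x where
  locallyIntegrable := hg.1.add hh.1
  locallyIntegrable_deriv i := (hg.2 i).add (hh.2 i)
  integral_eq φ hφ hc i := by
    have hφi := (contDiff_partialDeriv hφ i).continuous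
    have hci := hasCompactSupport_partialDeriv hc i
    simp only [mul_add]
    rw [integral_add (LocallyIntegrable.integrable_mul_of_hasCompactSupport hg.1 hφi hci)
        (LocallyIntegrable.integrable_mul_of_hasCompactSupport hh.1 hφi hci),
      integral_add
        (LocallyIntegrable.integrable_mul_of_hasCompactSupport (hg.2 i) hφ.continuous hc)
        (LocallyIntegrable.integrable_mul_of_hasCompactSupport (hh.2 i) hφ.continuous hc),
      hg.3 φ hφ hc i, hh.3 φ hφ hc i]
    ring

theorem HasWeakPartials.const_mul {g : Dom m → ℝ} {dg : Fin m → Dom m → ℝ}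
    (hg : HasWeakPartials g dg) (c : ℝ) :
    HasWeakPartials (fun x => c * g x) fun i x => c * dg i x where
  locallyIntegrable := hg.1.smul c
  locallyIntegrable_deriv i := (hg.2 i).smul c
  integral_eq φ hφ hc i := by
    simp only [mul_left_comm _ c, integral_const_mul, hg.3 φ hφ hc i, mul_neg]

/-- The product rule for the product with a smooth function. -/
theorem HasWeakPartials.contDiff_mul {g : Dom m → ℝ} {dg : Fin m → Dom m → ℝ}
    (hg : HasWeakPartials g dg) {h : Dom m → ℝ} (hh : ContDiff ℝ ∞ h) :
    HasWeakPartials (fun x => h x * g x) fun i x => partialDeriv i h x * g x + h x * dg i x where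
  locallyIntegrable := by
    have h1 := hg.1.locallyIntegrableOn Set.univ |>.continuousOn_mul
      hh.continuous.continuousOn isOpen_univ.isLocallyClosed
    rwa [locallyIntegrableOn_univ] at h1
  locallyIntegrable_deriv i := by
    have h1 := hg.1.locallyIntegrableOn Set.univ |>.continuousOn_mul
      (contDiff_partialDeriv hh i).continuous.continuousOn isOpen_univ.isLocallyClosed
    have h2 := (hg.2 i).locallyIntegrableOn Set.univ |>.continuousOn_mul
      hh.continuous.continuousOn isOpen_univ.isLocallyClosed
    rw [locallyIntegrableOn_univ] at h1 h2
    exact h1.add h2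
  integral_eq φ hφ hc i := by
    have hφi := contDiff_partialDeriv hφ i
    have hci := hasCompactSupport_partialDeriv hc i
    have hhi := contDiff_partialDeriv hh i
    have key := hg.3 (fun x => φ x * h x) (hφ.mul hh) hc.mul_right i
    have i1 : Integrable fun x => partialDeriv i φ x * (h x * g x) := by
      simpa [mul_assoc] using LocallyIntegrable.integrable_mul_of_hasCompactSupport hg.1
        (hφi.continuous.mul hh.continuous) hci.mul_right
    have i2 : Integrable fun x => φ x * (partialDeriv i h x * g x) := by
      simpa [mul_assoc] using LocallyIntegrable.integrable_mul_of_hasCompactSupport hg.1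
        (hφ.continuous.mul hhi.continuous) hc.mul_right
    have i3 : Integrable fun x => φ x * (h x * dg i x) := by
      simpa [mul_assoc] using LocallyIntegrable.integrable_mul_of_hasCompactSupport (hg.2 i)
        (hφ.continuous.mul hh.continuous) hc.mul_right
    have e1 : ∫ x, partialDeriv i (fun y => φ y * h y) x * g x =
        (∫ x, φ x * (partialDeriv i h x * g x)) + ∫ x, partialDeriv i φ x * (h x * g x) := by
      rw [← integral_add i2 i1]
      refine integral_congr_ae (.of_forall fun x => ?_)
      simp only
      rw [partialDeriv_mul (hφ.differentiable (by simp) x) (hh.differentiable (by simp) x)]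
      ring
    simp only [mul_add, integral_add i2 i3]
    rw [e1] at key
    simp only [mul_assoc] at key
    linarith

/-- The functions `r^q P`, with `P` homogeneous of degree `d`, have their classical partial
derivatives as weak partial derivatives across the origin as soon as these are locally integrable.
The proof replaces `r²` by `r² + ε`; since `q ≤ 0`, the limits `ε → 0` are dominated. -/
theorem hasWeakPartials_norm_rpow_mul_polyFun (hm : 0 < m) {q : ℝ} (hq : q ≤ 0) {d : ℕ}
    {P : MvPolynomial (Fin m) ℝ} (hP : P.IsHomogeneous d) (hqd : 1 - (m : ℝ) < q + d) :
    HasWeakPartials (fun x : Dom m => ‖x‖ ^ q * polyFun P x) (radPolyDeriv q P) := by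
  have hl : LocallyIntegrable fun x : Dom m => ‖x‖ ^ q * polyFun P x :=
    locallyIntegrable_norm_rpow_mul_polyFun hm hP (by linarith)
  have hl1 : ∀ i, LocallyIntegrable fun x : Dom m => ‖x‖ ^ (q - 2) * (x i * polyFun P x) := by
    intro i
    have := locallyIntegrable_norm_rpow_mul_polyFun (q := q - 2) hm
      ((MvPolynomial.isHomogeneous_X ℝ i).mul hP) (by push_cast; linarith)
    simpa [polyFun] using this
  have hl2 : ∀ i, LocallyIntegrable fun x : Dom m =>
      ‖x‖ ^ q * polyFun (MvPolynomial.pderiv i P) x := by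
    intro i
    rcases Nat.eq_zero_or_pos d with rfl | hd
    · have h0 : MvPolynomial.pderiv i P = 0 := by
        rw [MvPolynomial.totalDegree_eq_zero_iff_eq_C.1 (Nat.le_zero.1 hP.totalDegree_le),
          MvPolynomial.pderiv_C]
      simpa [h0, polyFun] using locallyIntegrable_const (0 : ℝ)
    · refine locallyIntegrable_norm_rpow_mul_polyFun hm (hP.pderiv (i := i)) ?_
      rw [Nat.cast_sub hd]
      push_cast
      linarith
  refine ⟨hl, fun i => ?_, fun φ hφ hc i => ?_⟩
  · have := ((hl1 i).smul q).add (hl2 i)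
    refine this.congr (.of_forall fun x => ?_)
    simp [radPolyDeriv, mul_assoc]
  · set ε : ℕ → ℝ := fun n => 1 / ((n : ℝ) + 1) with hε
    have hε0 : ∀ n, 0 < ε n := fun n => by positivity
    have hεt : Tendsto ε atTop (𝓝 0) := tendsto_one_div_add_atTop_nhds_zero_nat
    set g : ℕ → Dom m → ℝ := fun n y => (‖y‖ ^ 2 + ε n) ^ (q / 2) * polyFun P y with hg
    have hgs : ∀ n, ContDiff ℝ ∞ (g n) := fun n =>
      contDiff_normSq_add_rpow_mul_polyFun (hε0 n) q P
    have hφi := contDiff_partialDeriv hφ i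
    have hci := hasCompactSupport_partialDeriv hc i
    have key : ∀ n, ∫ x, partialDeriv i φ x * g n x = -∫ x, φ x * partialDeriv i (g n) x :=
      fun n => integral_partialDeriv_mul_eq hφ hc (hgs n) i
    -- negative powers of `r² + ε` are increasing as `ε` decreases to `0`
    have hmono : ∀ (s : ℝ), s ≤ 0 → ∀ n (x : Dom m), x ≠ 0 →
        (‖x‖ ^ 2 + ε n) ^ (s / 2) ≤ ‖x‖ ^ s := fun s hs n x hx => by
      rw [← norm_sq_rpow_half]
      exact Real.rpow_le_rpow_of_nonpos (by positivity) (by linarith [hε0 n]) (by linarith)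
    have hpt : ∀ (s : ℝ) (x : Dom m), x ≠ 0 →
        Tendsto (fun n => (‖x‖ ^ 2 + ε n) ^ (s / 2)) atTop (𝓝 (‖x‖ ^ s)) := fun s x hx => by
      rw [← norm_sq_rpow_half]
      have h1 : Tendsto (fun n => ‖x‖ ^ 2 + ε n) atTop (𝓝 (‖x‖ ^ 2)) := by
        simpa using hεt.const_add (‖x‖ ^ 2)
      exact h1.rpow_const (Or.inl (by positivity))
    have t1 : Tendsto (fun n => ∫ x, partialDeriv i φ x * g n x) atTop
        (𝓝 (∫ x, partialDeriv i φ x * (‖x‖ ^ q * polyFun P x))) := by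
      refine tendsto_integral_of_dominated_convergence
        (fun x => ‖partialDeriv i φ x * (‖x‖ ^ q * polyFun P x)‖)
        (fun n => (hφi.continuous.mul (hgs n).continuous).aestronglyMeasurable)
        (LocallyIntegrable.integrable_mul_of_hasCompactSupport hl hφi.continuous hci).norm
        (fun n => ?_) ?_
      · filter_upwards [ae_ne_zero hm] with x hx
        simp only [hg, norm_mul]
        gcongr
        rw [Real.norm_of_nonneg (by positivity), Real.norm_of_nonneg (by positivity)]
        exact hmono q hq n x hx
      · filter_upwards [ae_ne_zero hm] with x hx
        exact ((hpt q x hx).mul_const _).const_mul _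
    have t2 : Tendsto (fun n => ∫ x, φ x * partialDeriv i (g n) x) atTop
        (𝓝 (∫ x, φ x * radPolyDeriv q P i x)) := by
      have b1 := LocallyIntegrable.integrable_mul_of_hasCompactSupport
        ((hl1 i).smul q) hφ.continuous hc
      have b2 := LocallyIntegrable.integrable_mul_of_hasCompactSupport (hl2 i) hφ.continuous hc
      refine tendsto_integral_of_dominated_convergence _
        (fun n => (hφ.continuous.mul
          (contDiff_partialDeriv (hgs n) i).continuous).aestronglyMeasurable)
        (b1.norm.add b2.norm) (fun n => ?_) ?_
      · filter_upwards [ae_ne_zero hm] with x hx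
        simp only [hg]
        rw [partialDeriv_normSq_add_rpow_mul_polyFun q P (by have := hε0 n; positivity) i, mul_add]
        refine (norm_add_le _ _).trans (add_le_add ?_ ?_)
        · simp only [Pi.smul_apply, smul_eq_mul, norm_mul, mul_assoc]
          gcongr
          rw [Real.norm_of_nonneg (by have := hε0 n; positivity),
            Real.norm_of_nonneg (by positivity)]
          exact hmono (q - 2) (by linarith) n x hx
        · simp only [norm_mul]
          gcongr
          rw [Real.norm_of_nonneg (by have := hε0 n; positivity),
            Real.norm_of_nonneg (by positivity)]
          exact hmono q hq n x hx
      · filter_upwards [ae_ne_zero hm] with x hx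
        have : ∀ n, partialDeriv i (g n) x = _ := fun n =>
          partialDeriv_normSq_add_rpow_mul_polyFun q P (x := x)
            (by have := hε0 n; positivity) i
        simp only [this]
        exact ((((hpt (q - 2) x hx).const_mul q).mul_const _).add
          ((hpt q x hx).mul_const _)).const_mul _
    refine tendsto_nhds_unique t1 ?_
    simp only [key]
    exact t2.neg

end WeakPartials

/-! ### The generalized radial projection in terms of harmonic polynomials -/

section RadialProjection

variable {m : ℕ}

open MvPolynomial in
theorem polyFun_normSqPoly (x : Dom m) : polyFun (normSqPoly m) x = ‖x‖ ^ 2 := by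
  simp [polyFun, normSqPoly, EuclideanSpace.real_norm_sq_eq]

theorem norm_rpow_sub_natCast {x : Dom m} (hx : x ≠ 0) (q : ℝ) (n : ℕ) :
    ‖x‖ ^ (q - n) = ‖x‖ ^ q / ‖x‖ ^ n := by
  rw [Real.rpow_sub (norm_pos_iff.2 hx), Real.rpow_natCast]

theorem norm_rpow_sub_two {x : Dom m} (hx : x ≠ 0) (q : ℝ) :
    ‖x‖ ^ (q - 2) = ‖x‖ ^ q / ‖x‖ ^ 2 := by
  exact_mod_cast norm_rpow_sub_natCast hx q 2

open MvPolynomial in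
/-- The recursion for `radialProj` is the one for `harmPoly` in disguise: the derivative of the
factor `r^{-k}` contributes another multiple of `x_j H`, and the square roots differ by a factor that
accounts for it. -/
theorem radialProj_eq (hm : 3 ≤ m) (k : ℕ) (I : Fin (k + 1) → Fin m) {x : Dom m} (hx : x ≠ 0) :
    radialProj m (k + 1) I x =
      ‖x‖ ^ (-((k + 1 : ℕ) : ℝ)) * polyFun (harmPoly m (k + 1) I) x := by
  have hm' : (3 : ℝ) ≤ m := by exact_mod_cast hm
  induction k generalizing x with
  | zero =>
    have h2 : (m : ℝ) - 2 ≠ 0 := by linarith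
    simp [radialProj, harmPoly, polyFun, h2, Real.rpow_neg_one, div_eq_inv_mul]
  | succ k ih =>
    have hr : 0 < ‖x‖ := norm_pos_iff.2 hx
    set j := I (Fin.last (k + 1)) with hj
    set H := harmPoly m (k + 1) (Fin.init I) with hH
    have hev : radialProj m (k + 1) (Fin.init I) =ᶠ[𝓝 x]
        fun y => ‖y‖ ^ (-((k + 1 : ℕ) : ℝ)) * polyFun H y := by
      filter_upwards [isOpen_ne.mem_nhds hx] with y hy
      exact ih _ hy
    have hpd : partialDeriv j (radialProj m (k + 1) (Fin.init I)) x =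
        radPolyDeriv (-((k + 1 : ℕ) : ℝ)) H j x := by
      rw [← partialDeriv_norm_rpow_mul_polyFun _ _ hx, partialDeriv, partialDeriv, hev.fderiv_eq]
    have hs : ‖x‖ ^ (-((k + 1 + 1 : ℕ) : ℝ)) = ‖x‖ ^ (-((k + 1 : ℕ) : ℝ)) / ‖x‖ := by
      have := norm_rpow_sub_natCast hx (-((k + 1 : ℕ) : ℝ)) 1
      rw [pow_one] at this
      rw [← this]
      congr 1
      push_cast
      ring
    have hpoly : polyFun (harmPoly m (k + 1 + 1) I) x =
        Real.sqrt ((2 * (k + 1 : ℕ) + m - 2 : ℝ) / ((k + 1 : ℕ) + m - 2)) *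
          (x j * polyFun H x - 1 / (2 * (k + 1 : ℕ) + m - 2 : ℝ) *
            (‖x‖ ^ 2 * polyFun (pderiv j H) x)) := by
      rw [← polyFun_normSqPoly, harmPoly, ← hj, ← hH]
      simp only [polyFun, map_mul, map_sub, eval_C, eval_X]
    rw [radialProj, ih _ hx, hpd, hpoly, hs, radPolyDeriv, norm_rpow_sub_two hx, normConst, ← hj,
      ← hH]
    have hk0 : (0 : ℝ) ≤ k := Nat.cast_nonneg k
    obtain ⟨d, hd⟩ : ∃ d : ℝ, d = 2 * k + m := ⟨_, rfl⟩
    obtain ⟨e, he⟩ : ∃ e : ℝ, e = k + m - 1 := ⟨_, rfl⟩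
    have hd0 : 0 < d := by linarith
    have he0 : 0 < e := by linarith
    have e1 : (((k + 2 : ℕ) : ℝ) + m - 3) = e := by rw [he]; push_cast; ring
    have e2 : (2 * ((k + 2 : ℕ) : ℝ) + m - 4) = d := by rw [hd]; push_cast; ring
    have e3 : (2 * ((k + 1 : ℕ) : ℝ) + m - 2) = d := by rw [hd]; push_cast; ring
    have e4 : (((k + 1 : ℕ) : ℝ) + m - 2) = e := by rw [he]; push_cast; ring
    have e5 : (((k + 1 : ℕ) : ℝ)) = d - e := by rw [hd, he]; push_cast; ring
    rw [e1, e2, e3, e4, e5]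
    have hsq : Real.sqrt (d / e) = Real.sqrt (e / d) * (d / e) := by
      rw [← Real.sqrt_sq (show 0 ≤ d / e by positivity), ← Real.sqrt_mul (by positivity),
        Real.sqrt_sq (by positivity)]
      congr 1
      field_simp
    rw [hsq]
    field_simp
    ring

variable (m) in
/-- The component `H_I / r^ℓ` of the generalized radial projection. -/
noncomputable def projCoord (ℓ : ℕ) (I : Fin ℓ → Fin m) (x : Dom m) : ℝ :=
  ‖x‖ ^ (-(ℓ : ℝ)) * polyFun (harmPoly m ℓ I) x

variable (m) in
/-- The `i`-th partial derivative of `H_I / r^ℓ`, away from the origin. -/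
noncomputable def projCoordDeriv (ℓ : ℕ) (I : Fin ℓ → Fin m) (i : Fin m) (x : Dom m) : ℝ :=
  radPolyDeriv (-(ℓ : ℝ)) (harmPoly m ℓ I) i x

theorem norm_rpow_neg_sq_mul {x : Dom m} (hx : x ≠ 0) (ℓ : ℕ) :
    (‖x‖ ^ (-(ℓ : ℝ))) ^ 2 * (‖x‖ ^ 2) ^ ℓ = 1 := by
  have hr : 0 < ‖x‖ := norm_pos_iff.2 hx
  rw [Real.rpow_neg hr.le, Real.rpow_natCast, ← pow_mul, mul_comm 2, pow_mul]
  field_simp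

open MvPolynomial in
theorem sum_polyFun_harmPoly_sq (hm : 3 ≤ m) (ℓ : ℕ) (x : Dom m) :
    ∑ I, polyFun (harmPoly m ℓ I) x ^ 2 = (‖x‖ ^ 2) ^ ℓ := by
  have h := congrArg (fun P => polyFun P x) (sum_harmPoly_sq hm ℓ)
  rw [← polyFun_normSqPoly]
  simpa [polyFun] using h

open MvPolynomial in
theorem sum_polyFun_harmPoly_mul_pderiv (hm : 3 ≤ m) (ℓ : ℕ) (i : Fin m) (x : Dom m) :
    ∑ I, polyFun (harmPoly m ℓ I) x * polyFun (pderiv i (harmPoly m ℓ I)) x =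
      ℓ * x i * (‖x‖ ^ 2) ^ (ℓ - 1) := by
  have h := congrArg (fun P => polyFun (pderiv i P) x) (sum_harmPoly_sq hm ℓ)
  rw [← polyFun_normSqPoly]
  simp only [map_sum, pderiv_pow, pderiv_normSqPoly, polyFun, map_mul, map_natCast, map_pow,
    map_ofNat, eval_X, Nat.add_one_sub_one, pow_one, Nat.cast_ofNat, mul_assoc,
    ← Finset.mul_sum] at h ⊢
  linarith

open MvPolynomial in
theorem sum_polyFun_pderiv_harmPoly_sq (hm : 3 ≤ m) (ℓ : ℕ) (x : Dom m) :
    ∑ I, ∑ i, polyFun (pderiv i (harmPoly m ℓ I)) x ^ 2 =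
      ℓ * (2 * ℓ + m - 2) * (‖x‖ ^ 2) ^ (ℓ - 1) := by
  have h := congrArg (fun P => polyFun P x) (sum_sum_pderiv_sq_of_sum_sq
    (fun I => polyLaplacian_harmPoly hm ℓ I) (sum_harmPoly_sq hm ℓ))
  rw [← polyFun_normSqPoly]
  simpa [polyFun] using h

open MvPolynomial in
theorem sum_coord_mul_polyFun_pderiv_harmPoly (ℓ : ℕ) (I : Fin ℓ → Fin m) (x : Dom m) :
    ∑ i, x i * polyFun (pderiv i (harmPoly m ℓ I)) x = ℓ * polyFun (harmPoly m ℓ I) x := by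
  have h := congrArg (fun P => polyFun P x) (isHomogeneous_harmPoly ℓ I).sum_X_mul_pderiv
  simpa [polyFun] using h

theorem sum_projCoord_sq (hm : 3 ≤ m) (ℓ : ℕ) {x : Dom m} (hx : x ≠ 0) :
    ∑ I, projCoord m ℓ I x ^ 2 = 1 := by
  simp only [projCoord, mul_pow, ← Finset.mul_sum, sum_polyFun_harmPoly_sq hm]
  exact norm_rpow_neg_sq_mul hx ℓ

theorem projCoordDeriv_eq {x : Dom m} (hx : x ≠ 0) (ℓ : ℕ) (I : Fin ℓ → Fin m) (i : Fin m) :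
    projCoordDeriv m ℓ I i x = ‖x‖ ^ (-(ℓ : ℝ)) *
      (polyFun (MvPolynomial.pderiv i (harmPoly m ℓ I)) x -
        ℓ / ‖x‖ ^ 2 * (x i * polyFun (harmPoly m ℓ I) x)) := by
  rw [projCoordDeriv, radPolyDeriv, norm_rpow_sub_two hx]
  ring

/-- The derivatives of a sphere-valued map are tangential. -/
theorem sum_projCoord_mul_projCoordDeriv (hm : 3 ≤ m) {ℓ : ℕ} (hℓ : 1 ≤ ℓ) {x : Dom m}
    (hx : x ≠ 0) (i : Fin m) :
    ∑ I, projCoord m ℓ I x * projCoordDeriv m ℓ I i x = 0 := by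
  have hr : 0 < ‖x‖ := norm_pos_iff.2 hx
  have h1 : ∀ I : Fin ℓ → Fin m, projCoord m ℓ I x * projCoordDeriv m ℓ I i x =
      (‖x‖ ^ (-(ℓ : ℝ))) ^ 2 *
        (polyFun (harmPoly m ℓ I) x * polyFun (MvPolynomial.pderiv i (harmPoly m ℓ I)) x) -
      (‖x‖ ^ (-(ℓ : ℝ))) ^ 2 * (ℓ / ‖x‖ ^ 2 * x i) * polyFun (harmPoly m ℓ I) x ^ 2 := fun I => by
    rw [projCoordDeriv_eq hx, projCoord]
    ring
  simp only [h1, Finset.sum_sub_distrib, ← Finset.mul_sum, sum_polyFun_harmPoly_sq hm,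
    sum_polyFun_harmPoly_mul_pderiv hm]
  obtain ⟨k, rfl⟩ := Nat.exists_eq_add_of_le' hℓ
  rw [Nat.add_sub_cancel, pow_succ (‖x‖ ^ 2) k]
  field_simp
  ring

/-- The eigenvalue `ℓ (ℓ + m - 2)` of the spherical harmonics of degree `ℓ`. -/
noncomputable def eigenval (m ℓ : ℕ) : ℝ := ℓ * (ℓ + m - 2)

theorem eigenval_pos (hm : 3 ≤ m) {ℓ : ℕ} (hℓ : 1 ≤ ℓ) : 0 < eigenval m ℓ := by
  have hm' : (3 : ℝ) ≤ m := by exact_mod_cast hm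
  have hℓ' : (1 : ℝ) ≤ ℓ := by exact_mod_cast hℓ
  have : (0 : ℝ) < ℓ + m - 2 := by linarith
  unfold eigenval
  positivity

/-- `|∇u|² = λ / r²` for the generalized radial projection `u`. -/
theorem sum_projCoordDeriv_sq (hm : 3 ≤ m) {ℓ : ℕ} (hℓ : 1 ≤ ℓ) {x : Dom m} (hx : x ≠ 0) :
    ∑ i, ∑ I, projCoordDeriv m ℓ I i x ^ 2 = eigenval m ℓ / ‖x‖ ^ 2 := by
  have hr : 0 < ‖x‖ := norm_pos_iff.2 hx
  rw [Finset.sum_comm]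
  have h1 : ∀ I : Fin ℓ → Fin m, ∑ i, projCoordDeriv m ℓ I i x ^ 2 =
      (‖x‖ ^ (-(ℓ : ℝ))) ^ 2 *
        (∑ i, polyFun (MvPolynomial.pderiv i (harmPoly m ℓ I)) x ^ 2) -
      (‖x‖ ^ (-(ℓ : ℝ))) ^ 2 * (ℓ ^ 2 / ‖x‖ ^ 2) * polyFun (harmPoly m ℓ I) x ^ 2 := fun I => by
    have h2 : ∀ i, projCoordDeriv m ℓ I i x ^ 2 =
        (‖x‖ ^ (-(ℓ : ℝ))) ^ 2 * polyFun (MvPolynomial.pderiv i (harmPoly m ℓ I)) x ^ 2 -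
        (‖x‖ ^ (-(ℓ : ℝ))) ^ 2 * (2 * ℓ / ‖x‖ ^ 2 * polyFun (harmPoly m ℓ I) x) *
          (x i * polyFun (MvPolynomial.pderiv i (harmPoly m ℓ I)) x) +
        (‖x‖ ^ (-(ℓ : ℝ))) ^ 2 * (ℓ / ‖x‖ ^ 2 * polyFun (harmPoly m ℓ I) x) ^ 2 * x i ^ 2 :=
      fun i => by
        rw [projCoordDeriv_eq hx]
        ring
    simp only [h2, Finset.sum_add_distrib, Finset.sum_sub_distrib, ← Finset.mul_sum,
      sum_coord_mul_polyFun_pderiv_harmPoly, ← EuclideanSpace.real_norm_sq_eq]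
    field_simp
    ring
  simp only [h1, Finset.sum_sub_distrib, ← Finset.mul_sum, sum_polyFun_harmPoly_sq hm,
    sum_polyFun_pderiv_harmPoly_sq hm]
  have h3 := norm_rpow_neg_sq_mul hx ℓ
  obtain ⟨k, rfl⟩ := Nat.exists_eq_add_of_le' hℓ
  rw [Nat.add_sub_cancel]
  rw [pow_succ (‖x‖ ^ 2) k] at h3 ⊢
  rw [eigenval, eq_div_iff (by positivity)]
  have h4 : ∀ s t : ℝ, s * (((k + 1 : ℕ) : ℝ) ^ 2 / ‖x‖ ^ 2) * (t * ‖x‖ ^ 2) =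
      s * ((k + 1 : ℕ) : ℝ) ^ 2 * t := fun s t => by field_simp
  rw [h4]
  linear_combination (((k + 1 : ℕ) : ℝ) * (((k + 1 : ℕ) : ℝ) + m - 2)) * h3

end RadialProjection

/-! ### Weak gradients on the ball -/

section WeakGradient

open scoped ContDiff

variable {m : ℕ} {ι : Type} [Fintype ι]

theorem partialDeriv_eq_zero_of_notMem_tsupport {V : Type} [NormedAddCommGroup V]
    [NormedSpace ℝ V] {φ : Dom m → V} {x : Dom m} (hx : x ∉ tsupport φ) (i : Fin m) :
    partialDeriv i φ x = 0 := by
  rw [partialDeriv, fderiv_of_notMem_tsupport ℝ hx]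
  rfl

theorem partialDeriv_apply {β : Dom m → EuclideanSpace ℝ ι} {x : Dom m}
    (h : DifferentiableAt ℝ β x) (i : Fin m) (j : ι) :
    partialDeriv i (fun y => β y j) x = partialDeriv i β x j := by
  have h1 : HasFDerivAt (fun y => β y j)
      ((EuclideanSpace.proj j : EuclideanSpace ℝ ι →L[ℝ] ℝ).comp (fderiv ℝ β x)) x :=
    (EuclideanSpace.proj j : EuclideanSpace ℝ ι →L[ℝ] ℝ).hasFDerivAt.comp x h.hasFDerivAt
  rw [partialDeriv_eq_of_hasFDerivAt h1]
  rfl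

/-- Integrals over the ball of functions that vanish outside are integrals over the space. -/
theorem integral_ballMeasure_eq {V : Type*} [NormedAddCommGroup V] [NormedSpace ℝ V]
    {f : Dom m → V} (h : ∀ x, x ∉ (ball m : Set (Dom m)) → f x = 0) :
    ∫ x, f x ∂(ballMeasure m) = ∫ x, f x :=
  setIntegral_eq_integral_of_forall_compl_eq_zero h

theorem locallyIntegrableOn_apply {κ : Type*} [Fintype κ] {V : κ → Type*}
    [∀ k, NormedAddCommGroup (V k)] {u : Dom m → PiLp 2 V} {s : Set (Dom m)}
    (hu : LocallyIntegrableOn u s) (k : κ) : LocallyIntegrableOn (fun x => u x k) s := by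
  intro x hx
  obtain ⟨t, ht, hut⟩ := hu x hx
  exact ⟨t, ht, Integrable.eval_piLp hut k⟩

theorem locallyIntegrable_of_apply {κ : Type*} [Fintype κ] {V : κ → Type*}
    [∀ k, NormedAddCommGroup (V k)] {u : Dom m → PiLp 2 V}
    (hu : ∀ k, LocallyIntegrable (fun x => u x k)) : LocallyIntegrable u := by
  rw [locallyIntegrable_iff]
  intro K hK
  exact Integrable.of_eval_piLp fun k => (hu k).integrableOn_isCompact hK

/-- Products of locally integrable functions on the ball with continuous functions supported in a
compact subset of the ball are integrable. -/
theorem LocallyIntegrableOn.integrable_smul_of_tsupport_subset {V : Type*} [NormedAddCommGroup V]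
    [NormedSpace ℝ V] {u : Dom m → V} (hu : LocallyIntegrableOn u (ball m : Set (Dom m)))
    {φ : Dom m → ℝ} (hφ : Continuous φ) (hc : HasCompactSupport φ)
    (hs : tsupport φ ⊆ (ball m : Set (Dom m))) :
    Integrable (fun x => φ x • u x) (ballMeasure m) := by
  have h1 : IntegrableOn (fun x => φ x • u x) (tsupport φ) :=
    (hu.integrableOn_compact_subset hs hc).continuousOn_smul hφ.continuousOn hc
  refine Integrable.restrict ?_
  rwa [integrableOn_iff_integrable_of_support_subset] at h1
  intro x hx
  refine subset_tsupport _ fun h => hx ?_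
  simp [h]

theorem tsupport_partialDeriv_subset {V : Type} [NormedAddCommGroup V] [NormedSpace ℝ V]
    (φ : Dom m → V) (i : Fin m) : tsupport (partialDeriv i φ) ⊆ tsupport φ := by
  refine closure_minimal (fun x hx => ?_) (isClosed_tsupport φ)
  by_contra h
  exact hx (partialDeriv_eq_zero_of_notMem_tsupport h i)

theorem HasWeakGrad.integrable_partialDeriv_smul {u : Dom m → EuclideanSpace ℝ ι}
    {G : Dom m → Grad m ι} (h : HasWeakGrad u G) (φ : 𝓓(ball m, ℝ)) (i : Fin m) :
    Integrable (fun x => partialDeriv i φ x • u x) (ballMeasure m) :=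
  LocallyIntegrableOn.integrable_smul_of_tsupport_subset h.1
    (contDiff_partialDeriv φ.contDiff i).continuous
    (hasCompactSupport_partialDeriv φ.hasCompactSupport i)
    ((tsupport_partialDeriv_subset _ i).trans φ.tsupport_subset)

theorem HasWeakGrad.integrable_smul_apply {u : Dom m → EuclideanSpace ℝ ι}
    {G : Dom m → Grad m ι} (h : HasWeakGrad u G) (φ : 𝓓(ball m, ℝ)) (i : Fin m) :
    Integrable (fun x => φ x • G x i) (ballMeasure m) :=
  LocallyIntegrableOn.integrable_smul_of_tsupport_subset (locallyIntegrableOn_apply h.2 i)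
    φ.continuous φ.hasCompactSupport φ.tsupport_subset

theorem HasWeakGrad.sub {u v : Dom m → EuclideanSpace ℝ ι} {G K : Dom m → Grad m ι}
    (hu : HasWeakGrad u G) (hv : HasWeakGrad v K) :
    HasWeakGrad (fun x => u x - v x) fun x => G x - K x where
  locallyIntegrable := hu.1.sub hv.1
  locallyIntegrable_grad := hu.2.sub hv.2
  integral_eq φ i := by
    simp only [smul_sub, PiLp.sub_apply]
    rw [integral_sub (hu.integrable_partialDeriv_smul φ i) (hv.integrable_partialDeriv_smul φ i),
      integral_sub (hu.integrable_smul_apply φ i) (hv.integrable_smul_apply φ i),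
      hu.3, hv.3]
    abel

/-- Weak gradients are unique almost everywhere. -/
theorem HasWeakGrad.ae_eq {u : Dom m → EuclideanSpace ℝ ι} {G K : Dom m → Grad m ι}
    (hG : HasWeakGrad u G) (hK : HasWeakGrad u K) : G =ᵐ[ballMeasure m] K := by
  have h : ∀ i, ∀ᵐ x ∂(ballMeasure m), G x i - K x i = 0 := by
    intro i
    refine (ae_restrict_iff' measurableSet_ball).2 ?_
    refine Metric.isOpen_ball.ae_eq_zero_of_integral_contDiff_smul_eq_zero
      ((locallyIntegrableOn_apply hG.2 i).sub (locallyIntegrableOn_apply hK.2 i)) ?_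
    intro g hg hgc hgs
    let φ : 𝓓(ball m, ℝ) := ⟨g, hg, hgc, hgs⟩
    have e1 := hG.3 φ i
    rw [hK.3 φ i, neg_inj] at e1
    have e2 : ∫ x, φ x • (G x i - K x i) ∂(ballMeasure m) = 0 := by
      simp only [smul_sub]
      rw [integral_sub (hG.integrable_smul_apply φ i) (hK.integrable_smul_apply φ i), e1, sub_self]
    rw [integral_ballMeasure_eq] at e2
    · exact e2
    · intro x hx
      have : φ x = 0 := image_eq_zero_of_notMem_tsupport fun h => hx (φ.tsupport_subset h)
      simp [this]
  filter_upwards [ae_all_iff.2 h] with x hx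
  ext1 i
  exact sub_eq_zero.1 (hx i)

theorem HasWeakGrad.weakGrad_ae_eq {u : Dom m → EuclideanSpace ℝ ι} {G : Dom m → Grad m ι}
    (hG : HasWeakGrad u G) : weakGrad u =ᵐ[ballMeasure m] G := by
  have h : ∃ G, HasWeakGrad u G := ⟨G, hG⟩
  rw [weakGrad, dif_pos h]
  exact h.choose_spec.ae_eq hG

/-- Weak partial derivatives of the components make up a weak gradient on the ball. -/
theorem hasWeakGrad_of_hasWeakPartials {u : Dom m → EuclideanSpace ℝ ι}
    {g : ι → Dom m → ℝ} {dg : ι → Fin m → Dom m → ℝ} (h : ∀ j, HasWeakPartials (g j) (dg j))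
    (hu : ∀ᵐ x, ∀ j, u x j = g j x) :
    HasWeakGrad u fun x => WithLp.toLp 2 fun i => WithLp.toLp 2 fun j => dg j i x := by
  have hu' : LocallyIntegrable u :=
    locallyIntegrable_of_apply fun j => (h j).1.congr (by
      filter_upwards [hu] with x hx using (hx j).symm)
  refine ⟨hu'.locallyIntegrableOn _, LocallyIntegrable.locallyIntegrableOn ?_ _, ?_⟩
  · exact locallyIntegrable_of_apply fun i => locallyIntegrable_of_apply fun j => (h j).2 i
  · intro φ i
    have z : ∀ x, x ∉ (ball m : Set (Dom m)) → x ∉ tsupport φ :=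
      fun x hx h => hx (φ.tsupport_subset h)
    rw [integral_ballMeasure_eq fun x hx => by
        rw [partialDeriv_eq_zero_of_notMem_tsupport (z x hx), zero_smul],
      integral_ballMeasure_eq fun x hx => by
        rw [image_eq_zero_of_notMem_tsupport (z x hx), zero_smul]]
    ext j
    have i1 : ∀ j, Integrable fun x => (partialDeriv i φ x • u x) j := fun j => by
      have := LocallyIntegrable.integrable_mul_of_hasCompactSupport (h j).1
        (contDiff_partialDeriv φ.contDiff i).continuous
        (hasCompactSupport_partialDeriv φ.hasCompactSupport i)
      refine this.congr ?_
      filter_upwards [hu] with x hx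
      simp [hx j]
    have i2 : ∀ j, Integrable fun x =>
        (φ x • (WithLp.toLp 2 fun j => dg j i x : EuclideanSpace ℝ ι)) j := fun j =>
      LocallyIntegrable.integrable_mul_of_hasCompactSupport ((h j).2 i)
        φ.continuous φ.hasCompactSupport
    rw [PiLp.neg_apply, eval_integral_piLp i1, eval_integral_piLp i2]
    simp only [PiLp.smul_apply, smul_eq_mul]
    rw [← (h j).3 φ φ.contDiff φ.hasCompactSupport i]
    refine integral_congr_ae ?_
    filter_upwards [hu] with x hx
    simp [hx j]

end WeakGradient

/-! ### The gradient of the equator map and the equation it satisfies -/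

section Equator

open scoped ContDiff

variable {m ℓ : ℕ}

/-- The gradient of the equator map, away from the origin. -/
noncomputable def equatorGrad (m ℓ : ℕ) (x : Dom m) : Grad m (Option (Fin ℓ → Fin m)) :=
  WithLp.toLp 2 fun i => WithLp.toLp 2 fun j => j.elim 0 fun I => projCoordDeriv m ℓ I i x

theorem equatorMap_some (hm : 3 ≤ m) (hℓ : 1 ≤ ℓ) {x : Dom m} (hx : x ≠ 0) (I : Fin ℓ → Fin m) :
    equatorMap m ℓ x (some I) = projCoord m ℓ I x := by
  obtain ⟨k, rfl⟩ := Nat.exists_eq_add_of_le' hℓ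
  exact radialProj_eq hm k I hx

theorem equatorMap_none (x : Dom m) : equatorMap m ℓ x none = 0 := rfl

theorem norm_sq_eq_sum_option {κ : Type} [Fintype κ] (v : EuclideanSpace ℝ (Option κ)) :
    ‖v‖ ^ 2 = v none ^ 2 + ∑ I, v (some I) ^ 2 := by
  rw [EuclideanSpace.real_norm_sq_eq, Fintype.sum_option]

theorem norm_equatorMap (hm : 3 ≤ m) (hℓ : 1 ≤ ℓ) {x : Dom m} (hx : x ≠ 0) :
    ‖equatorMap m ℓ x‖ = 1 := by
  have h : ‖equatorMap m ℓ x‖ ^ 2 = 1 := by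
    rw [norm_sq_eq_sum_option, equatorMap_none]
    simp only [equatorMap_some hm hℓ hx, sum_projCoord_sq hm ℓ hx]
    norm_num
  exact (pow_eq_one_iff_of_nonneg (norm_nonneg _) two_ne_zero).1 h

theorem grad_norm_sq {ι : Type} [Fintype ι] (G : Grad m ι) : ‖G‖ ^ 2 = ∑ i, ∑ j, G i j ^ 2 := by
  rw [PiLp.norm_sq_eq_of_L2]
  simp [EuclideanSpace.real_norm_sq_eq]

theorem norm_equatorGrad_sq (hm : 3 ≤ m) (hℓ : 1 ≤ ℓ) {x : Dom m} (hx : x ≠ 0) :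
    ‖equatorGrad m ℓ x‖ ^ 2 = eigenval m ℓ / ‖x‖ ^ 2 := by
  rw [grad_norm_sq, ← sum_projCoordDeriv_sq hm hℓ hx]
  simp [equatorGrad, Fintype.sum_option]

theorem norm_equatorGrad_rpow (hm : 3 ≤ m) (hℓ : 1 ≤ ℓ) {x : Dom m} (hx : x ≠ 0) (s : ℝ) :
    ‖equatorGrad m ℓ x‖ ^ s = eigenval m ℓ ^ (s / 2) * ‖x‖ ^ (-s) := by
  have hr : 0 < ‖x‖ := norm_pos_iff.2 hx
  have h : ‖equatorGrad m ℓ x‖ ^ s = (‖equatorGrad m ℓ x‖ ^ 2) ^ (s / 2) := by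
    rw [← Real.rpow_natCast_mul (norm_nonneg _)]
    congr 1
    push_cast
    ring
  rw [h, norm_equatorGrad_sq hm hℓ hx, Real.div_rpow (eigenval_pos hm hℓ).le (by positivity),
    norm_sq_rpow_half, Real.rpow_neg hr.le, div_eq_mul_inv]

theorem hasWeakPartials_projCoord (hm : 3 ≤ m) (I : Fin ℓ → Fin m) :
    HasWeakPartials (projCoord m ℓ I) (projCoordDeriv m ℓ I) := by
  have hm' : (3 : ℝ) ≤ m := by exact_mod_cast hm
  refine hasWeakPartials_norm_rpow_mul_polyFun (by omega) ?_ (isHomogeneous_harmPoly ℓ I) ?_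
  · simp
  · linarith

theorem hasWeakGrad_equatorMap (hm : 3 ≤ m) (hℓ : 1 ≤ ℓ) :
    HasWeakGrad (equatorMap m ℓ) (equatorGrad m ℓ) := by
  have h : ∀ j : Option (Fin ℓ → Fin m), HasWeakPartials (fun x => j.elim 0 (projCoord m ℓ · x))
      fun i x => j.elim 0 fun I => projCoordDeriv m ℓ I i x := by
    rintro (_ | I)
    · have := hasWeakPartials_of_contDiff (m := m) (g := fun _ => 0) contDiff_const
      have e : (fun (i : Fin m) (x : Dom m) => (0 : ℝ)) =
          fun i => partialDeriv i fun _ : Dom m => (0 : ℝ) := by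
        ext
        simp [partialDeriv]
      simp only [Option.elim_none]
      rw [e]
      exact this
    · exact hasWeakPartials_projCoord hm I
  refine hasWeakGrad_of_hasWeakPartials h ?_
  filter_upwards [ae_ne_zero (show 0 < m by omega)] with x hx
  rintro (_ | I)
  · rfl
  · exact equatorMap_some hm hℓ hx I

theorem ballMeasure_ae_ne_zero (hm : 0 < m) : ∀ᵐ x ∂(ballMeasure m), x ≠ 0 :=
  ae_restrict_of_ae (ae_ne_zero hm)

theorem ballMeasure_ae_norm_lt_one : ∀ᵐ x ∂(ballMeasure m), ‖x‖ < 1 := by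
  filter_upwards [ae_restrict_mem (μ := volume) (Metric.isOpen_ball (x := (0 : Dom m))
    (ε := 1)).measurableSet] with x hx
  simpa using hx

instance : IsFiniteMeasure (ballMeasure m) :=
  ⟨by simpa [ballMeasure] using measure_ball_lt_top⟩

theorem integrable_norm_rpow (hm : 0 < m) {s : ℝ} (hs : -(m : ℝ) < s) :
    Integrable (fun x : Dom m => ‖x‖ ^ s) (ballMeasure m) :=
  integrableOn_ball_of_norm_le_rpow (C := 1) (α := -s) (by simpa using Nat.succ_le_of_lt hm)
    (by simpa using by linarith)
    (.of_forall fun x => by simp [abs_of_nonneg (Real.rpow_nonneg (norm_nonneg x) s)])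
    (measurable_norm.pow_const s).aestronglyMeasurable

theorem aestronglyMeasurable_of_locallyIntegrableOn {V : Type*} [NormedAddCommGroup V]
    {u : Dom m → V} (hu : LocallyIntegrableOn u (ball m : Set (Dom m))) :
    AEStronglyMeasurable u (ballMeasure m) :=
  hu.aestronglyMeasurable

theorem memLp_equatorGrad (hm : 3 ≤ m) (hℓ : 1 ≤ ℓ) {p : ℝ} (hp : 2 ≤ p) (hpm : p < m) :
    MemLp (equatorGrad m ℓ) (ENNReal.ofReal p) (ballMeasure m) := by
  have hp0 : ENNReal.ofReal p ≠ 0 := by simpa using by linarith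
  rw [← integrable_norm_rpow_iff (aestronglyMeasurable_of_locallyIntegrableOn
    (hasWeakGrad_equatorMap hm hℓ).2) hp0 ENNReal.ofReal_ne_top,
    ENNReal.toReal_ofReal (by linarith)]
  have := (integrable_norm_rpow (m := m) (s := -p) (by omega) (by linarith)).const_mul
    (eigenval m ℓ ^ (p / 2))
  refine this.congr ?_
  filter_upwards [ballMeasure_ae_ne_zero (show 0 < m by omega)] with x hx
  exact (norm_equatorGrad_rpow hm hℓ hx p).symm

theorem memW1pSphere_equatorMap (hm : 3 ≤ m) (hℓ : 1 ≤ ℓ) {p : ℝ} (hp : 2 ≤ p) (hpm : p < m) :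
    MemW1pSphere p (equatorMap m ℓ) := by
  have h1 : ∀ᵐ x ∂(ballMeasure m), ‖equatorMap m ℓ x‖ = 1 := by
    filter_upwards [ballMeasure_ae_ne_zero (show 0 < m by omega)] with x hx
    exact norm_equatorMap hm hℓ hx
  refine ⟨⟨?_, _, hasWeakGrad_equatorMap hm hℓ, memLp_equatorGrad hm hℓ hp hpm⟩, ?_⟩
  · exact MemLp.of_bound (aestronglyMeasurable_of_locallyIntegrableOn
      (hasWeakGrad_equatorMap hm hℓ).1) 1 (h1.mono fun x hx => hx.le)
  · filter_upwards [h1] with x hx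
    simpa using hx

/-- The components of `div (r^{2-p} ∇u) = -λ r^{-p} u`, in the weak sense across the origin. -/
theorem sum_integral_partialDeriv_mul_projCoordDeriv (hm : 3 ≤ m) (hℓ : 1 ≤ ℓ) {p : ℝ}
    (hp : 2 ≤ p) (hpm : p < m) (I : Fin ℓ → Fin m) {φ : Dom m → ℝ} (hφ : ContDiff ℝ ∞ φ)
    (hc : HasCompactSupport φ) :
    ∑ i, ∫ x, partialDeriv i φ x * (‖x‖ ^ (2 - p) * projCoordDeriv m ℓ I i x) =
      eigenval m ℓ * ∫ x, φ x * (‖x‖ ^ (-p) * projCoord m ℓ I x) := by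
  have hm0 : 0 < m := by omega
  set H := harmPoly m ℓ I with hH
  have hHom : H.IsHomogeneous ℓ := isHomogeneous_harmPoly ℓ I
  have hℓ' : (1 : ℝ) ≤ ℓ := by exact_mod_cast hℓ
  have hw : ∀ i, HasWeakPartials
      (fun x : Dom m => ‖x‖ ^ (2 - p - ℓ) * polyFun (MvPolynomial.pderiv i H) x +
        -ℓ * (‖x‖ ^ (-p - ℓ) * polyFun (MvPolynomial.X i * H) x)) _ := fun i =>
    (hasWeakPartials_norm_rpow_mul_polyFun hm0 (by linarith) (hHom.pderiv (i := i))
      (by rw [Nat.cast_sub hℓ]; push_cast; linarith)).add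
    ((hasWeakPartials_norm_rpow_mul_polyFun hm0 (by linarith)
      ((MvPolynomial.isHomogeneous_X ℝ i).mul hHom) (by push_cast; linarith)).const_mul (-ℓ))
  have e1 : ∀ i, ∫ x, partialDeriv i φ x * (‖x‖ ^ (2 - p) * projCoordDeriv m ℓ I i x) =
      -∫ x, φ x * (radPolyDeriv (2 - p - ℓ) (MvPolynomial.pderiv i H) i x +
        -ℓ * radPolyDeriv (-p - ℓ) (MvPolynomial.X i * H) i x) := by
    intro i
    rw [← (hw i).3 φ hφ hc i]
    refine integral_congr_ae ?_
    filter_upwards [ae_ne_zero hm0] with x hx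
    have hr : 0 < ‖x‖ := norm_pos_iff.2 hx
    have s1 : ‖x‖ ^ (2 - p - ℓ) = ‖x‖ ^ (2 - p) * ‖x‖ ^ (-(ℓ : ℝ)) := by
      rw [← Real.rpow_add hr]; rfl
    have s2 : ‖x‖ ^ (-p - ℓ) = ‖x‖ ^ (2 - p) * ‖x‖ ^ (-(ℓ : ℝ)) / ‖x‖ ^ 2 := by
      rw [← Real.rpow_add hr, ← norm_rpow_sub_two hx]
      congr 1
      ring
    have s3 : polyFun (MvPolynomial.X i * H) x = x i * polyFun H x := by simp [polyFun]
    rw [projCoordDeriv_eq hx, s1, s2, s3, ← hH]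
    ring
  simp only [e1, Finset.sum_neg_distrib]
  rw [← integral_finsetSum, ← integral_neg, ← integral_const_mul]
  · refine integral_congr_ae ?_
    filter_upwards [ae_ne_zero hm0] with x hx
    have hr : 0 < ‖x‖ := norm_pos_iff.2 hx
    have s1 : ‖x‖ ^ (2 - p - ℓ - 2) = ‖x‖ ^ (-p - ℓ) := by congr 1; ring
    have s2 : ‖x‖ ^ (-p - ℓ - 2) = ‖x‖ ^ (-p - ℓ) / ‖x‖ ^ 2 := norm_rpow_sub_two hx _
    have s3 : ‖x‖ ^ (-p) * projCoord m ℓ I x = ‖x‖ ^ (-p - ℓ) * polyFun H x := by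
      rw [projCoord, ← mul_assoc, ← Real.rpow_add hr]; rfl
    have s4 : ∀ i, polyFun (MvPolynomial.pderiv i (MvPolynomial.X i * H)) x =
        polyFun H x + x i * polyFun (MvPolynomial.pderiv i H) x := fun i => by
      simp [polyFun, add_comm]
    have s5 : ∀ i, polyFun (MvPolynomial.X i * H) x = x i * polyFun H x := fun i => by
      simp [polyFun]
    have s6 : ∑ i, polyFun (MvPolynomial.pderiv i (MvPolynomial.pderiv i H)) x = 0 := by
      have := congrArg (fun P => polyFun P x) (polyLaplacian_harmPoly hm ℓ I)
      simpa [polyFun, polyLaplacian] using this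
    have s7 : ∑ i, x i ^ 2 = ‖x‖ ^ 2 := (EuclideanSpace.real_norm_sq_eq x).symm
    have s8 := sum_coord_mul_polyFun_pderiv_harmPoly ℓ I x
    rw [← hH] at s8
    rw [s3, ← Finset.mul_sum]
    have s9 : ∀ i, radPolyDeriv (2 - p - ℓ) (MvPolynomial.pderiv i H) i x +
        -ℓ * radPolyDeriv (-p - ℓ) (MvPolynomial.X i * H) i x =
        (2 - p - ℓ - ℓ) * ‖x‖ ^ (-p - ℓ) * (x i * polyFun (MvPolynomial.pderiv i H) x) +
        ‖x‖ ^ (2 - p - ℓ) * polyFun (MvPolynomial.pderiv i (MvPolynomial.pderiv i H)) x +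
        ℓ * (p + ℓ) * (‖x‖ ^ (-p - ℓ) / ‖x‖ ^ 2) * polyFun H x * x i ^ 2 -
        ℓ * ‖x‖ ^ (-p - ℓ) * polyFun H x := fun i => by
      rw [radPolyDeriv, radPolyDeriv, s1, s2, s4, s5]
      ring
    simp only [s9, Finset.sum_add_distrib, Finset.sum_sub_distrib, ← Finset.mul_sum, s6, s7, s8,
      Finset.sum_const, Finset.card_univ, Fintype.card_fin, nsmul_eq_mul]
    rw [eigenval]
    field_simp
    ring
  · intro i _
    exact LocallyIntegrable.integrable_mul_of_hasCompactSupport ((hw i).2 i) hφ.continuous hc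

theorem grad_inner_eq {ι : Type} [Fintype ι] (G K : Grad m ι) :
    inner ℝ G K = ∑ i, ∑ j, K i j * G i j := by
  simp [PiLp.inner_apply]

theorem TestFunction.contDiff_apply {ι : Type} [Fintype ι] (β : 𝓓(ball m, EuclideanSpace ℝ ι))
    (j : ι) : ContDiff ℝ ∞ fun x => β x j :=
  (EuclideanSpace.proj j : EuclideanSpace ℝ ι →L[ℝ] ℝ).contDiff.comp β.contDiff

theorem TestFunction.hasCompactSupport_apply {ι : Type} [Fintype ι]
    (β : 𝓓(ball m, EuclideanSpace ℝ ι)) (j : ι) : HasCompactSupport fun x => β x j :=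
  β.hasCompactSupport.comp_left (g := fun v : EuclideanSpace ℝ ι => v j) rfl

theorem TestFunction.eq_zero_of_notMem {V : Type} [NormedAddCommGroup V] [NormedSpace ℝ V]
    (β : 𝓓(ball m, V)) {x : Dom m} (hx : x ∉ (ball m : Set (Dom m))) : β x = 0 :=
  image_eq_zero_of_notMem_tsupport fun h => hx (β.tsupport_subset h)

theorem TestFunction.partialDeriv_eq_zero_of_notMem {V : Type} [NormedAddCommGroup V]
    [NormedSpace ℝ V] (β : 𝓓(ball m, V)) {x : Dom m} (hx : x ∉ (ball m : Set (Dom m)))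
    (i : Fin m) : partialDeriv i β x = 0 :=
  partialDeriv_eq_zero_of_notMem_tsupport (fun h => hx (β.tsupport_subset h)) i

theorem TestFunction.classicalGrad_eq_zero_of_notMem {ι : Type} [Fintype ι]
    (β : 𝓓(ball m, EuclideanSpace ℝ ι)) {x : Dom m} (hx : x ∉ (ball m : Set (Dom m))) :
    classicalGrad β x = 0 := by
  ext i j
  simp [classicalGrad, TestFunction.partialDeriv_eq_zero_of_notMem β hx]

theorem TestFunction.classicalGrad_apply {ι : Type} [Fintype ι]
    (β : 𝓓(ball m, EuclideanSpace ℝ ι)) (x : Dom m) (i : Fin m) (j : ι) :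
    classicalGrad β x i j = partialDeriv i (fun y => β y j) x := by
  rw [partialDeriv_apply (β.contDiff.differentiable (by simp) x)]
  rfl

theorem locallyIntegrable_norm_rpow_mul_projCoordDeriv (hm : 3 ≤ m) (hℓ : 1 ≤ ℓ)
    {p : ℝ} (hpm : p < m) (I : Fin ℓ → Fin m) (i : Fin m) :
    LocallyIntegrable fun x : Dom m => ‖x‖ ^ (2 - p) * projCoordDeriv m ℓ I i x := by
  have hm0 : 0 < m := by omega
  have hHom := isHomogeneous_harmPoly ℓ I
  have h := (locallyIntegrable_norm_rpow_mul_polyFun hm0 (q := 2 - p - ℓ) (hHom.pderiv (i := i))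
    (by rw [Nat.cast_sub hℓ]; push_cast; linarith)).add
    ((locallyIntegrable_norm_rpow_mul_polyFun hm0 (q := -p - ℓ)
      ((MvPolynomial.isHomogeneous_X ℝ i).mul hHom) (by push_cast; linarith)).smul (-ℓ : ℝ))
  refine h.congr ?_
  filter_upwards [ae_ne_zero hm0] with x hx
  have hr : 0 < ‖x‖ := norm_pos_iff.2 hx
  have s1 : ‖x‖ ^ (2 - p - ℓ) = ‖x‖ ^ (2 - p) * ‖x‖ ^ (-(ℓ : ℝ)) := by
    rw [← Real.rpow_add hr]; rfl
  have s2 : ‖x‖ ^ (-p - ℓ) = ‖x‖ ^ (2 - p) * ‖x‖ ^ (-(ℓ : ℝ)) / ‖x‖ ^ 2 := by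
    rw [← Real.rpow_add hr, ← norm_rpow_sub_two hx]
    congr 1
    ring
  have s3 : polyFun (MvPolynomial.X i * harmPoly m ℓ I) x = x i * polyFun (harmPoly m ℓ I) x := by
    simp [polyFun]
  simp only [Pi.add_apply, Pi.smul_apply, smul_eq_mul]
  rw [projCoordDeriv_eq hx, s1, s2, s3]
  ring

/-- The equation `div (r^{2-p} ∇u) = -λ r^{-p} u`, tested with smooth maps. -/
theorem integral_inner_equatorGrad_testFunction (hm : 3 ≤ m) (hℓ : 1 ≤ ℓ) {p : ℝ}
    (hp : 2 ≤ p) (hpm : p < m) (β : 𝓓(ball m, EuclideanSpace ℝ (Option (Fin ℓ → Fin m)))) :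
    ∫ x, ‖x‖ ^ (2 - p) * inner ℝ (equatorGrad m ℓ x) (classicalGrad β x) ∂(ballMeasure m) =
      eigenval m ℓ * ∫ x, ‖x‖ ^ (-p) * inner ℝ (equatorMap m ℓ x) (β x) ∂(ballMeasure m) := by
  have hm0 : 0 < m := by omega
  rw [integral_ballMeasure_eq fun x hx => by
      rw [TestFunction.classicalGrad_eq_zero_of_notMem β hx, inner_zero_right, mul_zero],
    integral_ballMeasure_eq fun x hx => by
      rw [TestFunction.eq_zero_of_notMem β hx, inner_zero_right, mul_zero]]
  have e1 : ∀ x, ‖x‖ ^ (2 - p) * inner ℝ (equatorGrad m ℓ x) (classicalGrad β x) =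
      ∑ I, ∑ i, partialDeriv i (fun y => β y (some I)) x *
        (‖x‖ ^ (2 - p) * projCoordDeriv m ℓ I i x) := by
    intro x
    rw [grad_inner_eq, Finset.sum_comm, Fintype.sum_option]
    simp only [TestFunction.classicalGrad_apply, Finset.mul_sum, equatorGrad, Option.elim_none,
      Option.elim_some, mul_zero, Finset.sum_const_zero, zero_add]
    exact Finset.sum_congr rfl fun I _ => Finset.sum_congr rfl fun i _ => by ring
  have e2 : ∀ᵐ x : Dom m, ‖x‖ ^ (-p) * inner ℝ (equatorMap m ℓ x) (β x) =
      ∑ I, β x (some I) * (‖x‖ ^ (-p) * projCoord m ℓ I x) := by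
    filter_upwards [ae_ne_zero hm0] with x hx
    rw [PiLp.inner_apply, Fintype.sum_option]
    simp only [equatorMap_some hm hℓ hx, equatorMap_none]
    simp [Finset.mul_sum]
    exact Finset.sum_congr rfl fun I _ => by ring
  have hl : ∀ I : Fin ℓ → Fin m, LocallyIntegrable fun x => ‖x‖ ^ (-p) * projCoord m ℓ I x := by
    intro I
    have h := locallyIntegrable_norm_rpow_mul_polyFun hm0 (q := -p - ℓ)
      (isHomogeneous_harmPoly ℓ I) (by linarith)
    refine h.congr ?_
    filter_upwards [ae_ne_zero hm0] with x hx
    rw [projCoord, ← mul_assoc, ← Real.rpow_add (norm_pos_iff.2 hx)]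
    rfl
  simp only [e1]
  rw [integral_congr_ae e2, integral_finsetSum, integral_finsetSum, Finset.mul_sum]
  · refine Finset.sum_congr rfl fun I _ => ?_
    rw [← sum_integral_partialDeriv_mul_projCoordDeriv hm hℓ hp hpm I
      (TestFunction.contDiff_apply β (some I)) (TestFunction.hasCompactSupport_apply β (some I)),
      integral_finsetSum]
    intro i _
    exact LocallyIntegrable.integrable_mul_of_hasCompactSupport
      (locallyIntegrable_norm_rpow_mul_projCoordDeriv hm hℓ hpm I i)
      (contDiff_partialDeriv (TestFunction.contDiff_apply β _) i).continuous
      (hasCompactSupport_partialDeriv (TestFunction.hasCompactSupport_apply β _) i)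
  · intro I _
    exact LocallyIntegrable.integrable_mul_of_hasCompactSupport (hl I)
      (TestFunction.contDiff_apply β _).continuous (TestFunction.hasCompactSupport_apply β _)
  · intro I _
    refine integrable_finsetSum _ fun i _ => ?_
    exact LocallyIntegrable.integrable_mul_of_hasCompactSupport
      (locallyIntegrable_norm_rpow_mul_projCoordDeriv hm hℓ hpm I i)
      (contDiff_partialDeriv (TestFunction.contDiff_apply β _) i).continuous
      (hasCompactSupport_partialDeriv (TestFunction.hasCompactSupport_apply β _) i)

theorem isPHarmonic_equatorMap (hm : 3 ≤ m) (hℓ : 1 ≤ ℓ) {p : ℝ} (hp : 2 ≤ p) (hpm : p < m) :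
    IsPHarmonic p (equatorMap m ℓ) := by
  refine ⟨memW1pSphere_equatorMap hm hℓ hp hpm, fun β => ?_⟩
  have hm0 : 0 < m := by omega
  have hG := (hasWeakGrad_equatorMap hm hℓ).weakGrad_ae_eq
  have e1 : ∫ x, ‖weakGrad (equatorMap m ℓ) x‖ ^ (p - 2) *
      inner ℝ (weakGrad (equatorMap m ℓ) x) (classicalGrad β x) ∂(ballMeasure m) =
      eigenval m ℓ ^ ((p - 2) / 2) * ∫ x, ‖x‖ ^ (2 - p) *
        inner ℝ (equatorGrad m ℓ x) (classicalGrad β x) ∂(ballMeasure m) := by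
    rw [← integral_const_mul]
    refine integral_congr_ae ?_
    filter_upwards [hG, ballMeasure_ae_ne_zero hm0] with x hx hx0
    rw [hx, norm_equatorGrad_rpow hm hℓ hx0, neg_sub]
    ring
  have e2 : ∫ x, ‖weakGrad (equatorMap m ℓ) x‖ ^ p *
      inner ℝ (equatorMap m ℓ x) (β x) ∂(ballMeasure m) =
      eigenval m ℓ ^ (p / 2) * ∫ x, ‖x‖ ^ (-p) *
        inner ℝ (equatorMap m ℓ x) (β x) ∂(ballMeasure m) := by
    rw [← integral_const_mul]
    refine integral_congr_ae ?_
    filter_upwards [hG, ballMeasure_ae_ne_zero hm0] with x hx hx0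
    rw [hx, norm_equatorGrad_rpow hm hℓ hx0]
    ring
  rw [e1, e2, integral_inner_equatorGrad_testFunction hm hℓ hp hpm β, ← mul_assoc]
  congr 1
  rw [← Real.rpow_add_one (eigenval_pos hm hℓ).ne']
  congr 1
  ring

end Equator

/-! ### The weighted Hardy inequality -/

section Hardy

open scoped ContDiff

variable {m : ℕ} {ι : Type} [Fintype ι]

theorem locallyIntegrable_norm_rpow (hm : 0 < m) {s : ℝ} (hs : -(m : ℝ) < s) :
    LocallyIntegrable fun x : Dom m => ‖x‖ ^ s :=
  locallyIntegrable_of_abs_le_rpow hm hs (C := 1)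
    (fun x _ => by simp [abs_of_nonneg (Real.rpow_nonneg (norm_nonneg x) s)])
    (measurable_norm.pow_const s)

theorem hasWeakPartials_norm_rpow_mul_coord (hm : 0 < m) {q : ℝ} (hq : q ≤ 0)
    (hqm : -(m : ℝ) < q) (i : Fin m) :
    HasWeakPartials (fun x : Dom m => ‖x‖ ^ q * x i) (radPolyDeriv q (MvPolynomial.X i)) := by
  have := hasWeakPartials_norm_rpow_mul_polyFun hm hq (MvPolynomial.isHomogeneous_X ℝ i)
    (by push_cast; linarith)
  simpa [polyFun] using this

/-- `div (r^q x) = (m + q) r^q`, in the weak sense across the origin. -/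
theorem sum_integral_partialDeriv_mul_norm_rpow_mul_coord (hm : 0 < m) {q : ℝ} (hq : q ≤ 0)
    (hqm : -(m : ℝ) < q) {φ : Dom m → ℝ} (hφ : ContDiff ℝ ∞ φ) (hc : HasCompactSupport φ) :
    ∑ i, ∫ x, partialDeriv i φ x * (‖x‖ ^ q * x i) =
      -((m + q) * ∫ x, φ x * ‖x‖ ^ q) := by
  have hw := fun i => hasWeakPartials_norm_rpow_mul_coord hm hq hqm i
  rw [Finset.sum_congr rfl fun i _ => (hw i).3 φ hφ hc i, Finset.sum_neg_distrib,
    ← integral_finsetSum, ← integral_const_mul]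
  · congr 1
    refine integral_congr_ae ?_
    filter_upwards [ae_ne_zero hm] with x hx
    have hr : 0 < ‖x‖ := norm_pos_iff.2 hx
    have h1 : ∀ i, radPolyDeriv q (MvPolynomial.X i) i x =
        q * ‖x‖ ^ (q - 2) * x i ^ 2 + ‖x‖ ^ q := fun i => by
      simp [radPolyDeriv, polyFun, sq]
    rw [← Finset.mul_sum]
    simp only [h1, Finset.sum_add_distrib, ← Finset.mul_sum, ← EuclideanSpace.real_norm_sq_eq,
      Finset.sum_const, Finset.card_univ, Fintype.card_fin, nsmul_eq_mul]
    rw [norm_rpow_sub_two hx]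
    field_simp
    ring
  · intro i _
    exact LocallyIntegrable.integrable_mul_of_hasCompactSupport ((hw i).2 i) hφ.continuous hc

/-- The scalar form of the Hardy inequality with weight `r^{2-p}`, with its sharp constant
`a² = ((m - p)/2)²` and a remainder term. It expresses that
`r^{2-p} |∇φ + (a r⁻² + 1) φ x|²` has a nonnegative integral: the vector field `a r⁻² x` alone would
give the sharp inequality without remainder. -/
theorem hardy_scalar (hm : 0 < m) {p : ℝ} (hp : 2 ≤ p) (hpm : p < m) {φ : Dom m → ℝ}
    (hφ : ContDiff ℝ ∞ φ) (hc : HasCompactSupport φ)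
    (hs : tsupport φ ⊆ (ball m : Set (Dom m))) :
    ∫ x, ‖x‖ ^ (-p) * (((m - p) / 2) ^ 2 + ‖x‖ ^ 2) * φ x ^ 2 ≤
      ∫ x, ‖x‖ ^ (2 - p) * ∑ i, partialDeriv i φ x ^ 2 := by
  set a : ℝ := (m - p) / 2 with ha
  have hp1 := locallyIntegrable_norm_rpow (m := m) hm (s := -p) (by linarith)
  have hp2 := locallyIntegrable_norm_rpow (m := m) hm (s := 2 - p) (by linarith)
  have hψ : ContDiff ℝ ∞ fun x => φ x ^ 2 := hφ.pow 2
  have hψc : HasCompactSupport fun x => φ x ^ 2 := hc.comp_left (g := fun t : ℝ => t ^ 2) (by simp)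
  have d1 := sum_integral_partialDeriv_mul_norm_rpow_mul_coord hm (q := -p) (by linarith)
    (by linarith) hψ hψc
  have d2 := sum_integral_partialDeriv_mul_norm_rpow_mul_coord hm (q := 2 - p) (by linarith)
    (by linarith) hψ hψc
  have hψi := fun i => (contDiff_partialDeriv hψ i).continuous
  have hψci := fun i => hasCompactSupport_partialDeriv hψc i
  have j1 : ∀ i, Integrable fun x => partialDeriv i (fun y => φ y ^ 2) x * (‖x‖ ^ (-p) * x i) :=
    fun i => LocallyIntegrable.integrable_mul_of_hasCompactSupport
      (hasWeakPartials_norm_rpow_mul_coord hm (by linarith) (by linarith) i).1 (hψi i) (hψci i)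
  have j2 : ∀ i, Integrable fun x => partialDeriv i (fun y => φ y ^ 2) x * (‖x‖ ^ (2 - p) * x i) :=
    fun i => LocallyIntegrable.integrable_mul_of_hasCompactSupport
      (hasWeakPartials_norm_rpow_mul_coord hm (by linarith) (by linarith) i).1 (hψi i) (hψci i)
  have k1 : Integrable fun x => φ x ^ 2 * ‖x‖ ^ (-p) :=
    LocallyIntegrable.integrable_mul_of_hasCompactSupport hp1 hψ.continuous hψc
  have k2 : Integrable fun x => φ x ^ 2 * ‖x‖ ^ (2 - p) :=
    LocallyIntegrable.integrable_mul_of_hasCompactSupport hp2 hψ.continuous hψc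
  have k3 : Integrable fun x => ‖x‖ ^ (2 - p) * ∑ i, partialDeriv i φ x ^ 2 := by
    have h : ∀ i, Integrable fun x => partialDeriv i φ x ^ 2 * ‖x‖ ^ (2 - p) := fun i =>
      LocallyIntegrable.integrable_mul_of_hasCompactSupport hp2
        ((contDiff_partialDeriv hφ i).continuous.pow 2)
        ((hasCompactSupport_partialDeriv hc i).comp_left (g := fun t : ℝ => t ^ 2) (by simp))
    refine (integrable_finsetSum Finset.univ fun i _ => h i).congr (.of_forall fun x => ?_)
    simp only [← Finset.sum_mul]
    ring
  -- the identity `∫ div (φ² K) = 0` for the field `K = r^{-p} (a + r²) x`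
  have s1 : ∫ x, ∑ i, partialDeriv i (fun y => φ y ^ 2) x *
      (a * (‖x‖ ^ (-p) * x i) + ‖x‖ ^ (2 - p) * x i) =
      -(2 * a ^ 2 * (∫ x, φ x ^ 2 * ‖x‖ ^ (-p)) +
        (2 * a + 2) * ∫ x, φ x ^ 2 * ‖x‖ ^ (2 - p)) := by
    rw [integral_finsetSum]
    · have : ∀ i, ∫ x, partialDeriv i (fun y => φ y ^ 2) x *
          (a * (‖x‖ ^ (-p) * x i) + ‖x‖ ^ (2 - p) * x i) =
          a * (∫ x, partialDeriv i (fun y => φ y ^ 2) x * (‖x‖ ^ (-p) * x i)) +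
          ∫ x, partialDeriv i (fun y => φ y ^ 2) x * (‖x‖ ^ (2 - p) * x i) := fun i => by
        rw [← integral_const_mul, ← integral_add ((j1 i).const_mul a) (j2 i)]
        refine integral_congr_ae (.of_forall fun x => ?_)
        simp only
        ring
      simp only [this, Finset.sum_add_distrib, ← Finset.mul_sum, d1, d2]
      rw [ha]
      ring
    · intro i _
      refine (((j1 i).const_mul a).add (j2 i)).congr (.of_forall fun x => ?_)
      simp only [Pi.add_apply]
      ring
  have s2 : Integrable fun x => ∑ i, partialDeriv i (fun y => φ y ^ 2) x *
      (a * (‖x‖ ^ (-p) * x i) + ‖x‖ ^ (2 - p) * x i) := by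
    refine integrable_finsetSum _ fun i _ => ?_
    refine (((j1 i).const_mul a).add (j2 i)).congr (.of_forall fun x => ?_)
    simp only [Pi.add_apply]
    ring
  have main : ∫ x, (‖x‖ ^ (-p) * (a ^ 2 + ‖x‖ ^ 2) * φ x ^ 2) ≤
      ∫ x, (‖x‖ ^ (2 - p) * ∑ i, partialDeriv i φ x ^ 2 +
        ∑ i, partialDeriv i (fun y => φ y ^ 2) x *
          (a * (‖x‖ ^ (-p) * x i) + ‖x‖ ^ (2 - p) * x i) +
        (2 * a ^ 2 * (φ x ^ 2 * ‖x‖ ^ (-p)) + (2 * a + 2) * (φ x ^ 2 * ‖x‖ ^ (2 - p)))) := by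
    refine integral_mono_ae ?_ ((k3.add s2).add ((k1.const_mul _).add (k2.const_mul _))) ?_
    · refine ((k1.const_mul (a ^ 2)).add k2).congr ?_
      filter_upwards [ae_ne_zero hm] with x hx
      have : ‖x‖ ^ (2 - p) = ‖x‖ ^ (-p) * ‖x‖ ^ 2 := by
        rw [← Real.rpow_two, ← Real.rpow_add (norm_pos_iff.2 hx)]
        congr 1
        ring
      simp only [Pi.add_apply]
      rw [this]
      ring
    · filter_upwards [ae_ne_zero hm] with x hx
      by_cases hxb : x ∈ (ball m : Set (Dom m))
      · have hr : 0 < ‖x‖ := norm_pos_iff.2 hx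
        have hr1 : ‖x‖ < 1 := by simpa [ball] using hxb
        have hw : ‖x‖ ^ (2 - p) = ‖x‖ ^ (-p) * ‖x‖ ^ 2 := by
          rw [← Real.rpow_two, ← Real.rpow_add hr]
          congr 1
          ring
        have hd : ∀ i, partialDeriv i (fun y => φ y ^ 2) x = 2 * φ x * partialDeriv i φ x := by
          intro i
          have := partialDeriv_mul (hφ.differentiable (by simp) x)
            (hφ.differentiable (by simp) x) i
          simp only [sq]
          rw [this]
          ring
        have hsq : 0 ≤ ‖x‖ ^ (-p) * ∑ i,
            (‖x‖ * partialDeriv i φ x + (a + ‖x‖ ^ 2) * φ x * (x i / ‖x‖)) ^ 2 := by positivity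
        have hexp : ∑ i, (‖x‖ * partialDeriv i φ x + (a + ‖x‖ ^ 2) * φ x * (x i / ‖x‖)) ^ 2 =
            ‖x‖ ^ 2 * ∑ i, partialDeriv i φ x ^ 2 +
            ∑ i, 2 * φ x * partialDeriv i φ x * ((a + ‖x‖ ^ 2) * x i) +
            (a + ‖x‖ ^ 2) ^ 2 * φ x ^ 2 := by
          have h1 : ∀ i, (‖x‖ * partialDeriv i φ x + (a + ‖x‖ ^ 2) * φ x * (x i / ‖x‖)) ^ 2 =
              ‖x‖ ^ 2 * partialDeriv i φ x ^ 2 +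
              2 * φ x * partialDeriv i φ x * ((a + ‖x‖ ^ 2) * x i) +
              ((a + ‖x‖ ^ 2) ^ 2 * φ x ^ 2 / ‖x‖ ^ 2) * x i ^ 2 := fun i => by
            field_simp
            ring
          simp only [h1, Finset.sum_add_distrib, ← Finset.mul_sum,
            ← EuclideanSpace.real_norm_sq_eq]
          rw [div_mul_cancel₀ _ (by positivity)]
        rw [hexp] at hsq
        have hsum : ∑ i, partialDeriv i (fun y => φ y ^ 2) x *
            (a * (‖x‖ ^ (-p) * x i) + ‖x‖ ^ (2 - p) * x i) =
            ‖x‖ ^ (-p) * ∑ i, 2 * φ x * partialDeriv i φ x * ((a + ‖x‖ ^ 2) * x i) := by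
          rw [Finset.mul_sum]
          refine Finset.sum_congr rfl fun i _ => ?_
          rw [hd, hw]
          ring
        have hrem : 0 ≤ ‖x‖ ^ (-p) * φ x ^ 2 * (‖x‖ ^ 2 * (1 - ‖x‖ ^ 2)) := by
          have : ‖x‖ ^ 2 ≤ 1 := pow_le_one₀ hr.le hr1.le
          have : 0 ≤ 1 - ‖x‖ ^ 2 := by linarith
          positivity
        rw [hsum, hw]
        nlinarith [hsq, hrem]
      · have h0 : x ∉ tsupport φ := fun h => hxb (hs h)
        have h1 : φ x = 0 := image_eq_zero_of_notMem_tsupport h0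
        have h2 : ∀ i, partialDeriv i φ x = 0 := partialDeriv_eq_zero_of_notMem_tsupport h0
        have h3 : ∀ i, partialDeriv i (fun y => φ y ^ 2) x = 0 := fun i => by
          have := partialDeriv_mul (hφ.differentiable (by simp) x)
            (hφ.differentiable (by simp) x) i
          simp only [sq]
          rw [this, h1]
          ring
        simp [h1, h2, h3]
  refine main.trans_eq ?_
  refine (integral_add (k3.add s2) ((k1.const_mul _).add (k2.const_mul _))).trans ?_
  rw [integral_add' k3 s2, integral_add' (k1.const_mul _) (k2.const_mul _), s1,
    integral_const_mul, integral_const_mul]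
  ring

/-- The square root of the weight `r^{2-p}` of the gradient. -/
noncomputable def gradWeight (p : ℝ) (x : Dom m) : ℝ := ‖x‖ ^ ((2 - p) / 2)

/-- The square root of the weight `r^{-p} (a² + r²)`, where `a = (m - p)/2`. -/
noncomputable def hardyWeight (p : ℝ) (x : Dom m) : ℝ :=
  Real.sqrt (‖x‖ ^ (-p) * (((m - p) / 2) ^ 2 + ‖x‖ ^ 2))

theorem measurable_gradWeight (p : ℝ) : Measurable (gradWeight (m := m) p) :=
  measurable_norm.pow_const _

theorem measurable_hardyWeight (p : ℝ) : Measurable (hardyWeight (m := m) p) :=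
  ((measurable_norm.pow_const _).mul (measurable_const.add (measurable_norm.pow_const 2))).sqrt

theorem gradWeight_sq (p : ℝ) (x : Dom m) : gradWeight p x ^ 2 = ‖x‖ ^ (2 - p) := by
  rw [gradWeight, ← Real.rpow_mul_natCast (norm_nonneg x)]
  congr 1
  push_cast
  ring

theorem hardyWeight_sq (p : ℝ) (x : Dom m) :
    hardyWeight p x ^ 2 = ‖x‖ ^ (-p) * (((m - p) / 2) ^ 2 + ‖x‖ ^ 2) :=
  Real.sq_sqrt (by positivity)

theorem norm_smul_sq {V : Type*} [NormedAddCommGroup V] [NormedSpace ℝ V] (c : ℝ) (v : V) :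
    ‖c • v‖ ^ 2 = c ^ 2 * ‖v‖ ^ 2 := by
  rw [norm_smul, mul_pow, Real.norm_eq_abs, sq_abs]

theorem eLpNorm_two_le_iff {α : Type*} [MeasurableSpace α] {μ : Measure α} {V W : Type*}
    [NormedAddCommGroup V] [NormedAddCommGroup W] {f : α → V} {g : α → W} (hf : MemLp f 2 μ)
    (hg : MemLp g 2 μ) :
    eLpNorm f 2 μ ≤ eLpNorm g 2 μ ↔ ∫ x, ‖f x‖ ^ 2 ∂μ ≤ ∫ x, ‖g x‖ ^ 2 ∂μ := by
  rw [hf.eLpNorm_eq_integral_rpow_norm two_ne_zero ENNReal.ofNat_ne_top,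
    hg.eLpNorm_eq_integral_rpow_norm two_ne_zero ENNReal.ofNat_ne_top,
    ENNReal.ofReal_le_ofReal_iff (by positivity)]
  simp only [ENNReal.toReal_ofNat, Real.rpow_two]
  exact Real.rpow_le_rpow_iff (by positivity) (by positivity) (by norm_num)

theorem contDiff_classicalGrad (φ : 𝓓(ball m, EuclideanSpace ℝ ι)) :
    ContDiff ℝ ∞ (classicalGrad φ) := by
  refine (contDiff_piLp 2).2 fun i => ?_
  exact contDiff_partialDeriv φ.contDiff i

theorem memLp_gradWeight_smul_classicalGrad (hm : 0 < m) {p : ℝ} (hpm : p < m)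
    (φ : 𝓓(ball m, EuclideanSpace ℝ ι)) :
    MemLp (fun x => gradWeight p x • classicalGrad φ x) 2 (ballMeasure m) := by
  have hcont := (contDiff_classicalGrad φ).continuous
  have hmeas : AEStronglyMeasurable (fun x => gradWeight p x • classicalGrad φ x)
      (ballMeasure m) :=
    (measurable_gradWeight p).aestronglyMeasurable.smul hcont.aestronglyMeasurable
  rw [memLp_two_iff_integrable_sq_norm hmeas]
  simp only [norm_smul_sq, gradWeight_sq]
  have hc : HasCompactSupport fun x => ‖classicalGrad φ x‖ ^ 2 := by
    refine HasCompactSupport.of_support_subset_isCompact φ.hasCompactSupport fun x hx => ?_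
    by_contra h
    refine hx ?_
    have : classicalGrad φ x = 0 := by
      ext i j
      simp [classicalGrad, partialDeriv_eq_zero_of_notMem_tsupport h]
    simp [this]
  have := LocallyIntegrable.integrable_mul_of_hasCompactSupport
    (locallyIntegrable_norm_rpow hm (s := 2 - p) (by linarith)) (hcont.norm.pow 2) hc
  refine this.restrict.congr (.of_forall fun x => ?_)
  simp only [Pi.pow_apply]
  ring

theorem memLp_hardyWeight_smul_testFunction (hm : 0 < m) {p : ℝ} (hpm : p < m)
    (φ : 𝓓(ball m, EuclideanSpace ℝ ι)) :
    MemLp (fun x => hardyWeight p x • φ x) 2 (ballMeasure m) := by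
  have hmeas : AEStronglyMeasurable (fun x => hardyWeight p x • φ x) (ballMeasure m) :=
    (measurable_hardyWeight p).aestronglyMeasurable.smul φ.continuous.aestronglyMeasurable
  rw [memLp_two_iff_integrable_sq_norm hmeas]
  simp only [norm_smul_sq, hardyWeight_sq]
  have hc : HasCompactSupport fun x => (((m - p) / 2) ^ 2 + ‖x‖ ^ 2) * ‖φ x‖ ^ 2 :=
    (φ.hasCompactSupport.comp_left (g := fun v : EuclideanSpace ℝ ι => ‖v‖ ^ 2)
      (by simp)).mul_left
  have := LocallyIntegrable.integrable_mul_of_hasCompactSupport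
    (locallyIntegrable_norm_rpow hm (s := -p) (by linarith))
    ((continuous_const.add (continuous_norm.pow 2)).mul (φ.continuous.norm.pow 2)) hc
  refine this.restrict.congr (.of_forall fun x => ?_)
  simp only [Pi.mul_apply, Pi.add_apply, Pi.pow_apply]
  ring

/-- The Hardy inequality for vector-valued test functions, as a comparison of `L²` norms. -/
theorem hardy_testFunction (hm : 0 < m) {p : ℝ} (hp : 2 ≤ p) (hpm : p < m)
    (φ : 𝓓(ball m, EuclideanSpace ℝ ι)) :
    eLpNorm (fun x => hardyWeight p x • φ x) 2 (ballMeasure m) ≤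
      eLpNorm (fun x => gradWeight p x • classicalGrad φ x) 2 (ballMeasure m) := by
  rw [eLpNorm_two_le_iff (memLp_hardyWeight_smul_testFunction hm hpm φ)
    (memLp_gradWeight_smul_classicalGrad hm hpm φ)]
  simp only [norm_smul_sq, gradWeight_sq, hardyWeight_sq]
  rw [integral_ballMeasure_eq fun x hx => by simp [TestFunction.eq_zero_of_notMem φ hx],
    integral_ballMeasure_eq fun x hx => by
      simp [TestFunction.classicalGrad_eq_zero_of_notMem φ hx]]
  have hj : ∀ j, tsupport (fun x => φ x j) ⊆ (ball m : Set (Dom m)) := fun j =>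
    (closure_mono fun x (hx : φ x j ≠ 0) => show φ x ≠ 0 from fun h => hx (by simp [h])).trans
      φ.tsupport_subset
  have e1 : ∀ x, ‖x‖ ^ (-p) * (((m - p) / 2) ^ 2 + ‖x‖ ^ 2) * ‖φ x‖ ^ 2 =
      ∑ j, ‖x‖ ^ (-p) * (((m - p) / 2) ^ 2 + ‖x‖ ^ 2) * φ x j ^ 2 := fun x => by
    rw [EuclideanSpace.real_norm_sq_eq (φ x), Finset.mul_sum]
  have e2 : ∀ x, ‖x‖ ^ (2 - p) * ‖classicalGrad φ x‖ ^ 2 =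
      ∑ j, ‖x‖ ^ (2 - p) * ∑ i, partialDeriv i (fun y => φ y j) x ^ 2 := fun x => by
    rw [grad_norm_sq, Finset.sum_comm, Finset.mul_sum]
    simp only [TestFunction.classicalGrad_apply]
  simp only [e1, e2]
  rw [integral_finsetSum, integral_finsetSum]
  · exact Finset.sum_le_sum fun j _ => hardy_scalar hm hp hpm (TestFunction.contDiff_apply φ j)
      (TestFunction.hasCompactSupport_apply φ j) (hj j)
  · intro j _
    simp only [Finset.mul_sum]
    refine integrable_finsetSum _ fun i _ => ?_
    have hcj : HasCompactSupport fun x => partialDeriv i (fun y => φ y j) x ^ 2 :=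
      (hasCompactSupport_partialDeriv (TestFunction.hasCompactSupport_apply φ j) i).comp_left
        (g := fun t : ℝ => t ^ 2) (by simp)
    have := LocallyIntegrable.integrable_mul_of_hasCompactSupport
      (locallyIntegrable_norm_rpow hm (s := 2 - p) (by linarith))
      ((contDiff_partialDeriv (TestFunction.contDiff_apply φ j) i).continuous.pow 2) hcj
    refine this.congr (.of_forall fun x => ?_)
    simp [mul_comm]
  · intro j _
    have hcj : HasCompactSupport fun x => φ x j ^ 2 :=
      (TestFunction.hasCompactSupport_apply φ j).comp_left (g := fun t : ℝ => t ^ 2) (by simp)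
    have hcj' : HasCompactSupport fun x : Dom m => (((m - p) / 2) ^ 2 + ‖x‖ ^ 2) * φ x j ^ 2 :=
      hcj.mul_left
    have := LocallyIntegrable.integrable_mul_of_hasCompactSupport
      (locallyIntegrable_norm_rpow hm (s := -p) (by linarith))
      ((continuous_const.add (continuous_norm.pow 2)).mul
        ((TestFunction.contDiff_apply φ j).continuous.pow 2)) hcj'
    refine this.congr (.of_forall fun x => ?_)
    simp only [Pi.mul_apply, Pi.add_apply, Pi.pow_apply]
    ring

end Hardy

/-! ### Extension to `W^{1,p}₀` -/

section Extension

open scoped ContDiff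

variable {m : ℕ} {ι : Type} [Fintype ι]

/-- Hölder's inequality: the weight `r^{2-p}` maps `L^p` to `L^2`, since `r^{-p}` is integrable. -/
theorem exists_eLpNorm_gradWeight_smul_le (hm : 0 < m) {p : ℝ} (hp : 2 ≤ p) (hpm : p < m)
    (V : Type*) [NormedAddCommGroup V] [NormedSpace ℝ V] :
    ∃ C : ENNReal, C ≠ ⊤ ∧ ∀ G : Dom m → V, AEStronglyMeasurable G (ballMeasure m) →
      eLpNorm (fun x => gradWeight p x • G x) 2 (ballMeasure m) ≤
        C * eLpNorm G (ENNReal.ofReal p) (ballMeasure m) := by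
  rcases hp.eq_or_lt with rfl | hp2
  · refine ⟨1, ENNReal.one_ne_top, fun G _ => ?_⟩
    simp [gradWeight]
  · have hp0 : p - 2 ≠ 0 := by linarith
    have hq : 0 < 2 * p / (p - 2) := div_pos (by linarith) (by linarith)
    have hmem : MemLp (gradWeight p) (ENNReal.ofReal (2 * p / (p - 2))) (ballMeasure m) := by
      rw [← integrable_norm_rpow_iff (measurable_gradWeight p).aestronglyMeasurable
        (by simpa using hq) ENNReal.ofReal_ne_top, ENNReal.toReal_ofReal hq.le]
      refine (integrable_norm_rpow (m := m) (s := -p) hm (by linarith)).congr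
        (.of_forall fun x => ?_)
      have h0 : 0 ≤ gradWeight p x := Real.rpow_nonneg (norm_nonneg x) _
      simp only [Real.norm_of_nonneg h0]
      rw [gradWeight, ← Real.rpow_mul (norm_nonneg x)]
      congr 1
      field_simp
      ring
    have hH : ENNReal.HolderTriple (ENNReal.ofReal (2 * p / (p - 2))) (ENNReal.ofReal p) 2 := by
      refine ⟨?_⟩
      rw [← ENNReal.ofReal_inv_of_pos hq, ← ENNReal.ofReal_inv_of_pos (by linarith),
        ← ENNReal.ofReal_add (by positivity) (by positivity), ← ENNReal.ofReal_ofNat 2,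
        ← ENNReal.ofReal_inv_of_pos (by norm_num)]
      congr 1
      field_simp
      ring
    exact ⟨_, hmem.2.ne, fun G hG =>
      eLpNorm_smul_le_mul_eLpNorm hG (measurable_gradWeight p).aestronglyMeasurable⟩

theorem classicalGrad_sub (φ ψ : 𝓓(ball m, EuclideanSpace ℝ ι)) (x : Dom m) :
    classicalGrad (φ - ψ : 𝓓(ball m, EuclideanSpace ℝ ι)) x =
      classicalGrad φ x - classicalGrad ψ x := by
  have h : fderiv ℝ (⇑φ - ⇑ψ) x = fderiv ℝ φ x - fderiv ℝ ψ x :=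
    fderiv_sub (φ.contDiff.differentiable (by simp) x) (ψ.contDiff.differentiable (by simp) x)
  ext i j
  simp [classicalGrad, partialDeriv, h]

/-- `v` is the limit in `W^{1,p}` of the test functions `φ k`, and `G` is the limit of their
gradients. -/
structure IsTestLimit (p : ℝ) (v : Dom m → EuclideanSpace ℝ ι) (G : Dom m → Grad m ι)
    (φ : ℕ → 𝓓(ball m, EuclideanSpace ℝ ι)) : Prop where
  memLp : MemLp v (ENNReal.ofReal p) (ballMeasure m)
  memLp_grad : MemLp G (ENNReal.ofReal p) (ballMeasure m)
  tendsto : Tendsto (fun k => eLpNorm (fun x => φ k x - v x) (ENNReal.ofReal p) (ballMeasure m))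
    atTop (𝓝 0)
  tendsto_grad : Tendsto (fun k => eLpNorm (fun x => classicalGrad (φ k) x - G x)
    (ENNReal.ofReal p) (ballMeasure m)) atTop (𝓝 0)

namespace IsTestLimit

variable {p : ℝ} {v : Dom m → EuclideanSpace ℝ ι} {G : Dom m → Grad m ι}
  {φ : ℕ → 𝓓(ball m, EuclideanSpace ℝ ι)}

theorem aestronglyMeasurable_grad_sub (h : IsTestLimit p v G φ)
    (ψ : 𝓓(ball m, EuclideanSpace ℝ ι)) :
    AEStronglyMeasurable (fun x => classicalGrad ψ x - G x) (ballMeasure m) :=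
  (contDiff_classicalGrad ψ).continuous.aestronglyMeasurable.sub h.memLp_grad.1

theorem tendsto_weighted_grad (h : IsTestLimit p v G φ) (hm : 0 < m) (hp : 2 ≤ p) (hpm : p < m) :
    Tendsto (fun k => eLpNorm (fun x => gradWeight p x • (classicalGrad (φ k) x - G x)) 2
      (ballMeasure m)) atTop (𝓝 0) := by
  obtain ⟨C, hC, hle⟩ := exists_eLpNorm_gradWeight_smul_le hm hp hpm (Grad m ι)
  have h1 := ENNReal.Tendsto.const_mul h.tendsto_grad (Or.inr hC)
  rw [mul_zero] at h1
  exact tendsto_of_tendsto_of_tendsto_of_le_of_le tendsto_const_nhds h1 (fun _ => zero_le)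
    fun k => hle _ (h.aestronglyMeasurable_grad_sub (φ k))

theorem memLp_weighted_grad (h : IsTestLimit p v G φ) (hm : 0 < m) (hp : 2 ≤ p) (hpm : p < m) :
    MemLp (fun x => gradWeight p x • G x) 2 (ballMeasure m) := by
  obtain ⟨C, hC, hle⟩ := exists_eLpNorm_gradWeight_smul_le hm hp hpm (Grad m ι)
  exact ⟨(measurable_gradWeight p).aestronglyMeasurable.smul h.memLp_grad.1,
    (hle _ h.memLp_grad.1).trans_lt (ENNReal.mul_lt_top hC.lt_top h.memLp_grad.2)⟩

/-- The Hardy inequality for the difference of a test function and an element of `W^{1,p}₀`, by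
Fatou's lemma along a subsequence that converges almost everywhere. -/
theorem hardy_sub (h : IsTestLimit p v G φ) (hm : 0 < m) (hp : 2 ≤ p) (hpm : p < m)
    (ψ : 𝓓(ball m, EuclideanSpace ℝ ι)) :
    eLpNorm (fun x => hardyWeight p x • (ψ x - v x)) 2 (ballMeasure m) ≤
      eLpNorm (fun x => gradWeight p x • (classicalGrad ψ x - G x)) 2 (ballMeasure m) := by
  have hp0 : ENNReal.ofReal p ≠ 0 := by simpa using by linarith
  obtain ⟨ns, hns, hae⟩ := (tendstoInMeasure_of_tendsto_eLpNorm hp0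
    (fun k => (φ k).continuous.aestronglyMeasurable) h.memLp.1 h.tendsto).exists_seq_tendsto_ae
  have hlim := Lp.eLpNorm_lim_le_liminf_eLpNorm (p := 2) (μ := ballMeasure m)
    (f := fun k x => hardyWeight p x • (ψ x - φ (ns k) x))
    (fun k => (measurable_hardyWeight p).aestronglyMeasurable.smul
      (ψ.continuous.sub (φ (ns k)).continuous).aestronglyMeasurable)
    (fun x => hardyWeight p x • (ψ x - v x))
    (by filter_upwards [hae] with x hx using (hx.const_sub (ψ x)).const_smul _)
  refine hlim.trans ?_
  set A := eLpNorm (fun x => gradWeight p x • (classicalGrad ψ x - G x)) 2 (ballMeasure m)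
  have hb : ∀ k, eLpNorm (fun x => hardyWeight p x • (ψ x - φ (ns k) x)) 2 (ballMeasure m) ≤
      A + eLpNorm (fun x => gradWeight p x • (classicalGrad (φ (ns k)) x - G x)) 2
        (ballMeasure m) := by
    intro k
    refine (hardy_testFunction hm hp hpm (ψ - φ (ns k))).trans ?_
    have e : (fun x => gradWeight p x •
        classicalGrad (ψ - φ (ns k) : 𝓓(ball m, EuclideanSpace ℝ ι)) x) =
        (fun x => gradWeight p x • (classicalGrad ψ x - G x)) -
          fun x => gradWeight p x • (classicalGrad (φ (ns k)) x - G x) := by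
      ext1 x
      simp only [classicalGrad_sub, Pi.sub_apply, ← smul_sub]
      congr 1
      abel
    rw [e]
    exact eLpNorm_sub_le
      ((measurable_gradWeight p).aestronglyMeasurable.smul (h.aestronglyMeasurable_grad_sub ψ))
      ((measurable_gradWeight p).aestronglyMeasurable.smul
        (h.aestronglyMeasurable_grad_sub (φ (ns k)))) one_le_two
  have ht : Tendsto (fun k => A + eLpNorm (fun x => gradWeight p x •
      (classicalGrad (φ (ns k)) x - G x)) 2 (ballMeasure m)) atTop (𝓝 A) := by
    simpa using ((h.tendsto_weighted_grad hm hp hpm).comp hns.tendsto_atTop).const_add A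
  exact (liminf_le_liminf (.of_forall hb)).trans ht.liminf_eq.le

/-- The Hardy inequality on `W^{1,p}₀`. -/
theorem hardy (h : IsTestLimit p v G φ) (hm : 0 < m) (hp : 2 ≤ p) (hpm : p < m) :
    MemLp (fun x => hardyWeight p x • v x) 2 (ballMeasure m) ∧
      ∫ x, ‖x‖ ^ (-p) * (((m - p) / 2) ^ 2 + ‖x‖ ^ 2) * ‖v x‖ ^ 2 ∂(ballMeasure m) ≤
        ∫ x, ‖x‖ ^ (2 - p) * ‖G x‖ ^ 2 ∂(ballMeasure m) := by
  have h0 := h.hardy_sub hm hp hpm 0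
  have hz : ∀ x, classicalGrad (0 : 𝓓(ball m, EuclideanSpace ℝ ι)) x = 0 := fun x => by
    have := classicalGrad_sub (0 : 𝓓(ball m, EuclideanSpace ℝ ι)) 0 x
    simpa using this
  have hG := h.memLp_weighted_grad hm hp hpm
  have e1 : (fun x => hardyWeight p x • ((0 : 𝓓(ball m, EuclideanSpace ℝ ι)) x - v x)) =
      -fun x => hardyWeight p x • v x := by
    ext1 x
    rw [FunLike.coe_zero, Pi.zero_apply, zero_sub, smul_neg, Pi.neg_apply]
  have e2 : (fun x => gradWeight p x • (classicalGrad (0 : 𝓓(ball m, EuclideanSpace ℝ ι)) x -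
      G x)) = -fun x => gradWeight p x • G x := by
    ext1 x
    rw [hz, zero_sub, smul_neg, Pi.neg_apply]
  rw [e1, e2] at h0
  rw [eLpNorm_neg, eLpNorm_neg] at h0
  have hv : MemLp (fun x => hardyWeight p x • v x) 2 (ballMeasure m) :=
    ⟨(measurable_hardyWeight p).aestronglyMeasurable.smul h.memLp.1, h0.trans_lt hG.2⟩
  refine ⟨hv, ?_⟩
  rw [eLpNorm_two_le_iff hv hG] at h0
  simpa only [norm_smul_sq, gradWeight_sq, hardyWeight_sq] using h0

end IsTestLimit

theorem integrable_inner_of_memLp_two {α : Type*} [MeasurableSpace α] {μ : Measure α}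
    {V : Type*} [NormedAddCommGroup V] [InnerProductSpace ℝ V] {H F : α → V}
    (hH : MemLp H 2 μ) (hF : MemLp F 2 μ) : Integrable (fun x => inner ℝ (H x) (F x)) μ :=
  (hH.norm.integrable_mul hF.norm).mono' (hH.1.inner hF.1)
    (.of_forall fun x => norm_inner_le_norm (H x) (F x))

theorem tendsto_integral_inner_of_tendsto_eLpNorm_two {α : Type*} [MeasurableSpace α]
    {μ : Measure α} {V : Type*} [NormedAddCommGroup V] [InnerProductSpace ℝ V] {H F : α → V}
    {Fk : ℕ → α → V} (hH : MemLp H 2 μ) (hF : MemLp F 2 μ) (hFk : ∀ k, MemLp (Fk k) 2 μ)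
    (h : Tendsto (fun k => eLpNorm (fun x => Fk k x - F x) 2 μ) atTop (𝓝 0)) :
    Tendsto (fun k => ∫ x, inner ℝ (H x) (Fk k x) ∂μ) atTop (𝓝 (∫ x, inner ℝ (H x) (F x) ∂μ)) := by
  refine tendsto_integral_of_L1' _ (hH.1.inner hF.1)
    (.of_forall fun k => integrable_inner_of_memLp_two hH (hFk k)) ?_
  have h1 := ENNReal.Tendsto.const_mul h (Or.inr hH.2.ne)
  rw [mul_zero] at h1
  refine tendsto_of_tendsto_of_tendsto_of_le_of_le tendsto_const_nhds h1 (fun _ => zero_le)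
    fun k => ?_
  have e : ((fun x => inner ℝ (H x) (Fk k x)) - fun x => inner ℝ (H x) (F x)) =
      fun x => inner ℝ (H x) (Fk k x - F x) := by
    ext x
    simp [inner_sub_right]
  rw [e]
  have := eLpNorm_le_eLpNorm_mul_eLpNorm_of_nnnorm (p := 2) (q := 2) (r := 1) hH.1
    ((hFk k).sub hF).1 (fun a b => inner ℝ a b) 1
    (.of_forall fun x => by
      rw [one_mul]
      exact_mod_cast norm_inner_le_norm (𝕜 := ℝ) (H x) (Fk k x - F x))
  rw [ENNReal.coe_one, one_mul] at this
  exact this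

theorem norm_rpow_neg_mul_norm_sq {x : Dom m} (hx : x ≠ 0) (p : ℝ) :
    ‖x‖ ^ (-p) * ‖x‖ ^ 2 = ‖x‖ ^ (2 - p) := by
  rw [← Real.rpow_two, ← Real.rpow_add (norm_pos_iff.2 hx)]
  congr 1
  ring

/-- The equation for the equator map, tested with elements of `W^{1,p}₀`. -/
theorem integral_inner_equatorGrad (hm : 3 ≤ m) {ℓ : ℕ} (hℓ : 1 ≤ ℓ) {p : ℝ}
    (hp : 2 ≤ p) (hpm : p < m) {v : Dom m → EuclideanSpace ℝ (Option (Fin ℓ → Fin m))}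
    {G : Dom m → Grad m (Option (Fin ℓ → Fin m))}
    {φ : ℕ → 𝓓(ball m, EuclideanSpace ℝ (Option (Fin ℓ → Fin m)))}
    (h : IsTestLimit p v G φ) :
    ∫ x, ‖x‖ ^ (2 - p) * inner ℝ (equatorGrad m ℓ x) (G x) ∂(ballMeasure m) =
      eigenval m ℓ * ∫ x, ‖x‖ ^ (-p) * inner ℝ (equatorMap m ℓ x) (v x) ∂(ballMeasure m) := by
  have hm0 : 0 < m := by omega
  have hu := hasWeakGrad_equatorMap hm hℓ
  have ha : 0 < ((m - p) / 2) ^ 2 := by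
    have : 0 < m - p := by linarith
    positivity
  have hwpos : ∀ x : Dom m, x ≠ 0 → 0 < hardyWeight p x := fun x hx => by
    have hr : 0 < ‖x‖ := norm_pos_iff.2 hx
    exact Real.sqrt_pos.2 (by positivity)
  have hH1 : MemLp (fun x => gradWeight p x • equatorGrad m ℓ x) 2 (ballMeasure m) := by
    obtain ⟨C, hC, hle⟩ := exists_eLpNorm_gradWeight_smul_le hm0 hp hpm
      (Grad m (Option (Fin ℓ → Fin m)))
    have hG := memLp_equatorGrad hm hℓ hp hpm
    exact ⟨(measurable_gradWeight p).aestronglyMeasurable.smul hG.1,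
      (hle _ hG.1).trans_lt (ENNReal.mul_lt_top hC.lt_top hG.2)⟩
  -- dividing by the Hardy weight here lets the right-hand side converge by the Hardy inequality
  have hH2 : MemLp (fun x => (‖x‖ ^ (-p) / hardyWeight p x) • equatorMap m ℓ x) 2
      (ballMeasure m) := by
    have hmeas : AEStronglyMeasurable (fun x => (‖x‖ ^ (-p) / hardyWeight p x) •
        equatorMap m ℓ x) (ballMeasure m) :=
      ((measurable_norm.pow_const _).div (measurable_hardyWeight p)).aestronglyMeasurable.smul
        (aestronglyMeasurable_of_locallyIntegrableOn hu.1)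
    rw [memLp_two_iff_integrable_sq_norm hmeas]
    refine ((integrable_norm_rpow (m := m) (s := -p) hm0 (by linarith)).const_mul
      (((m - p) / 2) ^ 2)⁻¹).mono' (hmeas.norm.pow 2) ?_
    filter_upwards [ballMeasure_ae_ne_zero hm0] with x hx
    have hr : 0 < ‖x‖ := norm_pos_iff.2 hx
    have hrp : 0 < ‖x‖ ^ (-p) := Real.rpow_pos_of_pos hr _
    rw [norm_smul_sq, norm_equatorMap hm hℓ hx, div_pow, hardyWeight_sq,
      Real.norm_of_nonneg (by positivity)]
    have e : (‖x‖ ^ (-p)) ^ 2 / (‖x‖ ^ (-p) * (((m - p) / 2) ^ 2 + ‖x‖ ^ 2)) * 1 ^ 2 =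
        (((m - p) / 2) ^ 2 + ‖x‖ ^ 2)⁻¹ * ‖x‖ ^ (-p) := by
      field_simp
    rw [e]
    gcongr
    nlinarith [sq_nonneg ‖x‖]
  obtain ⟨hv, -⟩ := h.hardy hm0 hp hpm
  have t1 := tendsto_integral_inner_of_tendsto_eLpNorm_two hH1 (h.memLp_weighted_grad hm0 hp hpm)
    (fun k => memLp_gradWeight_smul_classicalGrad hm0 hpm (φ k))
    (by simpa only [smul_sub] using h.tendsto_weighted_grad hm0 hp hpm)
  have t2 := tendsto_integral_inner_of_tendsto_eLpNorm_two hH2 hv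
    (fun k => memLp_hardyWeight_smul_testFunction hm0 hpm (φ k))
    (tendsto_of_tendsto_of_tendsto_of_le_of_le tendsto_const_nhds
      (h.tendsto_weighted_grad hm0 hp hpm) (fun _ => zero_le)
      fun k => by simpa only [smul_sub] using h.hardy_sub hm0 hp hpm (φ k))
  have e1 : ∀ (x : Dom m) (K : Grad m (Option (Fin ℓ → Fin m))),
      inner ℝ (gradWeight p x • equatorGrad m ℓ x) (gradWeight p x • K) =
        ‖x‖ ^ (2 - p) * inner ℝ (equatorGrad m ℓ x) K := fun x K => by
    rw [real_inner_smul_left, real_inner_smul_right, ← mul_assoc, ← sq, gradWeight_sq]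
  have e2 : ∀ w : Dom m → EuclideanSpace ℝ (Option (Fin ℓ → Fin m)),
      ∫ x, inner ℝ ((‖x‖ ^ (-p) / hardyWeight p x) • equatorMap m ℓ x) (hardyWeight p x • w x)
        ∂(ballMeasure m) =
      ∫ x, ‖x‖ ^ (-p) * inner ℝ (equatorMap m ℓ x) (w x) ∂(ballMeasure m) := fun w => by
    refine integral_congr_ae ?_
    filter_upwards [ballMeasure_ae_ne_zero hm0] with x hx
    have := (hwpos x hx).ne'
    rw [real_inner_smul_left, real_inner_smul_right]
    field_simp
  simp only [e1] at t1
  simp only [e2] at t2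
  simp only [integral_inner_equatorGrad_testFunction hm hℓ hp hpm] at t1
  exact tendsto_nhds_unique t1 (t2.const_mul _)

end Extension

/-! ### Minimality -/

section Minimality

variable {m ℓ : ℕ}

theorem energy_eq {ι : Type} [Fintype ι] {p : ℝ} {u : Dom m → EuclideanSpace ℝ ι}
    {G : Dom m → Grad m ι} (h : HasWeakGrad u G) :
    energy p u = (1 / p) * ∫ x, ‖G x‖ ^ p ∂(ballMeasure m) := by
  rw [energy]
  congr 1
  refine integral_congr_ae ?_
  filter_upwards [h.weakGrad_ae_eq] with x hx
  rw [hx]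

/-- Convexity of `s ↦ s^{p/2}`, at the square of a norm. -/
theorem rpow_add_mul_sq_sub_sq_le_rpow {p s t : ℝ} (hp : 2 ≤ p) (hs : 0 ≤ s) (ht : 0 < t) :
    t ^ p + p / 2 * t ^ (p - 2) * (s ^ 2 - t ^ 2) ≤ s ^ p := by
  have h := one_add_mul_self_le_rpow_one_add (s := s ^ 2 / t ^ 2 - 1)
    (by have : 0 ≤ s ^ 2 / t ^ 2 := by positivity
        linarith) (p := p / 2) (by linarith)
  have e1 : (1 + (s ^ 2 / t ^ 2 - 1)) ^ (p / 2) = s ^ p / t ^ p := by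
    rw [add_sub_cancel, ← div_pow, ← Real.rpow_natCast_mul (by positivity),
      Real.div_rpow hs ht.le]
    norm_num
    rw [mul_div_cancel₀ p two_ne_zero]
  have e2 : t ^ (p - 2) = t ^ p / t ^ 2 := by
    rw [Real.rpow_sub ht, Real.rpow_two]
  rw [e1, le_div_iff₀ (by positivity)] at h
  rw [e2]
  refine le_trans (le_of_eq ?_) h
  field_simp

/-- The energy of a competitor `w` exceeds that of the equator map `u` by at least a multiple of
`∫ r^{2-p} |u - w|²`. -/
theorem energy_equatorMap_add_le (hm : 3 ≤ m) (hℓ : 1 ≤ ℓ) {p : ℝ} (hp : 2 ≤ p) (hpm : p < m)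
    (hstab : 4 * eigenval m ℓ ≤ (m - p) ^ 2)
    {w : Dom m → EuclideanSpace ℝ (Option (Fin ℓ → Fin m))} (hw : MemW1pSphere p w)
    (hv : MemW1pZero p fun x => equatorMap m ℓ x - w x) :
    Integrable (fun x => ‖x‖ ^ (2 - p) * ‖equatorMap m ℓ x - w x‖ ^ 2) (ballMeasure m) ∧
    energy p (equatorMap m ℓ) + 1 / 2 * eigenval m ℓ ^ ((p - 2) / 2) *
      ∫ x, ‖x‖ ^ (2 - p) * ‖equatorMap m ℓ x - w x‖ ^ 2 ∂(ballMeasure m) ≤ energy p w := by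
  have hm0 : 0 < m := by omega
  have hp0 : 0 < p := by linarith
  obtain ⟨⟨hwp, Gw, hwG, hGwp⟩, hws⟩ := hw
  obtain ⟨hvp, G, hvG, hGp, φ, hφ, hφG⟩ := hv
  have hlim : IsTestLimit p (fun x => equatorMap m ℓ x - w x) G φ := ⟨hvp, hGp, hφ, hφG⟩
  have hu := hasWeakGrad_equatorMap hm hℓ
  have hGeq : G =ᵐ[ballMeasure m] fun x => equatorGrad m ℓ x - Gw x := hvG.ae_eq (hu.sub hwG)
  set v : Dom m → EuclideanSpace ℝ (Option (Fin ℓ → Fin m)) :=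
    fun x => equatorMap m ℓ x - w x with hvdef
  have hlam := eigenval_pos hm hℓ
  set Λ : ℝ := eigenval m ℓ ^ ((p - 2) / 2) with hΛ
  have hΛ0 : 0 < Λ := Real.rpow_pos_of_pos hlam _
  -- the constraint `|u| = |w| = 1`
  have hvu : ∀ᵐ x ∂(ballMeasure m), inner ℝ (equatorMap m ℓ x) (v x) = ‖v x‖ ^ 2 / 2 ∧
      ‖v x‖ ≤ 2 := by
    filter_upwards [ballMeasure_ae_ne_zero hm0, hws] with x hx hwx
    have h1 := norm_equatorMap hm hℓ hx
    have h2 : ‖w x‖ = 1 := by simpa using hwx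
    constructor
    · have h3 := norm_sub_sq_real (equatorMap m ℓ x) (w x)
      rw [hvdef]
      simp only [inner_sub_right, real_inner_self_eq_norm_sq]
      rw [h3, h1, h2]
      ring
    · refine (norm_sub_le _ _).trans ?_
      rw [h1, h2]
      norm_num
  have hint : ∀ s : ℝ, -(m : ℝ) < s → Integrable (fun x => ‖x‖ ^ s * ‖v x‖ ^ 2)
      (ballMeasure m) := by
    intro s hs
    refine (integrable_norm_rpow hm0 hs).mul_bdd (c := 4) (hvp.1.norm.pow 2) ?_
    filter_upwards [hvu] with x hx
    rw [Real.norm_of_nonneg (by positivity)]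
    nlinarith [hx.2, norm_nonneg (v x)]
  refine ⟨hint _ (by linarith), ?_⟩
  obtain ⟨-, hhardy⟩ := hlim.hardy hm0 hp hpm
  have heq := integral_inner_equatorGrad hm hℓ hp hpm hlim
  have hG2 : Integrable (fun x => ‖x‖ ^ (2 - p) * ‖G x‖ ^ 2) (ballMeasure m) := by
    have := (hlim.memLp_weighted_grad hm0 hp hpm)
    rw [memLp_two_iff_integrable_sq_norm this.1] at this
    simpa only [norm_smul_sq, gradWeight_sq] using this
  have hGu := memLp_equatorGrad hm hℓ hp hpm
  have hGi : Integrable (fun x => ‖x‖ ^ (2 - p) * inner ℝ (equatorGrad m ℓ x) (G x))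
      (ballMeasure m) := by
    obtain ⟨C, hC, hle⟩ := exists_eLpNorm_gradWeight_smul_le hm0 hp hpm
      (Grad m (Option (Fin ℓ → Fin m)))
    have h1 : MemLp (fun x => gradWeight p x • equatorGrad m ℓ x) 2 (ballMeasure m) :=
      ⟨(measurable_gradWeight p).aestronglyMeasurable.smul hGu.1,
        (hle _ hGu.1).trans_lt (ENNReal.mul_lt_top hC.lt_top hGu.2)⟩
    refine (integrable_inner_of_memLp_two h1 (hlim.memLp_weighted_grad hm0 hp hpm)).congr
      (.of_forall fun x => ?_)
    simp only
    rw [real_inner_smul_left, real_inner_smul_right, ← mul_assoc, ← sq, gradWeight_sq]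
  have hp0' : ENNReal.ofReal p ≠ 0 := by simpa using hp0
  have hGwi := hGwp.integrable_norm_rpow hp0' ENNReal.ofReal_ne_top
  have hGui := hGu.integrable_norm_rpow hp0' ENNReal.ofReal_ne_top
  rw [ENNReal.toReal_ofReal hp0.le] at hGwi hGui
  -- integrate the convexity inequality between `|∇u|` and `|∇w|`
  have hconv : ∫ x, (‖equatorGrad m ℓ x‖ ^ p + p / 2 * Λ * (‖x‖ ^ (2 - p) * ‖G x‖ ^ 2 -
      2 * (‖x‖ ^ (2 - p) * inner ℝ (equatorGrad m ℓ x) (G x)))) ∂(ballMeasure m) ≤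
      ∫ x, ‖Gw x‖ ^ p ∂(ballMeasure m) := by
    refine integral_mono_ae (hGui.add ((hG2.sub (hGi.const_mul 2)).const_mul _)) hGwi ?_
    filter_upwards [ballMeasure_ae_ne_zero hm0, hGeq] with x hx hGx
    have hpos : 0 < ‖equatorGrad m ℓ x‖ := by
      have h1 := norm_equatorGrad_sq hm hℓ hx
      have h2 : 0 < eigenval m ℓ / ‖x‖ ^ 2 := div_pos hlam (by positivity)
      rw [← h1] at h2
      exact (norm_nonneg _).lt_of_ne fun h => by simp [← h] at h2
    have h3 := rpow_add_mul_sq_sub_sq_le_rpow hp (norm_nonneg (Gw x)) hpos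
    have h4 : Gw x = equatorGrad m ℓ x - G x := by rw [hGx]; abel
    have h5 : ‖Gw x‖ ^ 2 - ‖equatorGrad m ℓ x‖ ^ 2 =
        ‖G x‖ ^ 2 - 2 * inner ℝ (equatorGrad m ℓ x) (G x) := by
      rw [h4, norm_sub_sq_real]
      ring
    rw [norm_equatorGrad_rpow hm hℓ hx (p - 2), neg_sub, h5, ← hΛ] at h3
    refine le_trans (le_of_eq ?_) h3
    ring
  have hcross : Integrable (fun x => ‖x‖ ^ (2 - p) * ‖G x‖ ^ 2 -
      2 * (‖x‖ ^ (2 - p) * inner ℝ (equatorGrad m ℓ x) (G x))) (ballMeasure m) :=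
    hG2.sub (hGi.const_mul 2)
  rw [integral_add hGui (hcross.const_mul _), integral_const_mul,
    integral_sub hG2 (hGi.const_mul 2), integral_const_mul, heq] at hconv
  have huv : ∫ x, ‖x‖ ^ (-p) * inner ℝ (equatorMap m ℓ x) (v x) ∂(ballMeasure m) =
      1 / 2 * ∫ x, ‖x‖ ^ (-p) * ‖v x‖ ^ 2 ∂(ballMeasure m) := by
    rw [← integral_const_mul]
    refine integral_congr_ae ?_
    filter_upwards [hvu] with x hx
    rw [hx.1]
    ring
  have hsplit : eigenval m ℓ * ∫ x, ‖x‖ ^ (-p) * ‖v x‖ ^ 2 ∂(ballMeasure m) +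
      ∫ x, ‖x‖ ^ (2 - p) * ‖v x‖ ^ 2 ∂(ballMeasure m) ≤
      ∫ x, ‖x‖ ^ (-p) * (((m - p) / 2) ^ 2 + ‖x‖ ^ 2) * ‖v x‖ ^ 2 ∂(ballMeasure m) := by
    rw [← integral_const_mul, ← integral_add ((hint _ (by linarith)).const_mul _)
      (hint _ (by linarith))]
    refine integral_mono_ae (((hint _ (by linarith)).const_mul _).add (hint _ (by linarith))) ?_ ?_
    · refine (((hint (-p) (by linarith)).const_mul (((m - p) / 2) ^ 2)).add
        (hint (2 - p) (by linarith))).congr ?_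
      filter_upwards [ballMeasure_ae_ne_zero hm0] with x hx
      simp only [Pi.add_apply]
      rw [← norm_rpow_neg_mul_norm_sq hx]
      ring
    · filter_upwards [ballMeasure_ae_ne_zero hm0] with x hx
      rw [← norm_rpow_neg_mul_norm_sq hx]
      have h1 : 0 ≤ ‖x‖ ^ (-p) * ‖v x‖ ^ 2 := by positivity
      have h2 : eigenval m ℓ ≤ ((m - p) / 2) ^ 2 := by linarith
      have h3 := mul_le_mul_of_nonneg_right h2 h1
      linarith
  rw [energy_eq hu, energy_eq hwG]
  rw [huv] at hconv
  set A := ∫ x, ‖x‖ ^ (-p) * ‖v x‖ ^ 2 ∂(ballMeasure m)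
  set B := ∫ x, ‖x‖ ^ (2 - p) * ‖v x‖ ^ 2 ∂(ballMeasure m)
  set D := ∫ x, ‖x‖ ^ (2 - p) * ‖G x‖ ^ 2 ∂(ballMeasure m)
  have h6 : B ≤ D - 2 * (eigenval m ℓ * (1 / 2 * A)) := by linarith
  have h7 : p / 2 * Λ * B ≤ p / 2 * Λ * (D - 2 * (eigenval m ℓ * (1 / 2 * A))) :=
    mul_le_mul_of_nonneg_left h6 (by positivity)
  have h8 : 1 / p * (∫ x, ‖equatorGrad m ℓ x‖ ^ p ∂(ballMeasure m)) + 1 / 2 * Λ * B =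
      1 / p * ((∫ x, ‖equatorGrad m ℓ x‖ ^ p ∂(ballMeasure m)) + p / 2 * Λ * B) := by
    field_simp
  rw [h8]
  exact mul_le_mul_of_nonneg_left (by linarith) (by positivity)

/-- The remainder term in `energy_equatorMap_add_le` gives the uniqueness, also in the borderline case
`4 λ = (m - p)²`. -/
theorem isUniqueMinimizer_equatorMap (hm : 3 ≤ m) (hℓ : 1 ≤ ℓ) {p : ℝ} (hp : 2 ≤ p)
    (hpm : p < m) (hstab : 4 * eigenval m ℓ ≤ (m - p) ^ 2) :
    IsUniqueMinimizer p (equatorMap m ℓ) := by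
  have hΛ : 0 < eigenval m ℓ ^ ((p - 2) / 2) := Real.rpow_pos_of_pos (eigenval_pos hm hℓ) _
  refine ⟨isPHarmonic_equatorMap hm hℓ hp hpm, fun w hw hv => ?_, fun w hw hv he => ?_⟩
  · have h := (energy_equatorMap_add_le hm hℓ hp hpm hstab hw hv).2
    have h0 : 0 ≤ ∫ x, ‖x‖ ^ (2 - p) * ‖equatorMap m ℓ x - w x‖ ^ 2 ∂(ballMeasure m) :=
      integral_nonneg fun x => by positivity
    have := mul_nonneg (mul_nonneg (by norm_num : (0 : ℝ) ≤ 1 / 2) hΛ.le) h0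
    linarith
  · obtain ⟨hi, h⟩ := energy_equatorMap_add_le hm hℓ hp hpm hstab hw hv
    have h0 : 0 ≤ ∫ x, ‖x‖ ^ (2 - p) * ‖equatorMap m ℓ x - w x‖ ^ 2 ∂(ballMeasure m) :=
      integral_nonneg fun x => by positivity
    have h1 : ∫ x, ‖x‖ ^ (2 - p) * ‖equatorMap m ℓ x - w x‖ ^ 2 ∂(ballMeasure m) = 0 := by
      refine le_antisymm ?_ h0
      by_contra! hlt
      have := mul_pos (mul_pos (by norm_num : (0 : ℝ) < 1 / 2) hΛ) hlt
      linarith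
    rw [integral_eq_zero_iff_of_nonneg (fun x => by positivity) hi] at h1
    filter_upwards [h1, ballMeasure_ae_ne_zero (show 0 < m by omega)] with x hx hx0
    have hr : 0 < ‖x‖ := norm_pos_iff.2 hx0
    have h2 : ‖x‖ ^ (2 - p) ≠ 0 := (Real.rpow_pos_of_pos hr _).ne'
    have h3 : ‖equatorMap m ℓ x - w x‖ ^ 2 = 0 := (mul_eq_zero.1 hx).resolve_left h2
    have h4 : equatorMap m ℓ x - w x = 0 := norm_eq_zero.1 (pow_eq_zero_iff two_ne_zero |>.1 h3)
    exact (sub_eq_zero.1 h4).symm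

end Minimality

/-! ### Differentiation of the energy along a variation -/

section Parametric

/-- The second derivative of `t ↦ Ψ (t²)` at `0` is `2 Ψ' 0`. -/
theorem HasSecondDerivAt.of_comp_sq {Ψ dΨ : ℝ → ℝ} (h : ∀ᶠ s in 𝓝 0, HasDerivAt Ψ (dΨ s) s)
    (hc : ContinuousAt dΨ 0) : HasSecondDerivAt (fun t => Ψ (t ^ 2)) (2 * dΨ 0) 0 := by
  have ht : Tendsto (fun t : ℝ => t ^ 2) (𝓝 0) (𝓝 0) := by
    have : ContinuousAt (fun t : ℝ => t ^ 2) 0 := by fun_prop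
    simpa [ContinuousAt] using this
  refine ⟨fun t => dΨ (t ^ 2) * (2 * t), ?_, ?_⟩
  · filter_upwards [ht.eventually h] with t hst
    have h2 : HasDerivAt (fun t : ℝ => t ^ 2) (2 * t) t := by simpa using hasDerivAt_pow 2 t
    exact HasDerivAt.comp (h₂ := Ψ) (h := fun t : ℝ => t ^ 2) t hst h2
  · rw [hasDerivAt_iff_tendsto_slope]
    have h1 : Tendsto (fun t : ℝ => 2 * dΨ (t ^ 2)) (𝓝[≠] 0) (𝓝 (2 * dΨ 0)) :=
      ((hc.tendsto.comp ht).const_mul 2).mono_left nhdsWithin_le_nhds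
    refine h1.congr' ?_
    filter_upwards [self_mem_nhdsWithin] with t (hne : t ≠ 0)
    simp only [slope, vsub_eq_sub, sub_zero, smul_eq_mul, mul_zero]
    field_simp

/-- The energy density `|∇u_t|²`, as a function of `s = t²`: here `A = |∇u|²`, `B = f²` and
`N = |∇f|²` for the variation of a map `u` in a normal direction by the function `f`. -/
noncomputable def varDensity (A B N s : ℝ) : ℝ := A / (1 + s * B) + s * N / (1 + s * B) ^ 2

/-- The derivative of `varDensity` with respect to `s`. -/
noncomputable def varDensityDeriv (A B N s : ℝ) : ℝ :=
  -(A * B) / (1 + s * B) ^ 2 + N / (1 + s * B) ^ 2 - 2 * s * N * B / (1 + s * B) ^ 3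

theorem hasDerivAt_varDensity (A B N : ℝ) {s : ℝ} (h : 1 + s * B ≠ 0) :
    HasDerivAt (varDensity A B N) (varDensityDeriv A B N s) s := by
  have h1 : HasDerivAt (fun s : ℝ => 1 + s * B) B s := by
    simpa using ((hasDerivAt_id s).mul_const B).const_add 1
  have h2 := (hasDerivAt_const s A).div h1 h
  have h3 := ((hasDerivAt_id s).mul_const N).div (h1.pow 2) (pow_ne_zero 2 h)
  refine (h2.add h3).congr_deriv ?_
  simp only [varDensityDeriv, id, Pi.pow_apply]
  field_simp
  push_cast
  ring

theorem one_add_mul_bounds {B M δ s : ℝ} (hB : 0 ≤ B) (hBM : B ≤ M) (hδM : δ * M ≤ 1 / 2)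
    (hs : |s| < δ) : 1 / 2 ≤ 1 + s * B ∧ 1 + s * B ≤ 3 / 2 := by
  have h1 : |s * B| ≤ 1 / 2 := by
    rw [abs_mul, abs_of_nonneg hB]
    refine le_trans ?_ hδM
    exact mul_le_mul hs.le hBM hB ((abs_nonneg s).trans hs.le)
  have := abs_le.1 h1
  constructor <;> linarith

theorem abs_mul_div_pow_le {N M δ s y : ℝ} (hN : 0 ≤ N) (hNM : N ≤ M) (hs : |s| < δ)
    (hy : 1 / 2 ≤ y) : |s * N / y ^ 2| ≤ 4 * δ * M := by
  have hδ : 0 ≤ δ := (abs_nonneg s).trans hs.le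
  have hy0 : 0 < y := by linarith
  rw [abs_div, abs_of_pos (pow_pos hy0 2), div_le_iff₀ (pow_pos hy0 2), abs_mul, abs_of_nonneg hN]
  have h1 : |s| * N ≤ δ * M := mul_le_mul hs.le hNM hN hδ
  have h2 : (1 / 2 : ℝ) ^ 2 ≤ y ^ 2 := by gcongr
  have h3 : 0 ≤ δ * M := mul_nonneg hδ (hN.trans hNM)
  nlinarith

theorem varDensity_pos {A B N M δ κ s : ℝ} (hκ : 0 < κ) (hA : κ ≤ A) (hB : 0 ≤ B) (hBM : B ≤ M)
    (hN : 0 ≤ N) (hNM : N ≤ M) (hδM : δ * M ≤ 1 / 2) (hδκ : 4 * δ * M ≤ κ / 3) (hs : |s| < δ) :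
    0 < varDensity A B N s := by
  obtain ⟨h1, h2⟩ := one_add_mul_bounds hB hBM hδM hs
  have h3 := neg_le_of_abs_le (abs_mul_div_pow_le hN hNM hs h1)
  have h4 : 2 / 3 * κ ≤ A / (1 + s * B) := by
    rw [le_div_iff₀ (by linarith)]
    nlinarith
  rw [varDensity]
  linarith

theorem varDensity_le {A B N M δ s : ℝ} (hB : 0 ≤ B) (hBM : B ≤ M)
    (hN : 0 ≤ N) (hNM : N ≤ M) (hδM : δ * M ≤ 1 / 2) (hAM : A ≤ M) (hs : |s| < δ) :
    varDensity A B N s ≤ 2 * M + 4 * δ * M := by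
  obtain ⟨h1, h2⟩ := one_add_mul_bounds hB hBM hδM hs
  have h3 := le_of_abs_le (abs_mul_div_pow_le hN hNM hs h1)
  have h4 : A / (1 + s * B) ≤ 2 * M := by
    rw [div_le_iff₀ (by linarith)]
    nlinarith
  rw [varDensity]
  linarith

theorem abs_varDensityDeriv_le {A B N M δ κ s : ℝ} (hκ : 0 < κ) (hA : κ ≤ A) (hB : 0 ≤ B)
    (hBM : B ≤ M) (hN : 0 ≤ N) (hNM : N ≤ M) (hδM : δ * M ≤ 1 / 2) (hAM : A ≤ M) (hs : |s| < δ) :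
    |varDensityDeriv A B N s| ≤ 4 * (M * M) + 4 * M + 16 * (δ * M * M) := by
  obtain ⟨h1, h2⟩ := one_add_mul_bounds hB hBM hδM hs
  have hδ : 0 ≤ δ := (abs_nonneg s).trans hs.le
  have hM : 0 ≤ M := hB.trans hBM
  have hA0 : 0 ≤ A := hκ.le.trans hA
  have hy2 : (1 / 2 : ℝ) ^ 2 ≤ (1 + s * B) ^ 2 := by gcongr
  have hy3 : (1 / 2 : ℝ) ^ 3 ≤ (1 + s * B) ^ 3 := by gcongr
  have e1 : |-(A * B) / (1 + s * B) ^ 2| ≤ 4 * (M * M) := by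
    rw [abs_div, abs_neg, abs_of_nonneg (by positivity : 0 ≤ A * B),
      abs_of_pos (lt_of_lt_of_le (by norm_num) hy2), div_le_iff₀ (lt_of_lt_of_le (by norm_num) hy2)]
    have : A * B ≤ M * M := mul_le_mul hAM hBM hB hM
    nlinarith [mul_nonneg hM hM]
  have e2 : |N / (1 + s * B) ^ 2| ≤ 4 * M := by
    rw [abs_div, abs_of_nonneg hN, abs_of_pos (lt_of_lt_of_le (by norm_num) hy2),
      div_le_iff₀ (lt_of_lt_of_le (by norm_num) hy2)]
    nlinarith
  have e3 : |2 * s * N * B / (1 + s * B) ^ 3| ≤ 16 * (δ * M * M) := by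
    rw [abs_div, abs_of_pos (lt_of_lt_of_le (by norm_num) hy3),
      div_le_iff₀ (lt_of_lt_of_le (by norm_num) hy3)]
    have : |2 * s * N * B| ≤ 2 * (δ * M * M) := by
      rw [abs_mul, abs_mul, abs_mul, abs_of_nonneg hN, abs_of_nonneg hB, abs_two, mul_assoc,
        mul_assoc]
      refine mul_le_mul_of_nonneg_left ?_ (by norm_num)
      rw [← mul_assoc]
      exact mul_le_mul (mul_le_mul hs.le hNM hN hδ) hBM hB (by positivity)
    have h0 : 0 ≤ δ * M * M := by positivity
    nlinarith
  rw [varDensityDeriv]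
  exact (abs_sub _ _).trans (add_le_add ((abs_add_le _ _).trans (add_le_add e1 e2)) e3)

/-- The second derivative of the energy at `t = 0`, for a density of the form `varDensity`. It
depends on `t` through `s = t²` only, so that one differentiation under the integral is enough. -/
theorem hasSecondDerivAt_integral_varDensity {α : Type*} [MeasurableSpace α] {μ : Measure α}
    [IsFiniteMeasure μ] {A B N : α → ℝ} {M κ p : ℝ} (hp : 2 ≤ p) (hκ : 0 < κ) (hM : 0 < M)
    (hAm : Measurable A) (hBm : Measurable B) (hNm : Measurable N)
    (hA : ∀ᵐ x ∂μ, κ ≤ A x) (hB : ∀ x, 0 ≤ B x) (hBM : ∀ x, B x ≤ M) (hN : ∀ x, 0 ≤ N x)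
    (hNM : ∀ x, N x ≤ M) (hAM : ∀ᵐ x ∂μ, (B x = 0 ∧ N x = 0) ∨ A x ≤ M)
    (hAi : Integrable (fun x => A x ^ (p / 2)) μ) :
    HasSecondDerivAt (fun t => 1 / p * ∫ x, varDensity (A x) (B x) (N x) (t ^ 2) ^ (p / 2) ∂μ)
      (∫ x, A x ^ ((p - 2) / 2) * (N x - A x * B x) ∂μ) 0 := by
  obtain ⟨δ, hδ, hδM, hδκ⟩ : ∃ δ : ℝ, 0 < δ ∧ δ * M ≤ 1 / 2 ∧ 4 * δ * M ≤ κ / 3 := by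
    refine ⟨min (1 / 2 / M) (κ / 3 / (4 * M)), by positivity, ?_, ?_⟩
    · calc min (1 / 2 / M) (κ / 3 / (4 * M)) * M ≤ 1 / 2 / M * M := by
            gcongr; exact min_le_left _ _
        _ = 1 / 2 := by field_simp
    · calc 4 * min (1 / 2 / M) (κ / 3 / (4 * M)) * M ≤ 4 * (κ / 3 / (4 * M)) * M := by
            gcongr; exact min_le_right _ _
        _ = κ / 3 := by field_simp
  set F : ℝ → α → ℝ := fun s x => 1 / p * varDensity (A x) (B x) (N x) s ^ (p / 2) with hF
  set F' : ℝ → α → ℝ := fun s x => 1 / p * (varDensityDeriv (A x) (B x) (N x) s * (p / 2) *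
    varDensity (A x) (B x) (N x) s ^ (p / 2 - 1)) with hF'
  set K : ℝ := 1 / p * ((4 * (M * M) + 4 * M + 16 * (δ * M * M)) * (p / 2) *
    (2 * M + 4 * δ * M) ^ (p / 2 - 1)) with hK
  have hp0 : 0 < p := by linarith
  have hD : ∀ s, Measurable fun x => varDensity (A x) (B x) (N x) s := fun s =>
    (hAm.div (measurable_const.add (hBm.const_mul s))).add
      ((hNm.const_mul s).div ((measurable_const.add (hBm.const_mul s)).pow_const 2))
  have hD' : ∀ s, Measurable fun x => varDensityDeriv (A x) (B x) (N x) s := fun s => by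
    unfold varDensityDeriv
    fun_prop
  have hFm : ∀ s, AEStronglyMeasurable (F s) μ := fun s =>
    (((hD s).pow_const _).const_mul _).aestronglyMeasurable
  have hF'm : ∀ s, AEStronglyMeasurable (F' s) μ := fun s =>
    ((((hD' s).mul_const _).mul ((hD s).pow_const _)).const_mul _).aestronglyMeasurable
  have hball : ∀ s ∈ Metric.ball (0 : ℝ) δ, |s| < δ := fun s hs => by simpa using hs
  have hbound : ∀ᵐ x ∂μ, ∀ s ∈ Metric.ball (0 : ℝ) δ, ‖F' s x‖ ≤ K := by
    filter_upwards [hA, hAM] with x hx hx' s hs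
    have hpos := varDensity_pos hκ hx (hB x) (hBM x) (hN x) (hNM x) hδM hδκ (hball s hs)
    rcases hx' with ⟨h1, h2⟩ | h1
    · simp only [hF', varDensityDeriv, h1, h2]
      simp only [mul_zero, neg_zero, zero_div, sub_zero, add_zero, zero_mul, norm_zero]
      positivity
    · have e1 := varDensity_le (hB x) (hBM x) (hN x) (hNM x) hδM h1 (hball s hs)
      have e2 := abs_varDensityDeriv_le hκ hx (hB x) (hBM x) (hN x) (hNM x) hδM h1 (hball s hs)
      simp only [hF', hK, norm_mul, Real.norm_eq_abs]
      rw [abs_of_pos (by positivity : 0 < 1 / p), abs_of_pos (by positivity : 0 < p / 2),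
        abs_of_pos (Real.rpow_pos_of_pos hpos _)]
      have e3 := Real.rpow_le_rpow hpos.le e1 (by linarith : 0 ≤ p / 2 - 1)
      gcongr
  have hdiff : ∀ᵐ x ∂μ, ∀ s ∈ Metric.ball (0 : ℝ) δ, HasDerivAt (fun s => F s x) (F' s x) s := by
    filter_upwards [hA] with x hx s hs
    have hpos := varDensity_pos hκ hx (hB x) (hBM x) (hN x) (hNM x) hδM hδκ (hball s hs)
    have hy := (one_add_mul_bounds (hB x) (hBM x) hδM (hball s hs)).1
    exact ((hasDerivAt_varDensity (A x) (B x) (N x) (by linarith)).rpow_const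
      (Or.inl hpos.ne')).const_mul _
  have hFi : ∀ s ∈ Metric.ball (0 : ℝ) δ, Integrable (F s) μ := by
    intro s hs
    refine ((hAi.add (integrable_const ((2 * M + 4 * δ * M) ^ (p / 2)))).const_mul
      (1 / p)).mono' (hFm s) ?_
    filter_upwards [hA, hAM] with x hx hx'
    have hpos := varDensity_pos hκ hx (hB x) (hBM x) (hN x) (hNM x) hδM hδκ (hball s hs)
    have hA0 : 0 < A x := hκ.trans_le hx
    simp only [hF, norm_mul, Real.norm_eq_abs, Pi.add_apply]
    rw [abs_of_pos (by positivity : 0 < 1 / p), abs_of_pos (Real.rpow_pos_of_pos hpos _)]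
    refine mul_le_mul_of_nonneg_left ?_ (by positivity)
    rcases hx' with ⟨h1, h2⟩ | h1
    · simp only [varDensity, h1, h2, mul_zero, add_zero, div_one, zero_div]
      have : 0 ≤ (2 * M + 4 * δ * M) ^ (p / 2) := by positivity
      linarith
    · have e1 := varDensity_le (hB x) (hBM x) (hN x) (hNM x) hδM h1 (hball s hs)
      have e2 := Real.rpow_le_rpow hpos.le e1 (by linarith : 0 ≤ p / 2)
      have : 0 ≤ A x ^ (p / 2) := by positivity
      linarith
  have hderiv : ∀ᶠ s in 𝓝 (0 : ℝ), HasDerivAt (fun s => ∫ x, F s x ∂μ) (∫ x, F' s x ∂μ) s := by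
    filter_upwards [Metric.ball_mem_nhds (0 : ℝ) hδ] with s hs
    exact (hasDerivAt_integral_of_dominated_loc_of_deriv_le (Metric.isOpen_ball.mem_nhds hs)
      (.of_forall hFm) (hFi s hs) (hF'm s) hbound (integrable_const K) hdiff).2
  have hcont : ContinuousAt (fun s => ∫ x, F' s x ∂μ) 0 := by
    refine continuousAt_of_dominated (bound := fun _ => K) (.of_forall hF'm) ?_
      (integrable_const K) ?_
    · filter_upwards [Metric.ball_mem_nhds (0 : ℝ) hδ] with s hs
      filter_upwards [hbound] with x hx using hx s hs
    · filter_upwards [hA] with x hx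
      have hpos : varDensity (A x) (B x) (N x) 0 ≠ 0 := by
        simpa [varDensity] using (hκ.trans_le hx).ne'
      have c1 : ContinuousAt (varDensity (A x) (B x) (N x)) 0 :=
        (hasDerivAt_varDensity (A x) (B x) (N x) (by simp)).continuousAt
      have c2 : ContinuousAt (varDensityDeriv (A x) (B x) (N x)) 0 := by
        unfold varDensityDeriv
        fun_prop (disch := simp)
      exact continuousAt_const.mul ((c2.mul continuousAt_const).mul
        (c1.rpow_const (Or.inl hpos)))
  have key := HasSecondDerivAt.of_comp_sq hderiv hcont
  have e1 : 2 * ∫ x, F' 0 x ∂μ = ∫ x, A x ^ ((p - 2) / 2) * (N x - A x * B x) ∂μ := by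
    rw [← integral_const_mul]
    refine integral_congr_ae (.of_forall fun x => ?_)
    simp only [hF', varDensity, varDensityDeriv, zero_mul, add_zero, one_pow, div_one, mul_zero,
      sub_zero]
    rw [show (p - 2) / 2 = p / 2 - 1 by ring]
    field_simp
    ring
  simp only [hF, integral_const_mul] at key
  rw [← e1]
  exact key

end Parametric

/-! ### Variations of the equator map towards the pole -/

section Vertical

open scoped ContDiff

variable {m ℓ : ℕ}

/-- The field that points to the pole of the sphere with length `f`. -/
noncomputable def verticalField (ℓ : ℕ) (f : Dom m → ℝ) (x : Dom m) :
    EuclideanSpace ℝ (Option (Fin ℓ → Fin m)) :=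
  EuclideanSpace.single none (f x)

/-- The factor `1 / |u + t f e|` that normalizes the variation of the equator map `u` in the
direction of the pole `e`. -/
noncomputable def normalizer (f : Dom m → ℝ) (t : ℝ) (x : Dom m) : ℝ :=
  (1 + t ^ 2 * f x ^ 2) ^ (-(1 / 2) : ℝ)

theorem normalizer_sq (f : Dom m → ℝ) (t : ℝ) (x : Dom m) :
    normalizer f t x ^ 2 = (1 + t ^ 2 * f x ^ 2)⁻¹ := by
  rw [normalizer, ← Real.rpow_mul_natCast (by positivity), ← Real.rpow_neg_one]
  norm_num

theorem contDiff_normalizer {f : Dom m → ℝ} (hf : ContDiff ℝ ∞ f) (t : ℝ) :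
    ContDiff ℝ ∞ (normalizer f t) :=
  ContDiff.rpow_const_of_ne (contDiff_const.add (contDiff_const.mul (hf.pow 2)))
    fun x => by positivity

theorem partialDeriv_normalizer {f : Dom m → ℝ} (hf : ContDiff ℝ ∞ f) (t : ℝ) (i : Fin m)
    (x : Dom m) :
    partialDeriv i (normalizer f t) x =
      -(t ^ 2 * f x * partialDeriv i f x) * normalizer f t x ^ 3 := by
  have hpos : 0 < 1 + t ^ 2 * f x ^ 2 := by positivity
  have h1 : HasDerivAt (fun y : ℝ => 1 + t ^ 2 * y ^ 2) (t ^ 2 * (2 * f x)) (f x) := by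
    simpa using ((hasDerivAt_pow 2 (f x)).const_mul (t ^ 2)).const_add 1
  have h2 := h1.rpow_const (p := -(1 / 2)) (Or.inl hpos.ne')
  have h3 : HasFDerivAt (normalizer f t) _ x :=
    HasDerivAt.comp_hasFDerivAt x h2 (hf.differentiable (by simp) x).hasFDerivAt
  have h4 : normalizer f t x ^ 3 = (1 + t ^ 2 * f x ^ 2) ^ (-(1 / 2) - 1 : ℝ) := by
    rw [normalizer, ← Real.rpow_mul_natCast hpos.le]
    norm_num
  rw [partialDeriv_eq_of_hasFDerivAt h3, h4]
  simp only [_root_.smul_apply, smul_eq_mul, partialDeriv]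
  ring

theorem variation_verticalField (hm : 3 ≤ m) (hℓ : 1 ≤ ℓ) (f : Dom m → ℝ) (t : ℝ) {x : Dom m}
    (hx : x ≠ 0) (j : Option (Fin ℓ → Fin m)) :
    variation (equatorMap m ℓ) (verticalField ℓ f) t x j =
      j.elim (normalizer f t x * (t * f x)) fun I => normalizer f t x * projCoord m ℓ I x := by
  have hn : ‖equatorMap m ℓ x + t • verticalField ℓ f x‖⁻¹ = normalizer f t x := by
    have h : ‖equatorMap m ℓ x + t • verticalField ℓ f x‖ ^ 2 = 1 + t ^ 2 * f x ^ 2 := by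
      rw [norm_sq_eq_sum_option]
      simp only [PiLp.add_apply, PiLp.smul_apply, equatorMap_none, equatorMap_some hm hℓ hx,
        verticalField, smul_eq_mul]
      simp only [PiLp.single_apply, if_true, reduceCtorEq, if_false, mul_zero, add_zero, zero_add,
        sum_projCoord_sq hm ℓ hx]
      ring
    refine (sq_eq_sq₀ (inv_nonneg.2 (norm_nonneg _)) (Real.rpow_nonneg (by positivity) _)).1 ?_
    rw [inv_pow, h]
    exact (normalizer_sq f t x).symm
  rw [variation, hn]
  rcases j with _ | I
  · simp [verticalField, equatorMap_none]
  · simp [verticalField, equatorMap_some hm hℓ hx]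

/-- The gradient of the variation of the equator map in the direction of the pole, away from the
origin. -/
noncomputable def variationGrad (ℓ : ℕ) (f : Dom m → ℝ) (t : ℝ) (x : Dom m) :
    Grad m (Option (Fin ℓ → Fin m)) :=
  WithLp.toLp 2 fun i => WithLp.toLp 2 fun j =>
    j.elim (partialDeriv i (fun y => normalizer f t y * (t * f y)) x) fun I =>
      partialDeriv i (normalizer f t) x * projCoord m ℓ I x +
        normalizer f t x * projCoordDeriv m ℓ I i x

theorem hasWeakGrad_variation (hm : 3 ≤ m) (hℓ : 1 ≤ ℓ) {f : Dom m → ℝ} (hf : ContDiff ℝ ∞ f)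
    (t : ℝ) :
    HasWeakGrad (variation (equatorMap m ℓ) (verticalField ℓ f) t) (variationGrad ℓ f t) := by
  have h : ∀ j : Option (Fin ℓ → Fin m), HasWeakPartials
      (fun x => j.elim (normalizer f t x * (t * f x)) fun I =>
        normalizer f t x * projCoord m ℓ I x)
      fun i x => j.elim (partialDeriv i (fun y => normalizer f t y * (t * f y)) x) fun I =>
        partialDeriv i (normalizer f t) x * projCoord m ℓ I x +
          normalizer f t x * projCoordDeriv m ℓ I i x := by
    rintro (_ | I)
    · exact hasWeakPartials_of_contDiff
        ((contDiff_normalizer hf t).mul (contDiff_const.mul hf))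
    · exact (hasWeakPartials_projCoord hm I).contDiff_mul (contDiff_normalizer hf t)
  refine hasWeakGrad_of_hasWeakPartials h ?_
  filter_upwards [ae_ne_zero (show 0 < m by omega)] with x hx j
  exact variation_verticalField hm hℓ f t hx j

/-- The cross terms vanish since the pole is orthogonal to the equator and the derivatives of `u` are
orthogonal to `u`. -/
theorem norm_variationGrad_sq (hm : 3 ≤ m) (hℓ : 1 ≤ ℓ) {f : Dom m → ℝ} (hf : ContDiff ℝ ∞ f)
    (t : ℝ) {x : Dom m} (hx : x ≠ 0) :
    ‖variationGrad ℓ f t x‖ ^ 2 =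
      varDensity (eigenval m ℓ / ‖x‖ ^ 2) (f x ^ 2) (∑ i, partialDeriv i f x ^ 2) (t ^ 2) := by
  have hsq := normalizer_sq f t x
  have hpos : 0 < 1 + t ^ 2 * f x ^ 2 := by positivity
  set n := normalizer f t x with hn
  have hn1 : n ^ 2 * (1 + t ^ 2 * f x ^ 2) = 1 := by
    rw [hsq, inv_mul_cancel₀ hpos.ne']
  have hz : ∀ i, partialDeriv i (fun y => normalizer f t y * (t * f y)) x =
      t * partialDeriv i f x * n ^ 3 := by
    intro i
    have h1 := partialDeriv_mul ((contDiff_normalizer hf t).differentiable (by simp) x)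
      ((contDiff_const (c := t)).mul hf |>.differentiable (by simp) x) i
    have h2 := partialDeriv_mul (differentiableAt_const t) (hf.differentiable (by simp) x) i
    have h3 : partialDeriv i (fun _ : Dom m => t) x = 0 := by simp [partialDeriv]
    rw [h3, zero_mul, add_zero] at h2
    rw [h1, h2, partialDeriv_normalizer hf, ← hn]
    linear_combination (-(n * t * partialDeriv i f x)) * hn1
  have hI : ∀ i, ∑ I, (partialDeriv i (normalizer f t) x * projCoord m ℓ I x +
      n * projCoordDeriv m ℓ I i x) ^ 2 =
      (t ^ 2 * f x * n ^ 3) ^ 2 * partialDeriv i f x ^ 2 +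
        n ^ 2 * ∑ I, projCoordDeriv m ℓ I i x ^ 2 := by
    intro i
    have h1 : ∀ I, (partialDeriv i (normalizer f t) x * projCoord m ℓ I x +
        n * projCoordDeriv m ℓ I i x) ^ 2 =
        partialDeriv i (normalizer f t) x ^ 2 * projCoord m ℓ I x ^ 2 +
        2 * partialDeriv i (normalizer f t) x * n *
          (projCoord m ℓ I x * projCoordDeriv m ℓ I i x) +
        n ^ 2 * projCoordDeriv m ℓ I i x ^ 2 := fun I => by ring
    rw [Finset.sum_congr rfl fun I _ => h1 I]
    simp only [Finset.sum_add_distrib, ← Finset.mul_sum, sum_projCoord_sq hm ℓ hx,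
      sum_projCoord_mul_projCoordDeriv hm hℓ hx]
    rw [partialDeriv_normalizer hf, ← hn]
    ring
  have hmain : ‖variationGrad ℓ f t x‖ ^ 2 =
      ∑ i, ((t * partialDeriv i f x * n ^ 3) ^ 2 + ((t ^ 2 * f x * n ^ 3) ^ 2 *
        partialDeriv i f x ^ 2 + n ^ 2 * ∑ I, projCoordDeriv m ℓ I i x ^ 2)) := by
    rw [grad_norm_sq]
    refine Finset.sum_congr rfl fun i _ => ?_
    rw [Fintype.sum_option]
    simp only [variationGrad, Option.elim_none, Option.elim_some]
    rw [hz, ← hn, hI]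
  have hterm : ∀ i, (t * partialDeriv i f x * n ^ 3) ^ 2 + ((t ^ 2 * f x * n ^ 3) ^ 2 *
        partialDeriv i f x ^ 2 + n ^ 2 * ∑ I, projCoordDeriv m ℓ I i x ^ 2) =
      t ^ 2 * n ^ 4 * partialDeriv i f x ^ 2 + n ^ 2 * ∑ I, projCoordDeriv m ℓ I i x ^ 2 :=
    fun i => by linear_combination (t ^ 2 * n ^ 4 * partialDeriv i f x ^ 2) * hn1
  rw [hmain]
  simp only [hterm, Finset.sum_add_distrib, ← Finset.mul_sum, sum_projCoordDeriv_sq hm hℓ hx]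
  rw [varDensity, show n ^ 4 = (n ^ 2) ^ 2 by ring, hsq]
  field_simp
  ring

theorem isVariationField_verticalField (p : ℝ) {f : Dom m → ℝ} (hf : ContDiff ℝ ∞ f)
    (hc : HasCompactSupport f) (hs : tsupport f ⊆ (ball m : Set (Dom m))) :
    IsVariationField p (verticalField ℓ f) := by
  have hcd : ContDiff ℝ ∞ (verticalField ℓ f) := by
    refine (contDiff_piLp 2).2 fun j => ?_
    rcases j with _ | I
    · simpa [verticalField] using hf
    · simpa [verticalField] using contDiff_const
  have hsub : tsupport (verticalField ℓ f) ⊆ tsupport f := by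
    refine closure_mono fun x hx => ?_
    simp only [Function.mem_support] at hx ⊢
    exact fun h => hx (by simp [verticalField, h])
  let φ : 𝓓(ball m, EuclideanSpace ℝ (Option (Fin ℓ → Fin m))) :=
    ⟨verticalField ℓ f, hcd, hc.of_isClosed_subset (isClosed_tsupport _) hsub, hsub.trans hs⟩
  have hgc : HasCompactSupport (classicalGrad φ) := by
    refine HasCompactSupport.of_support_subset_isCompact φ.hasCompactSupport fun x hx => ?_
    by_contra h
    refine hx ?_
    ext i j
    simp [classicalGrad, partialDeriv_eq_zero_of_notMem_tsupport h]
  have hw : HasWeakGrad (verticalField ℓ f) (classicalGrad φ) := by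
    have h := hasWeakGrad_of_hasWeakPartials (u := verticalField ℓ f)
      (fun j => hasWeakPartials_of_contDiff (TestFunction.contDiff_apply φ j))
      (.of_forall fun x j => rfl)
    have e : (fun x => WithLp.toLp 2 fun i => WithLp.toLp 2 fun j =>
        partialDeriv i (fun y => φ y j) x) = classicalGrad φ := by
      ext x i j
      rw [TestFunction.classicalGrad_apply]
    rwa [e] at h
  obtain ⟨C, hC⟩ := φ.continuous.bounded_above_of_compact_support φ.hasCompactSupport
  refine ⟨⟨?_, classicalGrad φ, hw, ?_, fun _ => φ, ?_, ?_⟩, C, .of_forall hC⟩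
  · exact (φ.continuous.memLp_of_hasCompactSupport φ.hasCompactSupport).restrict _
  · exact ((contDiff_classicalGrad φ).continuous.memLp_of_hasCompactSupport hgc).restrict _
  · have e : (fun x => φ x - verticalField ℓ f x) = 0 := by
      ext1 x
      exact sub_self _
    simp [e]
  · simp

/-- The second variation of the energy at the equator map in the direction of the pole. -/
theorem hasSecondDerivAt_energy_variation (hm : 3 ≤ m) (hℓ : 1 ≤ ℓ) {p : ℝ} (hp : 2 ≤ p)
    (hpm : p < m) {f : Dom m → ℝ} (hf : ContDiff ℝ ∞ f) (hc : HasCompactSupport f)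
    (h0 : (0 : Dom m) ∉ tsupport f) :
    HasSecondDerivAt (fun t => energy p (variation (equatorMap m ℓ) (verticalField ℓ f) t))
      (eigenval m ℓ ^ ((p - 2) / 2) * ∫ x, ‖x‖ ^ (2 - p) *
        (∑ i, partialDeriv i f x ^ 2 - eigenval m ℓ / ‖x‖ ^ 2 * f x ^ 2) ∂(ballMeasure m)) 0 := by
  have hm0 : 0 < m := by omega
  have hlam := eigenval_pos hm hℓ
  have hNc : Continuous fun x => ∑ i, partialDeriv i f x ^ 2 :=
    continuous_finsetSum _ fun i _ => (contDiff_partialDeriv hf i).continuous.pow 2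
  have hBc : Continuous fun x => f x ^ 2 := hf.continuous.pow 2
  have hN0 : ∀ x, x ∉ tsupport f → ∑ i, partialDeriv i f x ^ 2 = 0 := fun x hx => by
    simp [partialDeriv_eq_zero_of_notMem_tsupport hx]
  have hB0 : ∀ x, x ∉ tsupport f → f x ^ 2 = 0 := fun x hx => by
    simp [image_eq_zero_of_notMem_tsupport hx]
  obtain ⟨M1, hM1⟩ := hBc.bounded_above_of_compact_support
    (HasCompactSupport.of_support_subset_isCompact hc fun x hx => by
      by_contra h; exact hx (hB0 x h))
  obtain ⟨M2, hM2⟩ := hNc.bounded_above_of_compact_support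
    (HasCompactSupport.of_support_subset_isCompact hc fun x hx => by
      by_contra h; exact hx (hN0 x h))
  obtain ⟨ρ, hρ, hρs⟩ := Metric.isOpen_iff.1 (isClosed_tsupport f).isOpen_compl 0 h0
  have hA : ∀ᵐ x ∂(ballMeasure m), eigenval m ℓ ≤ eigenval m ℓ / ‖x‖ ^ 2 := by
    filter_upwards [ballMeasure_ae_ne_zero hm0, ballMeasure_ae_norm_lt_one] with x hx hx1
    have hr : 0 < ‖x‖ := norm_pos_iff.2 hx
    rw [le_div_iff₀ (by positivity)]
    have : ‖x‖ ^ 2 ≤ 1 := pow_le_one₀ hr.le hx1.le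
    nlinarith
  have hAM : ∀ x, (f x ^ 2 = 0 ∧ ∑ i, partialDeriv i f x ^ 2 = 0) ∨
      eigenval m ℓ / ‖x‖ ^ 2 ≤ eigenval m ℓ / ρ ^ 2 := by
    intro x
    by_cases hx : x ∈ tsupport f
    · right
      have : ρ ≤ ‖x‖ := by
        by_contra! hlt
        exact hρs (by simpa using hlt) hx
      gcongr
    · exact Or.inl ⟨hB0 x hx, hN0 x hx⟩
  set M := max (max M1 M2) (eigenval m ℓ / ρ ^ 2) with hM
  have hMpos : 0 < M := lt_of_lt_of_le (by positivity) (le_max_right _ _)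
  have hpow : ∀ (x : Dom m) (s : ℝ), x ≠ 0 → (eigenval m ℓ / ‖x‖ ^ 2) ^ (s / 2) =
      eigenval m ℓ ^ (s / 2) * ‖x‖ ^ (-s) := fun x s hx => by
    rw [Real.div_rpow hlam.le (by positivity), norm_sq_rpow_half, Real.rpow_neg (norm_nonneg x),
      div_eq_mul_inv]
  have key := hasSecondDerivAt_integral_varDensity (μ := ballMeasure m)
    (A := fun x => eigenval m ℓ / ‖x‖ ^ 2) (B := fun x => f x ^ 2)
    (N := fun x => ∑ i, partialDeriv i f x ^ 2) (M := M) hp hlam hMpos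
    (measurable_const.div (measurable_norm.pow_const 2)) hBc.measurable hNc.measurable hA
    (fun x => by positivity)
    (fun x => (le_abs_self _).trans ((hM1 x).trans ((le_max_left _ _).trans (le_max_left _ _))))
    (fun x => by positivity)
    (fun x => (le_abs_self _).trans ((hM2 x).trans ((le_max_right _ _).trans (le_max_left _ _))))
    (.of_forall fun x => (hAM x).imp_right fun h => h.trans (le_max_right _ _))
    (by
      refine ((integrable_norm_rpow (m := m) (s := -p) hm0 (by linarith)).const_mul
        (eigenval m ℓ ^ (p / 2))).congr ?_
      filter_upwards [ballMeasure_ae_ne_zero hm0] with x hx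
      exact (hpow x p hx).symm)
  have e1 : (fun t => energy p (variation (equatorMap m ℓ) (verticalField ℓ f) t)) =
      fun t => 1 / p * ∫ x, varDensity (eigenval m ℓ / ‖x‖ ^ 2) (f x ^ 2)
        (∑ i, partialDeriv i f x ^ 2) (t ^ 2) ^ (p / 2) ∂(ballMeasure m) := by
    ext t
    rw [energy_eq (hasWeakGrad_variation hm hℓ hf t)]
    congr 1
    refine integral_congr_ae ?_
    filter_upwards [ballMeasure_ae_ne_zero hm0] with x hx
    rw [← norm_variationGrad_sq hm hℓ hf t hx, ← Real.rpow_natCast_mul (norm_nonneg _)]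
    congr 1
    push_cast
    ring
  rw [e1, ← integral_const_mul]
  refine (congrArg (fun c => HasSecondDerivAt _ c 0) ?_).mp key
  refine integral_congr_ae ?_
  filter_upwards [ballMeasure_ae_ne_zero hm0] with x hx
  rw [hpow x (p - 2) hx, neg_sub, mul_assoc]

end Vertical

/-! ### Functions of `log |x|` and the sharpness of the Hardy constant -/

section Sharpness

open scoped ContDiff

variable {m ℓ : ℕ}

/-- The radial function `x ↦ K (log |x|)`. If `K` is supported in a bounded interval to the left of
`0`, it is a test function on the punctured ball; its value at the origin is then `K 0 = 0`. -/
noncomputable def logRadial (m : ℕ) (K : ℝ → ℝ) (x : Dom m) : ℝ := K (Real.log ‖x‖)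

theorem tsupport_logRadial_subset {K : ℝ → ℝ} {b c : ℝ} (hc : 0 < c)
    (hK : Function.support K ⊆ Set.Icc (-b) (-c)) :
    tsupport (logRadial m K) ⊆ {x | Real.exp (-b) ≤ ‖x‖ ∧ ‖x‖ ≤ Real.exp (-c)} := by
  refine closure_minimal (fun x hx => ?_) ((isClosed_le continuous_const continuous_norm).inter
    (isClosed_le continuous_norm continuous_const))
  have h := hK (show Real.log ‖x‖ ∈ Function.support K from hx)
  have h0 : 0 < ‖x‖ := by
    refine norm_pos_iff.2 fun h0 => ?_
    rw [h0, norm_zero, Real.log_zero] at h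
    linarith [h.2]
  exact ⟨(Real.le_log_iff_exp_le h0).1 h.1, (Real.log_le_iff_le_exp h0).1 h.2⟩

theorem zero_notMem_tsupport_logRadial {K : ℝ → ℝ} {b c : ℝ} (hc : 0 < c)
    (hK : Function.support K ⊆ Set.Icc (-b) (-c)) : (0 : Dom m) ∉ tsupport (logRadial m K) := by
  intro h
  have := (tsupport_logRadial_subset hc hK h).1
  rw [norm_zero] at this
  exact (Real.exp_pos _).not_ge this

theorem hasCompactSupport_logRadial {K : ℝ → ℝ} {b c : ℝ} (hc : 0 < c)
    (hK : Function.support K ⊆ Set.Icc (-b) (-c)) : HasCompactSupport (logRadial m K) :=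
  (isCompact_closedBall (0 : Dom m) (Real.exp (-c))).of_isClosed_subset (isClosed_tsupport _)
    fun x hx => by simpa using (tsupport_logRadial_subset hc hK hx).2

theorem tsupport_logRadial_subset_ball {K : ℝ → ℝ} {b c : ℝ} (hc : 0 < c)
    (hK : Function.support K ⊆ Set.Icc (-b) (-c)) :
    tsupport (logRadial m K) ⊆ (ball m : Set (Dom m)) := fun x hx => by
  have h1 := (tsupport_logRadial_subset hc hK hx).2
  have h2 : Real.exp (-c) < 1 := by simpa using hc
  simpa [ball] using h1.trans_lt h2

theorem contDiff_logRadial {K : ℝ → ℝ} {b c : ℝ} (hc : 0 < c)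
    (hK : Function.support K ⊆ Set.Icc (-b) (-c)) (hs : ContDiff ℝ ∞ K) :
    ContDiff ℝ ∞ (logRadial m K) := by
  refine contDiff_iff_contDiffAt.2 fun x => ?_
  rcases eq_or_ne x 0 with rfl | hx
  · exact contDiffAt_const.congr_of_eventuallyEq
      (notMem_tsupport_iff_eventuallyEq.1 (zero_notMem_tsupport_logRadial hc hK))
  · exact hs.contDiffAt.comp x ((contDiffAt_norm ℝ hx).log (norm_ne_zero_iff.2 hx))

theorem sum_partialDeriv_logRadial_sq {K : ℝ → ℝ} (hs : ContDiff ℝ ∞ K) {x : Dom m}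
    (hx : x ≠ 0) :
    ∑ i, partialDeriv i (logRadial m K) x ^ 2 = deriv K (Real.log ‖x‖) ^ 2 / ‖x‖ ^ 2 := by
  have hr : 0 < ‖x‖ := norm_pos_iff.2 hx
  have h1 : HasFDerivAt (fun y : Dom m => Real.log ‖y‖) ((1 / ‖x‖ ^ 2) • innerSL ℝ x) x := by
    have h := ((hasStrictFDerivAt_norm_sq x).hasFDerivAt.log (by positivity)).const_mul (1 / 2)
    have e : (fun y : Dom m => Real.log ‖y‖) = fun y => 1 / 2 * Real.log (‖y‖ ^ 2) := by
      ext y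
      rw [Real.log_pow]
      push_cast
      ring
    rw [e]
    refine h.congr_fderiv ?_
    ext v
    simp
    ring
  have h2 : HasFDerivAt (logRadial m K) _ x :=
    ((hs.differentiable (by simp) (Real.log ‖x‖)).hasDerivAt).comp_hasFDerivAt x h1
  have h3 : ∀ i, partialDeriv i (logRadial m K) x ^ 2 =
      (deriv K (Real.log ‖x‖) / ‖x‖ ^ 2) ^ 2 * x i ^ 2 := fun i => by
    rw [partialDeriv_eq_of_hasFDerivAt h2]
    simp [EuclideanSpace.inner_single_right]
    ring
  simp only [h3, ← Finset.mul_sum]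
  have h4 : ∑ i, x i ^ 2 = ‖x‖ ^ 2 := by rw [EuclideanSpace.real_norm_sq_eq]
  rw [h4]
  field_simp

/-- Integration of a radial function in the logarithmic variable `τ = log |x|`. -/
theorem integral_radial_eq (hm : 0 < m) (h : ℝ → ℝ) :
    ∫ x : Dom m, h ‖x‖ = m * volume.real (Metric.ball (0 : Dom m) 1) *
      ∫ τ : ℝ, Real.exp (m * τ) * h (Real.exp τ) := by
  have : Nonempty (Fin m) := ⟨⟨0, hm⟩⟩
  have h1 := integral_image_eq_integral_abs_deriv_smul MeasurableSet.univ
    (fun τ _ => (Real.hasDerivAt_exp τ).hasDerivWithinAt) Real.exp_injective.injOn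
    (fun y : ℝ => y ^ (m - 1) • h y)
  rw [Set.image_univ, Real.range_exp, setIntegral_univ] at h1
  rw [integral_fun_norm_addHaar volume h, finrank_euclideanSpace_fin, h1, nsmul_eq_mul,
    smul_eq_mul, mul_assoc]
  congr 2
  refine integral_congr_ae (.of_forall fun τ => ?_)
  obtain ⟨n, rfl⟩ : ∃ n, m = n + 1 := ⟨m - 1, by omega⟩
  simp only [smul_eq_mul, abs_of_pos (Real.exp_pos τ), Nat.add_sub_cancel]
  rw [Real.exp_nat_mul, pow_succ]
  ring

/-- In logarithmic coordinates, the conjugation with `|x|^{-a}`, where `2 a = m - p`, turns the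
weighted Hardy quadratic form into one with constant coefficients on the line. -/
theorem integral_hardy_logRadial (hm : 0 < m) {p a l : ℝ} (ha : 2 * a = m - p) {g : ℝ → ℝ}
    (hg : ContDiff ℝ ∞ g) {b c : ℝ} (hc : 0 < c) (hs : Function.support g ⊆ Set.Icc (-b) (-c)) :
    ∫ x, ‖x‖ ^ (2 - p) * (∑ i, partialDeriv i
        (logRadial m fun τ => Real.exp (-a * τ) * g τ) x ^ 2 -
          l / ‖x‖ ^ 2 * logRadial m (fun τ => Real.exp (-a * τ) * g τ) x ^ 2) ∂(ballMeasure m) =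
      m * volume.real (Metric.ball (0 : Dom m) 1) *
        ∫ τ, ((deriv g τ - a * g τ) ^ 2 - l * g τ ^ 2) := by
  set K : ℝ → ℝ := fun τ => Real.exp (-a * τ) * g τ with hKdef
  have hK : ContDiff ℝ ∞ K := by
    refine ContDiff.mul ?_ hg
    exact Real.contDiff_exp.comp (contDiff_const.mul contDiff_id)
  have hKs : Function.support K ⊆ Set.Icc (-b) (-c) := fun τ hτ =>
    hs fun h => hτ (by simp [hKdef, h])
  have hK' : ∀ τ, deriv K τ = Real.exp (-a * τ) * (deriv g τ - a * g τ) := fun τ => by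
    have h1 : HasDerivAt (fun τ : ℝ => Real.exp (-a * τ)) (Real.exp (-a * τ) * (-a * 1)) τ :=
      ((hasDerivAt_id τ).const_mul (-a)).exp
    refine ((h1.mul (hg.differentiable (by simp) τ).hasDerivAt).congr_deriv ?_).deriv
    ring
  have hz : ∀ x, x ∉ (ball m : Set (Dom m)) → x ∉ tsupport (logRadial m K) := fun x hx h =>
    hx (tsupport_logRadial_subset_ball hc hKs h)
  rw [integral_ballMeasure_eq fun x hx => by
    simp [partialDeriv_eq_zero_of_notMem_tsupport (hz x hx),
      image_eq_zero_of_notMem_tsupport (hz x hx)]]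
  have h1 : ∫ x, ‖x‖ ^ (2 - p) * (∑ i, partialDeriv i (logRadial m K) x ^ 2 -
      l / ‖x‖ ^ 2 * logRadial m K x ^ 2) =
      ∫ x : Dom m, (fun r => r ^ (-p) * (deriv K (Real.log r) ^ 2 - l * K (Real.log r) ^ 2))
        ‖x‖ := by
    refine integral_congr_ae ?_
    filter_upwards [ae_ne_zero hm] with x hx
    have hr : 0 < ‖x‖ := norm_pos_iff.2 hx
    rw [sum_partialDeriv_logRadial_sq hK hx, logRadial, sub_eq_add_neg 2 p, Real.rpow_add hr,
      Real.rpow_two]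
    field_simp
  rw [h1, integral_radial_eq hm fun r =>
    r ^ (-p) * (deriv K (Real.log r) ^ 2 - l * K (Real.log r) ^ 2)]
  congr 1
  refine integral_congr_ae (.of_forall fun τ => ?_)
  simp only [Real.log_exp]
  rw [hK', ← Real.exp_mul]
  have e1 : Real.exp (m * τ) * Real.exp (τ * -p) * Real.exp (-a * τ) ^ 2 = 1 := by
    rw [← Real.exp_nat_mul, ← Real.exp_add, ← Real.exp_add, Real.exp_eq_one_iff]
    push_cast
    linear_combination (-τ) * ha
  simp only [hKdef]
  linear_combination ((deriv g τ - a * g τ) ^ 2 - l * g τ ^ 2) * e1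

/-- A bump function that is stretched enough makes the derivative term negligible. -/
theorem exists_integral_neg {a l : ℝ} (hal : a ^ 2 < l) :
    ∃ g : ℝ → ℝ, ∃ b c : ℝ, 0 < c ∧ ContDiff ℝ ∞ g ∧ Function.support g ⊆ Set.Icc (-b) (-c) ∧
      ∫ τ, ((deriv g τ - a * g τ) ^ 2 - l * g τ ^ 2) < 0 := by
  let G : ContDiffBump (-2 : ℝ) := ⟨1 / 2, 1, by norm_num, by norm_num⟩
  have hG : ContDiff ℝ ∞ G := G.contDiff
  have hGs : HasCompactSupport G := G.hasCompactSupport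
  have hd : Differentiable ℝ G := hG.differentiable (by simp)
  have hG' : Continuous (deriv G) := hG.continuous_deriv (by simp)
  have hGs' : HasCompactSupport (deriv G) := hGs.deriv
  have i1 : Integrable fun s => G s * deriv G s :=
    (hG.continuous.mul hG').integrable_of_hasCompactSupport hGs.mul_right
  have i2 : Integrable fun s => G s ^ 2 := by
    simp only [sq]
    exact (hG.continuous.mul hG.continuous).integrable_of_hasCompactSupport hGs.mul_right
  have i3 : Integrable fun s => deriv G s ^ 2 := by
    simp only [sq]
    exact (hG'.mul hG').integrable_of_hasCompactSupport hGs'.mul_right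
  have z1 : ∫ s, G s * deriv G s = 0 := by
    refine integral_eq_zero_of_hasDerivAt_of_integrable (f := fun s => G s ^ 2 / 2)
      (fun s => ?_) i1 (i2.div_const 2)
    refine (((hd s).hasDerivAt.pow 2).div_const 2).congr_deriv ?_
    simp
    ring
  have z2 : 0 < ∫ s, G s ^ 2 := by
    refine (hG.continuous.pow 2).integral_pos_of_hasCompactSupport_nonneg_nonzero
      (x := -2) ?_ (fun s => sq_nonneg _) ?_
    · simp only [sq]
      exact hGs.mul_right
    · rw [G.one_of_mem_closedBall (Metric.mem_closedBall_self (by norm_num))]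
      norm_num
  set I0 := ∫ s, G s ^ 2
  set I1 := ∫ s, deriv G s ^ 2
  obtain ⟨L, hL1, hL⟩ : ∃ L : ℝ, 1 ≤ L ∧ I1 / L ^ 2 < (l - a ^ 2) * I0 := by
    have h0 : 0 < (l - a ^ 2) * I0 := mul_pos (by linarith) z2
    have ht : Tendsto (fun L : ℝ => I1 / L ^ 2) atTop (𝓝 0) :=
      tendsto_const_nhds.div_atTop (tendsto_pow_atTop two_ne_zero)
    obtain ⟨L, h1, h2⟩ := ((eventually_ge_atTop 1).and (ht.eventually_lt_const h0)).exists
    exact ⟨L, h1, h2⟩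
  have hL0 : 0 < L := by linarith
  refine ⟨fun τ => G (τ / L), 3 * L, L, hL0, hG.comp (contDiff_id.div_const L), ?_, ?_⟩
  · intro τ hτ
    have h : τ / L ∈ Function.support G := hτ
    rw [G.support_eq, Real.ball_eq_Ioo] at h
    have h1 := (lt_div_iff₀ hL0).1 h.1
    have h2 := (div_lt_iff₀ hL0).1 h.2
    have e : G.rOut = 1 := rfl
    rw [e] at h1 h2
    constructor <;> linarith
  · have hderiv : ∀ τ, deriv (fun τ => G (τ / L)) τ = deriv G (τ / L) / L := fun τ => by
      have := (hd (τ / L)).hasDerivAt.comp τ ((hasDerivAt_id τ).div_const L)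
      simpa [Function.comp_def, div_eq_mul_inv] using this.deriv
    have e : ∀ τ, (deriv (fun τ => G (τ / L)) τ - a * G (τ / L)) ^ 2 - l * G (τ / L) ^ 2 =
        (fun s => 1 / L ^ 2 * deriv G s ^ 2 - 2 * a / L * (G s * deriv G s) -
          (l - a ^ 2) * G s ^ 2) (τ / L) := fun τ => by
      rw [hderiv]
      field_simp
      ring
    have j : Integrable fun s => 1 / L ^ 2 * deriv G s ^ 2 - 2 * a / L * (G s * deriv G s) :=
      (i3.const_mul _).sub (i1.const_mul _)
    simp only [e]
    rw [Measure.integral_comp_div (fun s => 1 / L ^ 2 * deriv G s ^ 2 -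
        2 * a / L * (G s * deriv G s) - (l - a ^ 2) * G s ^ 2),
      integral_sub j (i2.const_mul _), integral_sub (i3.const_mul _) (i1.const_mul _)]
    simp only [integral_const_mul, z1, smul_eq_mul, abs_of_pos hL0]
    refine mul_neg_of_pos_of_neg hL0 ?_
    have : 1 / L ^ 2 * I1 = I1 / L ^ 2 := by ring
    linarith

/-- For `4 λ > (m - p)²` the Hardy quadratic form with constant `λ` is negative on some radial test
function, and the variation towards the pole by this function decreases the energy. -/
theorem isUnstablePHarmonic_equatorMap (hm : 3 ≤ m) (hℓ : 1 ≤ ℓ) {p : ℝ} (hp : 2 ≤ p)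
    (hpm : p < m) (hstab : (m - p) ^ 2 < 4 * eigenval m ℓ) :
    IsUnstablePHarmonic p (equatorMap m ℓ) := by
  have hm0 : 0 < m := by omega
  obtain ⟨g, b, c, hc, hg, hs, hneg⟩ :=
    exists_integral_neg (a := (m - p) / 2) (l := eigenval m ℓ) (by nlinarith)
  set K : ℝ → ℝ := fun τ => Real.exp (-((m - p) / 2) * τ) * g τ with hKdef
  have hK : ContDiff ℝ ∞ K :=
    ContDiff.mul (Real.contDiff_exp.comp (contDiff_const.mul contDiff_id)) hg
  have hKs : Function.support K ⊆ Set.Icc (-b) (-c) := fun τ hτ =>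
    hs fun h => hτ (by simp [hKdef, h])
  refine ⟨isPHarmonic_equatorMap hm hℓ hp hpm, fun hst => ?_⟩
  have hf := contDiff_logRadial (m := m) hc hKs hK
  have hcs := hasCompactSupport_logRadial (m := m) hc hKs
  refine absurd (hst _ (isVariationField_verticalField (ℓ := ℓ) p hf hcs
    (tsupport_logRadial_subset_ball hc hKs)) _ (hasSecondDerivAt_energy_variation hm hℓ hp hpm hf
      hcs (zero_notMem_tsupport_logRadial hc hKs))) (not_le.2 ?_)
  rw [integral_hardy_logRadial hm0 (by ring) hg hc hs]
  have hv : 0 < volume.real (Metric.ball (0 : Dom m) 1) :=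
    ENNReal.toReal_pos (Metric.measure_ball_pos _ _ one_pos).ne' measure_ball_lt_top.ne
  have hm1 : (0 : ℝ) < m := by exact_mod_cast hm0
  exact mul_neg_of_pos_of_neg (Real.rpow_pos_of_pos (eigenval_pos hm hℓ) _)
    (mul_neg_of_pos_of_neg (mul_pos hm1 hv) hneg)

end Sharpness

end EquatorMap

theorem mainTheorem3 (m ℓ : ℕ) (p : ℝ) (hℓ : 1 ≤ ℓ) (hp : 2 ≤ p) (hpm : p < (m : ℝ)) :
    (((m : ℝ) - p) ^ 2 < 4 * (ℓ : ℝ) * ((ℓ : ℝ) + (m : ℝ) - 2) →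
      EquatorMap.IsUnstablePHarmonic p (EquatorMap.equatorMap m ℓ)) ∧
    (4 * (ℓ : ℝ) * ((ℓ : ℝ) + (m : ℝ) - 2) ≤ ((m : ℝ) - p) ^ 2 →
      EquatorMap.IsUniqueMinimizer p (EquatorMap.equatorMap m ℓ)) := by
  have hm : 3 ≤ m := by
    have h : (2 : ℝ) < m := hp.trans_lt hpm
    exact_mod_cast h
  have e : 4 * (ℓ : ℝ) * ((ℓ : ℝ) + (m : ℝ) - 2) = 4 * EquatorMap.eigenval m ℓ := by
    rw [EquatorMap.eigenval]
    ring
  rw [e]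
  exact ⟨EquatorMap.isUnstablePHarmonic_equatorMap hm hℓ hp hpm,
    EquatorMap.isUniqueMinimizer_equatorMap hm hℓ hp hpm⟩
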